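/- Let $k$ be a commutative ring, let $A$ and $B$ be $k$-algebras (associative, unital), let $\mathfrak C$ be an $A$-coring and $\mathfrak D$ a $B$-coring, with comultiplications $\Delta$ and counits $\epsilon$, and write $\mathcal M^{\mathfrak C}$, $\mathcal M^{\mathfrak D}$ for their categories of right comodules and $\mathcal M_A$ for the category of right $A$-modules. Let $(\varphi,\rho):\mathfrak C\to\mathfrak D$ be a homomorphism of corings, i.e. $\rho:A\to B$ is a homomorphism of $k$-algebras and $\varphi:\mathfrak C\to\mathfrak D$ is a homomorphism of $A$-bimodules with $\epsilon_{\mathfrak D}\circ\varphi=\rho\circ\epsilon_{\mathfrak C}$ and $\Delta_{\mathfrak D}\circ\varphi=\omega\circ(\varphi\otimes_A\varphi)\circ\Delta_{\mathfrak C}$, where $\omega:\mathfrak D\otimes_A\mathfrak D\to\mathfrak D\otimes_B\mathfrak D$ is the canonical map. Assume that the left modules ${}_A\mathfrak C$ and ${}_B\mathfrak D$ are flat. The induction functor $-\otimes_AB:\mathcal M^{\mathfrak C}\to\mathcal M^{\mathfrak D}$ sends $M$ to $M\otimes_AB$ with coaction $m\otimes b\mapsto\sum m_{(0)}\otimes 1\otimes_B\varphi(m_{(1)})b$.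 The $\mathfrak C$-$\mathfrak D$-bicomodule $\mathfrak C\otimes_AB$ carries this right coaction and the left coaction $\Delta_{\mathfrak C}\otimes_AB$; the $\mathfrak D$-$\mathfrak C$-bicomodule $B\otimes_A\mathfrak C$ carries the left coaction $b\otimes c\mapsto\sum b\varphi(c_{(1)})\otimes_B1\otimes c_{(2)}$ and the right coaction $B\otimes_A\Delta_{\mathfrak C}$. A functor is Frobenius if it has a right adjoint which is also a left adjoint of it. A $\mathfrak C$-$\mathfrak D$-bicomodule $N$ is quasi-finite as a right $\mathfrak D$-comodule if $-\otimes_AN:\mathcal M_A\to\mathcal M^{\mathfrak D}$ has a left adjoint $h_{\mathfrak D}(N,-)$, and is an injector as a right $\mathfrak D$-comodule if $-\otimes_AN:\mathcal M_A\to\mathcal M^{\mathfrak D}$ preserves injective objects. If $N$ is quasi-finite, then $h_{\mathfrak D}(N,\mathfrak D)$ is a $\mathfrak D$-$\mathfrak C$-bicomodule: $b\in B$ acts by $h_{\mathfrak D}(N,-)$ applied to left multiplication by $b$ on $\mathfrak D$; the left coaction is $h_{\mathfrak D}(N,\mathfrak D)\xrightarrow{h_{\mathfrak D}(N,\Delta)}h_{\mathfrak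 D}(N,\mathfrak D\otimes_B\mathfrak D)\cong\mathfrak D\otimes_Bh_{\mathfrak D}(N,\mathfrak D)$; the right coaction corresponds by adjunction to the composite $\mathfrak D\to h_{\mathfrak D}(N,\mathfrak D)\otimes_AN\to h_{\mathfrak D}(N,\mathfrak D)\otimes_A\mathfrak C\otimes_AN$ of the unit and the left coaction of $N$. Then the following are equivalent: (a) $-\otimes_AB:\mathcal M^{\mathfrak C}\to\mathcal M^{\mathfrak D}$ is a Frobenius functor; (b) $\mathfrak C\otimes_AB$ is quasi-finite and an injector as a right $\mathfrak D$-comodule, and there is an isomorphism of $\mathfrak D$-$\mathfrak C$-bicomodules $h_{\mathfrak D}(\mathfrak C\otimes_AB,\mathfrak D)\simeq B\otimes_A\mathfrak C$. Moreover, if $\mathfrak C$ and $\mathfrak D$ are coseparable (that is, their comultiplications are split monomorphisms of bicomodules), then the condition "injector" in (b) can be deleted: (a) holds if and only if $\mathfrak C\otimes_AB$ is quasi-finite as a right $\mathfrak D$-comodule and $h_{\mathfrak D}(\mathfrak C\otimes_AB,\mathfrak D)\simeq B\otimes_A\mathfrak C$ as $\mathfrak D$-$\mathfrak C$-bicomodules.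 -/

import Mathlib

/-! Corings over noncommutative rings, their comodules and bicomodules, induction functors and
co-hom functors. -/

universe u

open CategoryTheory MulOpposite
open scoped TensorProduct

namespace Corings

noncomputable section

/-! ### Bimodules and tensor products over a noncommutative ring

A right `A`-module is a module over `Aᵐᵒᵖ`, and an `A`-`B`-bimodule is a left `A`-module and right
`B`-module with commuting actions. -/

/-- Homomorphisms of `A`-`B`-bimodules. -/
structure BimodHom (A B M N : Type*) [Ring A] [Ring B] [AddCommGroup M] [Module A M]
    [Module Bᵐᵒᵖ M] [AddCommGroup N] [Module A N] [Module Bᵐᵒᵖ N] extends M →+ N where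
  map_smul' : ∀ (a : A) (m : M), toFun (a • m) = a • toFun m
  map_op_smul' : ∀ (b : Bᵐᵒᵖ) (m : M), toFun (b • m) = b • toFun m

namespace BimodHom

variable {A B M N : Type*} [Ring A] [Ring B] [AddCommGroup M] [Module A M]
  [Module Bᵐᵒᵖ M] [AddCommGroup N] [Module A N] [Module Bᵐᵒᵖ N]

instance : FunLike (BimodHom A B M N) M N where
  coe f := f.toFun
  coe_injective f g h := by
    cases f; cases g; congr; exact DFunLike.coe_injective h

instance : AddMonoidHomClass (BimodHom A B M N) M N where
  map_add f := f.map_add'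
  map_zero f := f.map_zero'

/-- The underlying left linear map. -/
def left (f : BimodHom A B M N) : M →ₗ[A] N where
  toFun := f
  map_add' := f.map_add'
  map_smul' := f.map_smul'

/-- The underlying right linear map. -/
def right (f : BimodHom A B M N) : M →ₗ[Bᵐᵒᵖ] N where
  toFun := f
  map_add' := f.map_add'
  map_smul' := f.map_op_smul'

/-- The identity. -/
def id : BimodHom A B M M := ⟨AddMonoidHom.id M, fun _ _ => rfl, fun _ _ => rfl⟩

/-- Composition. -/
def comp {P : Type*} [AddCommGroup P] [Module A P] [Module Bᵐᵒᵖ P] (g : BimodHom A B N P)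
    (f : BimodHom A B M N) : BimodHom A B M P :=
  ⟨(g.toAddMonoidHom).comp f.toAddMonoidHom,
    fun a m => (congrArg g (f.map_smul' a m)).trans (g.map_smul' a _),
    fun b m => (congrArg g (f.map_op_smul' b m)).trans (g.map_op_smul' b _)⟩

@[simp]
theorem comp_apply {P : Type*} [AddCommGroup P] [Module A P] [Module Bᵐᵒᵖ P]
    (g : BimodHom A B N P) (f : BimodHom A B M N) (m : M) : g.comp f m = g (f m) := rfl

@[simp] theorem left_apply (f : BimodHom A B M N) (m : M) : f.left m = f m := rfl

@[simp] theorem right_apply (f : BimodHom A B M N) (m : M) : f.right m = f m := rfl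

end BimodHom

section Tensor

section Basic

variable (A : Type*) [Ring A]
variable (M : Type*) [AddCommGroup M] [Module Aᵐᵒᵖ M]
variable (N : Type*) [AddCommGroup N] [Module A N]

/-- The relations `(m a) ⊗ n = m ⊗ (a n)`. -/
def balancing : Submodule ℤ (M ⊗[ℤ] N) :=
  Submodule.span ℤ
    {t | ∃ (m : M) (a : A) (n : N), t = (op a • m) ⊗ₜ[ℤ] n - m ⊗ₜ[ℤ] (a • n)}

/-- The tensor product `M ⊗_A N` of a right `A`-module and a left `A`-module. -/
def Tens : Type _ := (M ⊗[ℤ] N) ⧸ balancing A M N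

instance : AddCommGroup (Tens A M N) :=
  inferInstanceAs (AddCommGroup ((M ⊗[ℤ] N) ⧸ balancing A M N))

variable {M N}

/-- The pure tensor `m ⊗ n`. -/
def tm (m : M) (n : N) : Tens A M N := (balancing A M N).mkQ (m ⊗ₜ[ℤ] n)

variable {A}

theorem add_tm (m m' : M) (n : N) : tm A (m + m') n = tm A m n + tm A m' n := by
  unfold tm
  rw [TensorProduct.add_tmul]
  exact map_add _ _ _

theorem tm_add (m : M) (n n' : N) : tm A m (n + n') = tm A m n + tm A m n' := by
  unfold tm
  rw [TensorProduct.tmul_add]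
  exact map_add _ _ _

@[simp]
theorem zero_tm (n : N) : tm A (0 : M) n = 0 := by
  simpa using add_tm (A := A) (0 : M) 0 n

@[simp]
theorem tm_zero (m : M) : tm A m (0 : N) = 0 := by
  simpa using tm_add (A := A) m (0 : N) 0

theorem smul_tm (a : A) (m : M) (n : N) : tm A (op a • m) n = tm A m (a • n) := by
  unfold tm
  exact (Submodule.Quotient.eq _).2 (Submodule.subset_span ⟨m, a, n, rfl⟩)

/-- The additive map `M ⊗_A N → P` given by a balanced biadditive map. -/
def lift {P : Type*} [AddCommGroup P] (f : M → N → P)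
    (h₁ : ∀ m m' n, f (m + m') n = f m n + f m' n)
    (h₂ : ∀ m n n', f m (n + n') = f m n + f m n')
    (hb : ∀ (m : M) (a : A) (n : N), f (op a • m) n = f m (a • n)) : Tens A M N →+ P :=
  ((balancing A M N).liftQ
    (AddMonoidHom.toIntLinearMap
      (TensorProduct.liftAddHom
        (AddMonoidHom.mk' (fun m => AddMonoidHom.mk' (f m) (h₂ m))
          (fun m m' => by ext n; exact h₁ m m' n))
        (fun r m n => by rw [map_zsmul, map_zsmul, AddMonoidHom.smul_apply])))
    (by
      refine Submodule.span_le.2 ?_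
      rintro _ ⟨m, a, n, rfl⟩
      refine LinearMap.mem_ker.2 ?_
      refine (map_sub _ _ _).trans (sub_eq_zero.2 ?_)
      exact hb m a n)).toAddMonoidHom

@[simp]
theorem lift_tm {P : Type*} [AddCommGroup P] (f : M → N → P) (h₁ h₂)
    (hb : ∀ (m : M) (a : A) (n : N), f (op a • m) n = f m (a • n)) (m : M) (n : N) :
    lift f h₁ h₂ hb (tm A m n) = f m n := rfl

theorem tens_induction {p : Tens A M N → Prop} (x : Tens A M N) (zero : p 0)
    (tm : ∀ m n, p (tm A m n)) (add : ∀ x y, p x → p y → p (x + y)) : p x := by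
  obtain ⟨t, rfl⟩ := (balancing A M N).mkQ_surjective x
  induction t with
  | zero => exact zero
  | tmul m n => exact tm m n
  | add s t hs ht => rw [map_add]; exact add _ _ hs ht

theorem tens_ext {P : Type*} [AddCommGroup P] (f g : Tens A M N →+ P)
    (h : ∀ m n, f (tm A m n) = g (tm A m n)) (x : Tens A M N) : f x = g x := by
  refine tens_induction (p := fun x => f x = g x) x ((map_zero f).trans (map_zero g).symm) h
    fun x y hx hy => ?_
  rw [map_add, map_add, hx, hy]

end Basic

section Maps

variable {A : Type*} [Ring A]
variable {M M' M'' : Type*} [AddCommGroup M] [Module Aᵐᵒᵖ M] [AddCommGroup M'] [Module Aᵐᵒᵖ M']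
  [AddCommGroup M''] [Module Aᵐᵒᵖ M'']
variable {N N' N'' : Type*} [AddCommGroup N] [Module A N] [AddCommGroup N'] [Module A N']
  [AddCommGroup N''] [Module A N'']

/-- `M ⊗_A g`. -/
def lT (M : Type*) [AddCommGroup M] [Module Aᵐᵒᵖ M] (g : N →ₗ[A] N') :
    Tens A M N →+ Tens A M N' :=
  lift (fun m n => tm A m (g n)) (fun _ _ _ => add_tm _ _ _)
    (fun _ _ _ => by rw [map_add, tm_add]) (fun _ _ _ => by rw [smul_tm, map_smul])

/-- `f ⊗_A N`. -/
def rT (N : Type*) [AddCommGroup N] [Module A N] (f : M →ₗ[Aᵐᵒᵖ] M') :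
    Tens A M N →+ Tens A M' N :=
  lift (fun m n => tm A (f m) n) (fun _ _ _ => by rw [map_add, add_tm])
    (fun _ _ _ => tm_add _ _ _) (fun _ _ _ => by rw [map_smul, smul_tm])

@[simp]
theorem lT_tm (g : N →ₗ[A] N') (m : M) (n : N) : lT M g (tm A m n) = tm A m (g n) := rfl

@[simp]
theorem rT_tm (f : M →ₗ[Aᵐᵒᵖ] M') (m : M) (n : N) : rT N f (tm A m n) = tm A (f m) n := rfl

theorem rT_lT (f : M →ₗ[Aᵐᵒᵖ] M') (g : N →ₗ[A] N') (x : Tens A M N) :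
    rT N' f (lT M g x) = lT M' g (rT N f x) :=
  tens_ext ((rT N' f).comp (lT M g)) ((lT M' g).comp (rT N f)) (fun _ _ => rfl) x

theorem rT_comp (f : M →ₗ[Aᵐᵒᵖ] M') (f' : M' →ₗ[Aᵐᵒᵖ] M'') (x : Tens A M N) :
    rT N (f'.comp f) x = rT N f' (rT N f x) :=
  tens_ext (rT N (f'.comp f)) ((rT N f').comp (rT N f)) (fun _ _ => rfl) x

theorem lT_comp (g : N →ₗ[A] N') (g' : N' →ₗ[A] N'') (x : Tens A M N) :
    lT M (g'.comp g) x = lT M g' (lT M g x) :=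
  tens_ext (lT M (g'.comp g)) ((lT M g').comp (lT M g)) (fun _ _ => rfl) x

theorem rT_id (x : Tens A M N) : rT N (LinearMap.id (R := Aᵐᵒᵖ) (M := M)) x = x :=
  tens_ext (rT N (LinearMap.id (R := Aᵐᵒᵖ) (M := M))) (AddMonoidHom.id _) (fun _ _ => rfl) x

theorem lT_id (x : Tens A M N) : lT M (LinearMap.id (R := A) (M := N)) x = x :=
  tens_ext (lT M (LinearMap.id (R := A) (M := N))) (AddMonoidHom.id _) (fun _ _ => rfl) x

variable (M) in
/-- The canonical map `M ⊗_A A → M`. -/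
def rid : Tens A M A →+ M :=
  lift (fun m a => op a • m) (fun _ _ _ => smul_add _ _ _)
    (fun _ _ _ => by rw [MulOpposite.op_add, add_smul])
    (fun _ _ _ => by rw [smul_smul, ← op_mul]; rfl)

variable (N) in
/-- The canonical map `A ⊗_A N → N`. -/
def lid : Tens A A N →+ N :=
  lift (fun a n => a • n) (fun _ _ _ => add_smul _ _ _)
    (fun _ _ _ => smul_add _ _ _)
    (fun _ _ _ => by rw [smul_smul]; rfl)

@[simp] theorem rid_tm (m : M) (a : A) : rid M (tm A m a) = op a • m := rfl

@[simp] theorem lid_tm (a : A) (n : N) : lid N (tm A a n) = a • n := rfl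

theorem rid_rT (f : M →ₗ[Aᵐᵒᵖ] M') (x : Tens A M A) : rid M' (rT A f x) = f (rid M x) :=
  tens_ext ((rid M').comp (rT A f)) (f.toAddMonoidHom.comp (rid M))
    (fun m a => (f.map_smul (op a) m).symm) x

theorem lid_lT (g : N →ₗ[A] N') (x : Tens A A N) : lid N' (lT A g x) = g (lid N x) :=
  tens_ext ((lid N').comp (lT A g)) (g.toAddMonoidHom.comp (lid N))
    (fun a n => (g.map_smul a n).symm) x

/-- The map `M ⊗_A N → M' ⊗_B N'`, `m ⊗ n ↦ f m ⊗ g n`, for `f` and `g` semilinear along a ring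
homomorphism `A → B`. -/
def mapAlong {B : Type*} [Ring B] (r : A →+* B) {X Y : Type*}
    [AddCommGroup X] [Module Bᵐᵒᵖ X] [AddCommGroup Y] [Module B Y] (f : M →+ X) (g : N →+ Y)
    (hf : ∀ (a : A) m, f (op a • m) = op (r a) • f m) (hg : ∀ (a : A) n, g (a • n) = r a • g n) :
    Tens A M N →+ Tens B X Y :=
  lift (fun m n => tm B (f m) (g n)) (fun _ _ _ => by rw [map_add, add_tm])
    (fun _ _ _ => by rw [map_add, tm_add]) (fun _ _ _ => by rw [hf, hg, smul_tm])

end Maps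

section Actions

variable {A : Type*} [Ring A]
variable {M : Type*} [AddCommGroup M] [Module Aᵐᵒᵖ M]
variable {N : Type*} [AddCommGroup N] [Module A N]

/-- The left module structure of `M ⊗_A N` for a bimodule `M`. -/
instance {R : Type*} [Ring R] [Module R M] [SMulCommClass R Aᵐᵒᵖ M] : Module R (Tens A M N) where
  smul r := rT N (DistribSMul.toLinearMap Aᵐᵒᵖ M r)
  one_smul x := tens_ext (rT N (DistribSMul.toLinearMap Aᵐᵒᵖ M (1 : R))) (AddMonoidHom.id _)
    (fun m n => by simp) x
  mul_smul r s x := tens_ext (rT N (DistribSMul.toLinearMap Aᵐᵒᵖ M (r * s)))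
    ((rT N (DistribSMul.toLinearMap Aᵐᵒᵖ M r)).comp (rT N (DistribSMul.toLinearMap Aᵐᵒᵖ M s)))
    (fun m n => by simp [mul_smul]) x
  smul_zero r := map_zero (rT N (DistribSMul.toLinearMap Aᵐᵒᵖ M r))
  smul_add r := map_add (rT N (DistribSMul.toLinearMap Aᵐᵒᵖ M r))
  add_smul r s x := tens_ext (rT N (DistribSMul.toLinearMap Aᵐᵒᵖ M (r + s)))
    (rT N (DistribSMul.toLinearMap Aᵐᵒᵖ M r) + rT N (DistribSMul.toLinearMap Aᵐᵒᵖ M s))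
    (fun m n => by simp [add_smul, add_tm]) x
  zero_smul x := tens_ext (rT N (DistribSMul.toLinearMap Aᵐᵒᵖ M (0 : R))) (0 : Tens A M N →+ _)
    (fun m n => by simp) x

/-- The right module structure of `M ⊗_A N` for a bimodule `N`. -/
instance {S : Type*} [Ring S] [Module Sᵐᵒᵖ N] [SMulCommClass A Sᵐᵒᵖ N] :
    Module Sᵐᵒᵖ (Tens A M N) :=
  haveI : SMulCommClass Sᵐᵒᵖ A N := SMulCommClass.symm A Sᵐᵒᵖ N
  { smul := fun r => lT M (DistribSMul.toLinearMap A N r)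
    one_smul := fun x => tens_ext (lT M (DistribSMul.toLinearMap A N (1 : Sᵐᵒᵖ)))
      (AddMonoidHom.id _) (fun m n => by simp) x
    mul_smul := fun r s x => tens_ext (lT M (DistribSMul.toLinearMap A N (r * s)))
      ((lT M (DistribSMul.toLinearMap A N r)).comp (lT M (DistribSMul.toLinearMap A N s)))
      (fun m n => by simp [mul_smul]) x
    smul_zero := fun r => map_zero (lT M (DistribSMul.toLinearMap A N r))
    smul_add := fun r => map_add (lT M (DistribSMul.toLinearMap A N r))
    add_smul := fun r s x => tens_ext (lT M (DistribSMul.toLinearMap A N (r + s)))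
      (lT M (DistribSMul.toLinearMap A N r) + lT M (DistribSMul.toLinearMap A N s))
      (fun m n => by simp [add_smul, tm_add]) x
    zero_smul := fun x => tens_ext (lT M (DistribSMul.toLinearMap A N (0 : Sᵐᵒᵖ)))
      (0 : Tens A M N →+ _) (fun m n => by simp) x }

@[simp]
theorem smul_tm_left {R : Type*} [Ring R] [Module R M] [SMulCommClass R Aᵐᵒᵖ M] (r : R) (m : M)
    (n : N) : r • tm A m n = tm A (r • m) n := rfl

@[simp]
theorem smul_tm_right {S : Type*} [Ring S] [Module Sᵐᵒᵖ N] [SMulCommClass A Sᵐᵒᵖ N] (s : Sᵐᵒᵖ)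
    (m : M) (n : N) : s • tm A m n = tm A m (s • n) := rfl

instance {R S : Type*} [Ring R] [Module R M] [SMulCommClass R Aᵐᵒᵖ M] [Ring S] [Module Sᵐᵒᵖ N]
    [SMulCommClass A Sᵐᵒᵖ N] : SMulCommClass R Sᵐᵒᵖ (Tens A M N) where
  smul_comm r s x :=
    haveI : SMulCommClass Sᵐᵒᵖ A N := SMulCommClass.symm A Sᵐᵒᵖ N
    rT_lT (DistribSMul.toLinearMap Aᵐᵒᵖ M r) (DistribSMul.toLinearMap A N s) x

/-- An additive map out of a tensor product is left linear as soon as it is so on pure tensors. -/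
theorem map_smul_of_tm {R P : Type*} [Ring R] [Module R M] [SMulCommClass R Aᵐᵒᵖ M]
    [AddCommGroup P] [Module R P] (f : Tens A M N →+ P) (r : R)
    (h : ∀ m n, f (tm A (r • m) n) = r • f (tm A m n)) (x : Tens A M N) : f (r • x) = r • f x :=
  tens_ext (f.comp (DistribSMul.toAddMonoidHom _ r)) ((DistribSMul.toAddMonoidHom _ r).comp f) h x

/-- An additive map out of a tensor product is right linear as soon as it is so on pure tensors. -/
theorem map_op_smul_of_tm {S P : Type*} [Ring S] [Module Sᵐᵒᵖ N] [SMulCommClass A Sᵐᵒᵖ N]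
    [AddCommGroup P] [Module Sᵐᵒᵖ P] (f : Tens A M N →+ P) (s : Sᵐᵒᵖ)
    (h : ∀ m n, f (tm A m (s • n)) = s • f (tm A m n)) (x : Tens A M N) : f (s • x) = s • f x :=
  tens_ext (f.comp (DistribSMul.toAddMonoidHom _ s)) ((DistribSMul.toAddMonoidHom _ s).comp f) h x

variable {M' N' : Type*} [AddCommGroup M'] [Module Aᵐᵒᵖ M'] [AddCommGroup N'] [Module A N']

theorem rT_op_smul {S : Type*} [Ring S] [Module Sᵐᵒᵖ N] [SMulCommClass A Sᵐᵒᵖ N]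
    (f : M →ₗ[Aᵐᵒᵖ] M') (s : Sᵐᵒᵖ) (x : Tens A M N) : rT N f (s • x) = s • rT N f x :=
  map_op_smul_of_tm (rT N f) s (fun _ _ => rfl) x

theorem lT_smul {R : Type*} [Ring R] [Module R M] [SMulCommClass R Aᵐᵒᵖ M]
    (g : N →ₗ[A] N') (r : R) (x : Tens A M N) : lT M g (r • x) = r • lT M g x :=
  map_smul_of_tm (lT M g) r (fun _ _ => rfl) x

theorem rT_smul {R : Type*} [Ring R] [Module R M] [SMulCommClass R Aᵐᵒᵖ M] [Module R M']
    [SMulCommClass R Aᵐᵒᵖ M'] (f : M →ₗ[Aᵐᵒᵖ] M') (r : R) (hf : ∀ m, f (r • m) = r • f m)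
    (x : Tens A M N) : rT N f (r • x) = r • rT N f x :=
  map_smul_of_tm (rT N f) r (fun _ _ => by simp [hf]) x

theorem lT_op_smul {S : Type*} [Ring S] [Module Sᵐᵒᵖ N] [SMulCommClass A Sᵐᵒᵖ N]
    [Module Sᵐᵒᵖ N'] [SMulCommClass A Sᵐᵒᵖ N'] (g : N →ₗ[A] N') (s : Sᵐᵒᵖ)
    (hg : ∀ n, g (s • n) = s • g n) (x : Tens A M N) : lT M g (s • x) = s • lT M g x :=
  map_op_smul_of_tm (lT M g) s (fun _ _ => by simp [hg]) x

end Actions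

theorem rid_op_smul {A M : Type*} [Ring A] [AddCommGroup M] [Module Aᵐᵒᵖ M] (a : Aᵐᵒᵖ)
    (x : Tens A M A) : rid M (a • x) = a • rid M x :=
  map_op_smul_of_tm (rid M) a (fun m b => by
    rw [rid_tm, rid_tm, smul_smul]
    rfl) x

theorem lid_smul {A N : Type*} [Ring A] [AddCommGroup N] [Module A N] (a : A)
    (x : Tens A A N) : lid N (a • x) = a • lid N x :=
  map_smul_of_tm (lid N) a (fun b n => by
    rw [lid_tm, lid_tm, smul_smul]
    rfl) x

section Assoc

variable {A B : Type*} [Ring A] [Ring B]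
variable (M N P : Type*) [AddCommGroup M] [Module Aᵐᵒᵖ M]
variable [AddCommGroup N] [Module A N] [Module Bᵐᵒᵖ N] [SMulCommClass A Bᵐᵒᵖ N]
variable [AddCommGroup P] [Module B P]

/-- `tmL p` is `y ↦ y ⊗ p`. -/
def tmL {X : Type*} [AddCommGroup X] [Module Bᵐᵒᵖ X] {P : Type*} [AddCommGroup P] [Module B P]
    (p : P) : X →+ Tens B X P :=
  AddMonoidHom.mk' (fun y => tm B y p) fun _ _ => add_tm _ _ _

/-- `tmR m` is `y ↦ m ⊗ y`. -/
def tmR {M : Type*} [AddCommGroup M] [Module Aᵐᵒᵖ M] {X : Type*} [AddCommGroup X] [Module A X]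
    (m : M) : X →+ Tens A M X :=
  AddMonoidHom.mk' (fun y => tm A m y) fun _ _ => tm_add _ _ _

@[simp]
theorem tmL_apply {X : Type*} [AddCommGroup X] [Module Bᵐᵒᵖ X] {P : Type*} [AddCommGroup P]
    [Module B P] (p : P) (y : X) : tmL p y = tm B y p := rfl

@[simp]
theorem tmR_apply {M : Type*} [AddCommGroup M] [Module Aᵐᵒᵖ M] {X : Type*} [AddCommGroup X]
    [Module A X] (m : M) (y : X) : tmR m y = tm A m y := rfl

variable {N P} in
/-- `x ↦ x ⊗ p`, reassociated. -/
def assocAux (p : P) : Tens A M N →+ Tens A M (Tens B N P) :=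
  lift (fun m n => tm A m (tm B n p)) (fun _ _ _ => add_tm _ _ _)
    (fun _ _ _ => by rw [add_tm, tm_add]) (fun m a n => by rw [smul_tm, smul_tm_left])

variable {M N} in
/-- `y ↦ m ⊗ y`, reassociated. -/
def assocAux' (m : M) : Tens B N P →+ Tens B (Tens A M N) P :=
  lift (fun n p => tm B (tm A m n) p) (fun _ _ _ => by rw [tm_add, add_tm])
    (fun _ _ _ => tm_add _ _ _) (fun n b p => by rw [← smul_tm, smul_tm_right])

variable {M N P} in
theorem assocAux_tm (p : P) (m : M) (n : N) :
    assocAux (A := A) (B := B) M p (tm A m n) = tm A m (tm B n p) := rfl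

variable {M N P} in
theorem assocAux'_tm (m : M) (n : N) (p : P) :
    assocAux' (A := A) (B := B) P m (tm B n p) = tm B (tm A m n) p := rfl

/-- The canonical map `(M ⊗_A N) ⊗_B P → M ⊗_A (N ⊗_B P)`. -/
def assocHom : Tens B (Tens A M N) P →+ Tens A M (Tens B N P) :=
  lift (fun x p => assocAux M p x) (fun x x' p => map_add _ _ _)
    (fun x p p' => tens_ext (assocAux (A := A) (B := B) (N := N) M (p + p'))
      (assocAux M p + assocAux M p')
      (fun m n => by simp only [assocAux_tm, AddMonoidHom.add_apply, tm_add]) x)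
    (fun x b p => tens_ext ((assocAux (A := A) (B := B) (N := N) M p).comp
        (DistribSMul.toAddMonoidHom (Tens A M N) (op b))) (assocAux M (b • p))
      (fun m n => by
        simp only [assocAux_tm, AddMonoidHom.comp_apply, DistribSMul.toAddMonoidHom_apply,
          smul_tm_right, smul_tm]) x)

/-- The canonical map `M ⊗_A (N ⊗_B P) → (M ⊗_A N) ⊗_B P`. -/
def assocInv : Tens A M (Tens B N P) →+ Tens B (Tens A M N) P :=
  lift (fun m y => assocAux' P m y)
    (fun m m' y => tens_ext (assocAux' (A := A) (B := B) (N := N) P (m + m'))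
      (assocAux' P m + assocAux' P m')
      (fun n p => by simp only [assocAux'_tm, AddMonoidHom.add_apply, add_tm]) y)
    (fun m y y' => map_add _ _ _)
    (fun m a y => tens_ext (assocAux' (A := A) (B := B) (N := N) P (op a • m))
      ((assocAux' P m).comp (DistribSMul.toAddMonoidHom (Tens B N P) a))
      (fun n p => by
        simp only [assocAux'_tm, AddMonoidHom.comp_apply, DistribSMul.toAddMonoidHom_apply,
          smul_tm_left, smul_tm]) y)

/-- The canonical isomorphism `(M ⊗_A N) ⊗_B P ≃ M ⊗_A (N ⊗_B P)`. -/
def assoc : Tens B (Tens A M N) P ≃+ Tens A M (Tens B N P) where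
  __ := assocHom M N P
  invFun := assocInv M N P
  left_inv x := tens_ext ((assocInv M N P).comp (assocHom M N P)) (AddMonoidHom.id _)
    (fun y p => tens_ext (((assocInv M N P).comp (assocHom M N P)).comp (tmL p)) (tmL p)
      (fun _ _ => rfl) y) x
  right_inv x := tens_ext ((assocHom M N P).comp (assocInv M N P)) (AddMonoidHom.id _)
    (fun m y => tens_ext (((assocHom M N P).comp (assocInv M N P)).comp (tmR m)) (tmR m)
      (fun _ _ => rfl) y) x

variable {M N P}

@[simp]
theorem assoc_tm (m : M) (n : N) (p : P) :
    assoc M N P (tm B (tm A m n) p) = tm A m (tm B n p) := rfl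

@[simp]
theorem assoc_symm_tm (m : M) (n : N) (p : P) :
    (assoc M N P).symm (tm A m (tm B n p)) = tm B (tm A m n) p := rfl

/-- Two additive maps out of `(M ⊗ N) ⊗ P` agree if they do on pure tensors. -/
theorem tens_ext₃ {Q : Type*} [AddCommGroup Q] (f g : Tens B (Tens A M N) P →+ Q)
    (h : ∀ m n p, f (tm B (tm A m n) p) = g (tm B (tm A m n) p)) (x : Tens B (Tens A M N) P) :
    f x = g x :=
  tens_ext f g (fun y p =>
    tens_ext (f.comp (tmL p)) (g.comp (tmL p)) (fun m n => h m n p) y) x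

/-- Two additive maps out of `M ⊗ (N ⊗ P)` agree if they do on pure tensors. -/
theorem tens_ext₃' {Q : Type*} [AddCommGroup Q] (f g : Tens A M (Tens B N P) →+ Q)
    (h : ∀ m n p, f (tm A m (tm B n p)) = g (tm A m (tm B n p))) (x : Tens A M (Tens B N P)) :
    f x = g x := by
  obtain ⟨y, rfl⟩ := (assoc M N P).surjective x
  exact tens_ext₃ (f.comp (assoc M N P).toAddMonoidHom) (g.comp (assoc M N P).toAddMonoidHom) h y

theorem assoc_smul {R : Type*} [Ring R] [Module R M] [SMulCommClass R Aᵐᵒᵖ M] (r : R)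
    (x : Tens B (Tens A M N) P) : assoc M N P (r • x) = r • assoc M N P x :=
  tens_ext₃ ((assoc M N P).toAddMonoidHom.comp (DistribSMul.toAddMonoidHom _ r))
    ((DistribSMul.toAddMonoidHom _ r).comp (assoc M N P).toAddMonoidHom) (fun _ _ _ => rfl) x

theorem assoc_symm_smul {R : Type*} [Ring R] [Module R M] [SMulCommClass R Aᵐᵒᵖ M] (r : R)
    (x : Tens A M (Tens B N P)) : (assoc M N P).symm (r • x) = r • (assoc M N P).symm x := by
  rw [AddEquiv.symm_apply_eq, assoc_smul, AddEquiv.apply_symm_apply]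

theorem assoc_op_smul {S : Type*} [Ring S] [Module Sᵐᵒᵖ P] [SMulCommClass B Sᵐᵒᵖ P] (s : Sᵐᵒᵖ)
    (x : Tens B (Tens A M N) P) : assoc M N P (s • x) = s • assoc M N P x :=
  tens_ext₃ ((assoc M N P).toAddMonoidHom.comp (DistribSMul.toAddMonoidHom _ s))
    ((DistribSMul.toAddMonoidHom _ s).comp (assoc M N P).toAddMonoidHom) (fun _ _ _ => rfl) x

theorem assoc_symm_op_smul {S : Type*} [Ring S] [Module Sᵐᵒᵖ P] [SMulCommClass B Sᵐᵒᵖ P]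
    (s : Sᵐᵒᵖ) (x : Tens A M (Tens B N P)) :
    (assoc M N P).symm (s • x) = s • (assoc M N P).symm x := by
  rw [AddEquiv.symm_apply_eq, assoc_op_smul, AddEquiv.apply_symm_apply]

/-- `f ⊗_A N` as a right linear map. -/
def rTr {M M' : Type*} [AddCommGroup M] [Module Aᵐᵒᵖ M] [AddCommGroup M'] [Module Aᵐᵒᵖ M']
    (N : Type*) [AddCommGroup N] [Module A N] [Module Bᵐᵒᵖ N] [SMulCommClass A Bᵐᵒᵖ N]
    (f : M →ₗ[Aᵐᵒᵖ] M') : Tens A M N →ₗ[Bᵐᵒᵖ] Tens A M' N where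
  toFun := rT N f
  map_add' := map_add _
  map_smul' := rT_op_smul f

/-- `M ⊗_B g` as a left linear map. -/
def lTl {N N' : Type*} [AddCommGroup N] [Module B N] [AddCommGroup N'] [Module B N']
    (M : Type*) [AddCommGroup M] [Module Bᵐᵒᵖ M] [Module A M] [SMulCommClass A Bᵐᵒᵖ M]
    (g : N →ₗ[B] N') : Tens B M N →ₗ[A] Tens B M N' where
  toFun := lT M g
  map_add' := map_add _
  map_smul' := lT_smul g

/-- `M ⊗_A g` as a right linear map, for a bimodule homomorphism `g`. -/
def lTr {N N' : Type*} [AddCommGroup N] [Module A N] [Module Bᵐᵒᵖ N] [SMulCommClass A Bᵐᵒᵖ N]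
    [AddCommGroup N'] [Module A N'] [Module Bᵐᵒᵖ N'] [SMulCommClass A Bᵐᵒᵖ N']
    (M : Type*) [AddCommGroup M] [Module Aᵐᵒᵖ M] (g : BimodHom A B N N') :
    Tens A M N →ₗ[Bᵐᵒᵖ] Tens A M N' where
  toFun := lT M g.left
  map_add' := map_add _
  map_smul' s x := lT_op_smul g.left s (g.map_op_smul' s) x

/-- `f ⊗_B N` as a left linear map, for a bimodule homomorphism `f`. -/
def rTl {M M' : Type*} [AddCommGroup M] [Module A M] [Module Bᵐᵒᵖ M] [SMulCommClass A Bᵐᵒᵖ M]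
    [AddCommGroup M'] [Module A M'] [Module Bᵐᵒᵖ M'] [SMulCommClass A Bᵐᵒᵖ M']
    (N : Type*) [AddCommGroup N] [Module B N] (f : BimodHom A B M M') :
    Tens B M N →ₗ[A] Tens B M' N where
  toFun := rT N f.right
  map_add' := map_add _
  map_smul' r x := rT_smul f.right r (f.map_smul' r) x

section

variable {M M' : Type*} [AddCommGroup M] [Module Aᵐᵒᵖ M] [AddCommGroup M'] [Module Aᵐᵒᵖ M']
variable {N N' : Type*} [AddCommGroup N] [Module A N] [Module Bᵐᵒᵖ N] [SMulCommClass A Bᵐᵒᵖ N]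
    [AddCommGroup N'] [Module A N'] [Module Bᵐᵒᵖ N'] [SMulCommClass A Bᵐᵒᵖ N']
variable {P P' : Type*} [AddCommGroup P] [Module B P] [AddCommGroup P'] [Module B P']

@[simp] theorem rTr_apply (f : M →ₗ[Aᵐᵒᵖ] M') (x : Tens A M N) :
    rTr (B := B) N f x = rT N f x := rfl

@[simp] theorem lTl_apply (g : P →ₗ[B] P') (x : Tens B N P) :
    lTl (A := A) N g x = lT N g x := rfl

@[simp] theorem lTr_apply (g : BimodHom A B N N') (x : Tens A M N) :
    lTr M g x = lT M g.left x := rfl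

@[simp] theorem rTl_apply (f : BimodHom A B N N') (x : Tens B N P) :
    rTl P f x = rT P f.right x := rfl

theorem assoc_rT_rT (f : M →ₗ[Aᵐᵒᵖ] M') (x : Tens B (Tens A M N) P) :
    assoc M' N P (rT P (rTr N f) x) = rT (Tens B N P) f (assoc M N P x) :=
  tens_ext₃ ((assoc M' N P).toAddMonoidHom.comp (rT P (rTr N f)))
    ((rT (Tens B N P) f).comp (assoc M N P).toAddMonoidHom) (fun _ _ _ => rfl) x

theorem assoc_rT_lT (g : BimodHom A B N N') (x : Tens B (Tens A M N) P) :
    assoc M N' P (rT P (lTr M g) x) = lT M (rTl P g) (assoc M N P x) :=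
  tens_ext₃ ((assoc M N' P).toAddMonoidHom.comp (rT P (lTr M g)))
    ((lT M (rTl P g)).comp (assoc M N P).toAddMonoidHom) (fun _ _ _ => rfl) x

theorem assoc_lT (h : P →ₗ[B] P') (x : Tens B (Tens A M N) P) :
    assoc M N P' (lT (Tens A M N) h x) = lT M (lTl N h) (assoc M N P x) :=
  tens_ext₃ ((assoc M N P').toAddMonoidHom.comp (lT (Tens A M N) h))
    ((lT M (lTl N h)).comp (assoc M N P).toAddMonoidHom) (fun _ _ _ => rfl) x

theorem assoc_symm_rT (f : M →ₗ[Aᵐᵒᵖ] M') (x : Tens A M (Tens B N P)) :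
    (assoc M' N P).symm (rT (Tens B N P) f x) = rT P (rTr N f) ((assoc M N P).symm x) := by
  rw [AddEquiv.symm_apply_eq, assoc_rT_rT, AddEquiv.apply_symm_apply]

theorem assoc_symm_lT_rT (g : BimodHom A B N N') (x : Tens A M (Tens B N P)) :
    (assoc M N' P).symm (lT M (rTl P g) x) = rT P (lTr M g) ((assoc M N P).symm x) := by
  rw [AddEquiv.symm_apply_eq, assoc_rT_lT, AddEquiv.apply_symm_apply]

theorem assoc_symm_lT_lT (h : P →ₗ[B] P') (x : Tens A M (Tens B N P)) :
    (assoc M N P').symm (lT M (lTl N h) x) = lT (Tens A M N) h ((assoc M N P).symm x) := by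
  rw [AddEquiv.symm_apply_eq, assoc_lT, AddEquiv.apply_symm_apply]

/-- `n ↦ m ⊗ n` as a right linear map. -/
def ins (N : Type*) [AddCommGroup N] [Module A N] [Module Bᵐᵒᵖ N] [SMulCommClass A Bᵐᵒᵖ N]
    (m : M) : N →ₗ[Bᵐᵒᵖ] Tens A M N where
  toFun := tm A m
  map_add' := tm_add m
  map_smul' _ _ := rfl

@[simp] theorem ins_apply (m : M) (n : N) : ins (B := B) N m n = tm A m n := rfl

theorem assoc_symm_tm_eq (m : M) (u : Tens B N P) :
    (assoc M N P).symm (tm A m u) = rT P (ins N m) u :=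
  tens_ext ((assoc M N P).symm.toAddMonoidHom.comp (tmR m)) (rT P (ins N m)) (fun _ _ => rfl) u

theorem assoc_rT_ins (m : M) (u : Tens B N P) : assoc M N P (rT P (ins N m) u) = tm A m u := by
  rw [← assoc_symm_tm_eq, AddEquiv.apply_symm_apply]

/-- `n ↦ n ⊗ p` as a left linear map. -/
def insR (N : Type*) [AddCommGroup N] [Module A N] [Module Bᵐᵒᵖ N] [SMulCommClass A Bᵐᵒᵖ N]
    (p : P) : N →ₗ[A] Tens B N P where
  toFun n := tm B n p
  map_add' n n' := add_tm n n' p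
  map_smul' _ _ := rfl

@[simp] theorem insR_apply (n : N) (p : P) : insR (A := A) (B := B) N p n = tm B n p := rfl

theorem assoc_tm_eq (u : Tens A M N) (p : P) : assoc M N P (tm B u p) = lT M (insR N p) u :=
  tens_ext ((assoc M N P).toAddMonoidHom.comp (tmL p)) (lT M (insR N p)) (fun _ _ => rfl) u

/-- The associativity isomorphism as a right linear map. -/
def assocR (M N P : Type*) [AddCommGroup M] [Module Aᵐᵒᵖ M] [AddCommGroup N] [Module A N]
    [Module Bᵐᵒᵖ N] [SMulCommClass A Bᵐᵒᵖ N] [AddCommGroup P] [Module B P] {E : Type*} [Ring E]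
    [Module Eᵐᵒᵖ P] [SMulCommClass B Eᵐᵒᵖ P] :
    Tens B (Tens A M N) P →ₗ[Eᵐᵒᵖ] Tens A M (Tens B N P) where
  toFun := assoc M N P
  map_add' := map_add _
  map_smul' := assoc_op_smul

@[simp]
theorem assocR_apply {E : Type*} [Ring E] [Module Eᵐᵒᵖ P] [SMulCommClass B Eᵐᵒᵖ P]
    (x : Tens B (Tens A M N) P) : assocR (E := E) M N P x = assoc M N P x := rfl

/-- The canonical map `M ⊗_A A → M` as a right linear map. -/
def ridR (M : Type*) [AddCommGroup M] [Module Aᵐᵒᵖ M] : Tens A M A →ₗ[Aᵐᵒᵖ] M where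
  toFun := rid M
  map_add' := map_add _
  map_smul' := rid_op_smul

@[simp] theorem ridR_apply (x : Tens A M A) : ridR M x = rid M x := rfl

/-- The canonical map `A ⊗_A N → N` as a right linear map. -/
def lidR (N : Type*) [AddCommGroup N] [Module A N] [Module Bᵐᵒᵖ N] [SMulCommClass A Bᵐᵒᵖ N] :
    Tens A A N →ₗ[Bᵐᵒᵖ] N where
  toFun := lid N
  map_add' := map_add _
  map_smul' s := map_op_smul_of_tm (lid N) s fun a n => smul_comm a s n

@[simp] theorem lidR_apply (x : Tens A A N) : lidR (B := B) N x = lid N x := rfl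

theorem rT_add (f f' : M →ₗ[Aᵐᵒᵖ] M') (x : Tens A M N) :
    rT N (f + f') x = rT N f x + rT N f' x :=
  tens_ext (rT N (f + f')) (rT N f + rT N f') (fun _ _ => add_tm _ _ _) x

end

end Assoc

end Tensor

/-! ### Corings, comodules and bicomodules -/

/-- An `A`-coring. -/
structure Coring (A : Type u) [Ring A] where
  carrier : Type u
  [addCommGroup : AddCommGroup carrier]
  [leftModule : Module A carrier]
  [rightModule : Module Aᵐᵒᵖ carrier]
  [smulComm : SMulCommClass A Aᵐᵒᵖ carrier]
  comul : BimodHom A A carrier (Tens A carrier carrier)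
  counit : BimodHom A A carrier A
  coassoc : ∀ c, assoc _ _ _ (rT carrier comul.right (comul c)) = lT carrier comul.left (comul c)
  counit_left : ∀ c, lid carrier (rT carrier counit.right (comul c)) = c
  counit_right : ∀ c, rid carrier (lT carrier counit.left (comul c)) = c

namespace Coring

instance {A : Type u} [Ring A] : CoeSort (Coring A) (Type u) := ⟨Coring.carrier⟩

attribute [instance] addCommGroup leftModule rightModule smulComm

/-- The two actions on the underlying bimodule of a base ring `k` of `A` agree. -/
def IsCentralOver (k : Type*) {A : Type u} [Ring A] [CommRing k] [Algebra k A] (C : Coring A) :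
    Prop :=
  ∀ (t : k) (c : C), algebraMap k A t • c = op (algebraMap k A t) • c

/-- The module `_A C` is flat: `- ⊗_A C` preserves injections of right `A`-modules. -/
def IsLeftFlat {A : Type u} [Ring A] (C : Coring A) : Prop :=
  ∀ (M N : Type u) [AddCommGroup M] [Module Aᵐᵒᵖ M] [AddCommGroup N] [Module Aᵐᵒᵖ N]
    (f : M →ₗ[Aᵐᵒᵖ] N), Function.Injective f → Function.Injective (rT C f)

/-- `C` is coseparable: the comultiplication is a split monomorphism of `C`-bicomodules, where the
coactions on `C ⊗_A C` are `Δ ⊗ C` and `C ⊗ Δ`. -/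
def IsCoseparable {A : Type u} [Ring A] (C : Coring A) : Prop :=
  ∃ p : BimodHom A A (Tens A C C) C,
    (∀ x, lT C p.left (assoc C C C (rT C C.comul.right x)) = C.comul (p x)) ∧
    (∀ x, rT C p.right ((assoc C C C).symm (lT C C.comul.left x)) = C.comul (p x)) ∧
    ∀ c, p (C.comul c) = c

end Coring

/-- Homomorphisms from an `A`-coring to a `B`-coring, over a ring homomorphism `r : A → B`. -/
structure CoringHom {A B : Type u} [Ring A] [Ring B] (C : Coring A) (D : Coring B) (r : A →+* B)
    extends C →+ D where
  map_smul' : ∀ (a : A) (c : C), toAddMonoidHom (a • c) = r a • toAddMonoidHom c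
  map_op_smul' : ∀ (a : A) (c : C), toAddMonoidHom (op a • c) = op (r a) • toAddMonoidHom c
  counit_map' : ∀ c, D.counit (toAddMonoidHom c) = r (C.counit c)
  comul_map' : ∀ c, D.comul (toAddMonoidHom c) =
    mapAlong r toAddMonoidHom toAddMonoidHom map_op_smul' map_smul' (C.comul c)

/-- Right `C`-comodules. -/
structure RightComod {A : Type u} [Ring A] (C : Coring A) where
  carrier : Type u
  [addCommGroup : AddCommGroup carrier]
  [rightModule : Module Aᵐᵒᵖ carrier]
  coact : carrier →ₗ[Aᵐᵒᵖ] Tens A carrier C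
  coact_coassoc : ∀ m, assoc _ _ _ (rT C coact (coact m)) = lT carrier C.comul.left (coact m)
  coact_counit : ∀ m, rid carrier (lT carrier C.counit.left (coact m)) = m

namespace RightComod

variable {A : Type u} [Ring A] {C : Coring A}

instance : CoeSort (RightComod C) (Type u) := ⟨RightComod.carrier⟩

attribute [instance] addCommGroup rightModule

/-- Morphisms of right comodules. -/
@[ext]
structure Hom (M N : RightComod C) where
  lin : M →ₗ[Aᵐᵒᵖ] N
  comm : ∀ m, rT C lin (M.coact m) = N.coact (lin m)

/-- The category `M^C`. -/
instance : Category (RightComod C) where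
  Hom := Hom
  id M := ⟨LinearMap.id, fun m => rT_id _⟩
  comp f g := ⟨g.lin.comp f.lin, fun m => by
    rw [rT_comp, f.comm, g.comm, LinearMap.comp_apply]⟩

@[ext]
theorem hom_ext {M N : RightComod C} (f g : M ⟶ N) (h : ∀ m, f.lin m = g.lin m) : f = g :=
  Hom.ext (LinearMap.ext h)

@[simp] theorem id_lin (M : RightComod C) : Hom.lin (𝟙 M) = LinearMap.id := rfl

@[simp]
theorem comp_lin {M N P : RightComod C} (f : M ⟶ N) (g : N ⟶ P) :
    Hom.lin (f ≫ g) = g.lin.comp f.lin := rfl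

end RightComod

/-- `A`-`D`-bicomodules for a ring `A` and a `B`-coring `D`: right `D`-comodules with a left action
of `A` by comodule endomorphisms. -/
structure ModComod (A : Type u) [Ring A] {B : Type u} [Ring B] (D : Coring B)
    extends RightComod D where
  [leftModule : Module A carrier]
  [smulComm : SMulCommClass A Bᵐᵒᵖ carrier]
  coact_smul : ∀ (a : A) (m : carrier), coact (a • m) = a • coact m

namespace ModComod

variable {A B : Type u} [Ring A] [Ring B] {D : Coring B}

instance : CoeSort (ModComod A D) (Type u) := ⟨fun N => N.carrier⟩

attribute [instance] leftModule smulComm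

/-- The coaction as a bimodule homomorphism. -/
def coactBi (N : ModComod A D) : BimodHom A B N (Tens B N D) where
  __ := N.coact.toAddMonoidHom
  map_smul' := N.coact_smul
  map_op_smul' := N.coact.map_smul

@[simp] theorem coactBi_apply (N : ModComod A D) (n : N) : N.coactBi n = N.coact n := rfl

/-- The coaction `X ⊗ ρ_N` of `X ⊗_A N`. -/
def tensCoact (N : ModComod A D) (X : Type*) [AddCommGroup X] [Module Aᵐᵒᵖ X] :
    Tens A X N →ₗ[Bᵐᵒᵖ] Tens B (Tens A X N) D where
  toFun x := (assoc X N D).symm (lT X N.coactBi.left x)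
  map_add' x y := by rw [map_add, map_add]
  map_smul' b x := by
    rw [lT_op_smul N.coactBi.left b (N.coactBi.map_op_smul' b), assoc_symm_op_smul,
      RingHom.id_apply]

@[simp]
theorem tensCoact_tm (N : ModComod A D) {X : Type*} [AddCommGroup X] [Module Aᵐᵒᵖ X] (x : X)
    (n : N) : N.tensCoact X (tm A x n) = (assoc X N D).symm (tm A x (N.coact n)) := rfl

/-- The right `D`-comodule `X ⊗_A N`. -/
def tensObj (N : ModComod A D) (X : Type u) [AddCommGroup X] [Module Aᵐᵒᵖ X] : RightComod D where
  carrier := Tens A X N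
  coact := N.tensCoact X
  coact_coassoc x := by
    induction x using tens_induction with
    | zero => simp
    | add x y hx hy => simp only [map_add, hx, hy]
    | tm x n =>
      have h : (N.tensCoact X).comp (ins N x) = (rTr D (ins N x)).comp N.coact :=
        LinearMap.ext fun n => assoc_symm_tm_eq _ _
      rw [tensCoact_tm, assoc_symm_tm_eq, ← rT_comp, h, rT_comp, assoc_rT_rT, N.coact_coassoc,
        rT_lT]
  coact_counit x := by
    induction x using tens_induction with
    | zero => simp
    | add x y hx hy => simp only [map_add, hx, hy]
    | tm x n =>
      rw [tensCoact_tm, assoc_symm_tm_eq, ← rT_lT, rid_rT, N.coact_counit, ins_apply]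

theorem rT_tensCoact (N : ModComod A D) {X Y : Type*} [AddCommGroup X] [Module Aᵐᵒᵖ X]
    [AddCommGroup Y] [Module Aᵐᵒᵖ Y] (f : X →ₗ[Aᵐᵒᵖ] Y) (x : Tens A X N) :
    rT D (rTr N f) (N.tensCoact X x) = N.tensCoact Y (rT N f x) := by
  change rT D (rTr N f) ((assoc X N D).symm (lT X N.coactBi.left x)) =
    (assoc Y N D).symm (lT Y N.coactBi.left (rT N f x))
  rw [← assoc_symm_rT, rT_lT]

/-- The functor `- ⊗_A N : M_A → M^D`. -/
def tensorFunctor (N : ModComod A D) : ModuleCat.{u} Aᵐᵒᵖ ⥤ RightComod D where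
  obj X := N.tensObj X
  map f :=
    { lin := rTr N f.hom
      comm := N.rT_tensCoact f.hom }
  map_id _ := RightComod.hom_ext _ _ fun x => rT_id x
  map_comp f g := RightComod.hom_ext _ _ fun x => rT_comp f.hom g.hom x

end ModComod

/-- `C`-`D`-bicomodules: the left and right coactions are bimodule maps, and they commute. -/
structure Bicomodule {A B : Type u} [Ring A] [Ring B] (C : Coring A) (D : Coring B)
    extends ModComod A D where
  coactL : BimodHom A B carrier (Tens A C carrier)
  coactL_coassoc : ∀ m,
    assoc _ _ _ (rT carrier C.comul.right (coactL m)) = lT C coactL.left (coactL m)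
  coactL_counit : ∀ m, lid carrier (rT carrier C.counit.right (coactL m)) = m
  coact_comm : ∀ m,
    assoc _ _ _ (rT D coactL.right (coact m)) = lT C toModComod.coactBi.left (coactL m)

namespace Bicomodule

variable {A B : Type u} [Ring A] [Ring B] {C : Coring A} {D : Coring B}

instance : CoeSort (Bicomodule C D) (Type u) := ⟨fun N => N.carrier⟩

/-- Morphisms of bicomodules. -/
@[ext]
structure Hom (M N : Bicomodule C D) where
  hom : BimodHom A B M N
  commL : ∀ m, lT C hom.left (M.coactL m) = N.coactL (hom m)
  commR : ∀ m, rT D hom.right (M.coact m) = N.coact (hom m)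

/-- The category of `C`-`D`-bicomodules. -/
instance : Category (Bicomodule C D) where
  Hom := Hom
  id M := ⟨BimodHom.id, fun _ => lT_id _, fun _ => rT_id _⟩
  comp f g := ⟨g.hom.comp f.hom, fun m => by
      refine (lT_comp f.hom.left g.hom.left _).trans ?_
      rw [f.commL, g.commL, BimodHom.comp_apply], fun m => by
      refine (rT_comp f.hom.right g.hom.right _).trans ?_
      rw [f.commR, g.commR, BimodHom.comp_apply]⟩

end Bicomodule

/-- `C` as an `A`-`C`-bicomodule. -/
abbrev Coring.regular {A : Type u} [Ring A] (C : Coring A) : ModComod A C where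
  carrier := C
  coact := C.comul.right
  coact_coassoc := C.coassoc
  coact_counit := C.counit_right
  coact_smul := C.comul.map_smul'

/-! ### Induction along a homomorphism of corings -/

/-- The ring `B` viewed as a bimodule over `A` and `B`, on either side, along `r : A → B`. -/
def Along {A B : Type u} [Ring A] [Ring B] (_ : A →+* B) : Type u := B

namespace Along

variable {A B : Type u} [Ring A] [Ring B] (r : A →+* B)

instance : AddCommGroup (Along r) := inferInstanceAs (AddCommGroup B)

instance : Module B (Along r) := inferInstanceAs (Module B B)

instance : Module Bᵐᵒᵖ (Along r) := inferInstanceAs (Module Bᵐᵒᵖ B)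

instance : Module A (Along r) := Module.compHom B r

instance : Module Aᵐᵒᵖ (Along r) := Module.compHom B r.op

instance : SMulCommClass A Bᵐᵒᵖ (Along r) :=
  ⟨fun a b x => (mul_assoc (r a) (x : B) (unop b)).symm⟩

instance : SMulCommClass B Aᵐᵒᵖ (Along r) :=
  ⟨fun b a x => (mul_assoc b (x : B) (r (unop a))).symm⟩

/-- The unit element. -/
def one : Along r := (1 : B)

variable {r}

/-- The underlying element of `B`. -/
def val (x : Along r) : B := x

theorem val_add (x y : Along r) : (x + y).val = x.val + y.val := rfl

theorem val_smul (a : A) (x : Along r) : (a • x).val = r a * x.val := rfl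

theorem val_smul' (b : B) (x : Along r) : (b • x).val = b * x.val := rfl

theorem val_op_smul (b : Bᵐᵒᵖ) (x : Along r) : (b • x).val = x.val * unop b := rfl

theorem val_op_smul' (a : Aᵐᵒᵖ) (x : Along r) : (a • x).val = x.val * r (unop a) := rfl

theorem val_one : (one r).val = 1 := rfl

theorem val_injective {x y : Along r} (h : x.val = y.val) : x = y := h

variable (r)

theorem smul_one (a : A) : a • one r = op (r a) • one r :=
  val_injective (by rw [val_smul, val_op_smul, val_one, mul_one, unop_op, one_mul])

theorem smul_one' (a : A) : r a • one r = op a • one r :=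
  val_injective (by rw [val_smul', val_op_smul', val_one, mul_one, unop_op, one_mul])

theorem op_smul_one (x : Along r) : op x.val • one r = x :=
  val_injective (by rw [val_op_smul, val_one, unop_op, one_mul])

theorem val_smul_one (x : Along r) : x.val • one r = x :=
  val_injective (by rw [val_smul', val_one, mul_one])

end Along

namespace CoringHom

variable {A B : Type u} [Ring A] [Ring B] {C : Coring A} {D : Coring B} {r : A →+* B}

section Right

variable (f : CoringHom C D r) (M : Type u) [AddCommGroup M] [Module Aᵐᵒᵖ M]

/-- `m ↦ m ⊗ 1`. -/
def toTensOne (r : A →+* B) : M →+ Tens A M (Along r) := tmL (Along.one r)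

theorem toTensOne_smul (a : A) (m : M) :
    toTensOne M r (op a • m) = op (r a) • toTensOne M r m := by
  change tm A (op a • m) (Along.one r) = op (r a) • tm A m (Along.one r)
  rw [smul_tm, Along.smul_one, smul_tm_right]

/-- `m ⊗ c ↦ (m ⊗ 1) ⊗ f c`. -/
def indAux : Tens A M C →+ Tens B (Tens A M (Along r)) D :=
  mapAlong r (toTensOne M r) f.toAddMonoidHom (toTensOne_smul M) f.map_smul'

theorem indAux_tm (m : M) (c : C) :
    f.indAux M (tm A m c) = tm B (tm A m (Along.one r)) (f.toAddMonoidHom c) := rfl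

theorem indAux_op_smul (a : A) (x : Tens A M C) :
    f.indAux M (op a • x) = op (r a) • f.indAux M x := by
  induction x using tens_induction with
  | zero => simp
  | add x y hx hy => simp only [map_add, smul_add, hx, hy]
  | tm m c => rw [smul_tm_right, indAux_tm, f.map_op_smul', indAux_tm, smul_tm_right]

theorem indAux_smul {R : Type u} [Ring R] [Module R M] [SMulCommClass R Aᵐᵒᵖ M] (s : R)
    (x : Tens A M C) : f.indAux M (s • x) = s • f.indAux M x := by
  induction x using tens_induction with
  | zero => simp
  | add x y hx hy => simp only [map_add, smul_add, hx, hy]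
  | tm m c => rfl

end Right

/-- The coaction `m ⊗ b ↦ ∑ (m₀ ⊗ 1) ⊗ f(m₁) b` of `D` on `M ⊗_A B`. -/
def indCoact (f : CoringHom C D r) (M : RightComod C) :
    Tens A M (Along r) →ₗ[Bᵐᵒᵖ] Tens B (Tens A M (Along r)) D where
  toFun := lift (fun m b => op b.val • f.indAux M (M.coact m))
    (fun m m' b => by rw [map_add, map_add, smul_add])
    (fun m b b' => by rw [Along.val_add, MulOpposite.op_add, add_smul])
    (fun m a b => by rw [map_smul, indAux_op_smul, smul_smul, ← op_mul, Along.val_smul])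
  map_add' := map_add _
  map_smul' s := map_op_smul_of_tm _ s fun m b => by
    rw [lift_tm, lift_tm, Along.val_op_smul, op_mul, mul_smul, op_unop]

theorem indCoact_tm (f : CoringHom C D r) (M : RightComod C) (m : M) (b : Along r) :
    f.indCoact M (tm A m b) = op b.val • f.indAux M (M.coact m) := rfl

/-- The right `D`-comodule `M ⊗_A B`. -/
def indObj (f : CoringHom C D r) (M : RightComod C) : RightComod D where
  carrier := Tens A M (Along r)
  coact := f.indCoact M
  coact_coassoc x := by
    have h₁ (x : Tens A M C) : rT D (f.indCoact M) (f.indAux M x) =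
        mapAlong r (f.indAux M) f.toAddMonoidHom (f.indAux_op_smul M) f.map_smul'
          (rT C M.coact x) := by
      induction x using tens_induction with
      | zero => simp
      | add x y hx hy => simp only [map_add, hx, hy]
      | tm m c =>
        rw [indAux_tm, rT_tm, indCoact_tm, Along.val_one, op_one, one_smul]
        rfl
    have hD (a : A) (x : Tens A C C) : mapAlong r f.toAddMonoidHom f.toAddMonoidHom
        f.map_op_smul' f.map_smul' (a • x) = r a • mapAlong r f.toAddMonoidHom f.toAddMonoidHom
        f.map_op_smul' f.map_smul' x := by
      induction x using tens_induction with
      | zero => simp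
      | add x y hx hy => simp only [map_add, smul_add, hx, hy]
      | tm c c' => exact congrArg (fun t => tm B t (f.toAddMonoidHom c')) (f.map_smul' a c)
    have h₂ (y : Tens A (Tens A M C) C) : assoc _ _ _ (mapAlong r (f.indAux M) f.toAddMonoidHom
        (f.indAux_op_smul M) f.map_smul' y) = mapAlong r (toTensOne M r)
        (mapAlong r f.toAddMonoidHom f.toAddMonoidHom f.map_op_smul' f.map_smul')
        (toTensOne_smul M) hD (assoc _ _ _ y) :=
      tens_ext₃ ((assoc (Tens A M (Along r)) D D).toAddMonoidHom.comp
        (mapAlong r (f.indAux M) f.toAddMonoidHom (f.indAux_op_smul M) f.map_smul'))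
        ((mapAlong r (toTensOne M r)
        (mapAlong r f.toAddMonoidHom f.toAddMonoidHom f.map_op_smul' f.map_smul')
        (toTensOne_smul M) hD).comp (assoc M C C).toAddMonoidHom) (fun _ _ _ => rfl) y
    have h₃ (x : Tens A M C) : lT _ D.comul.left (f.indAux M x) = mapAlong r (toTensOne M r)
        (mapAlong r f.toAddMonoidHom f.toAddMonoidHom f.map_op_smul' f.map_smul')
        (toTensOne_smul M) hD (lT M C.comul.left x) :=
      tens_ext ((lT _ D.comul.left).comp (f.indAux M)) ((mapAlong r (toTensOne M r)
        (mapAlong r f.toAddMonoidHom f.toAddMonoidHom f.map_op_smul' f.map_smul')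
        (toTensOne_smul M) hD).comp (lT M C.comul.left))
        (fun m c => congrArg (tm B (tm A m (Along.one r))) (f.comul_map' c)) x
    induction x using tens_induction with
    | zero => simp
    | add x y hx hy => simp only [map_add, hx, hy]
    | tm m b =>
      rw [indCoact_tm, rT_op_smul, assoc_op_smul,
        lT_op_smul D.comul.left (op b.val) (D.comul.map_op_smul' _), h₁, h₂, h₃, M.coact_coassoc]
  coact_counit x := by
    have h (x : Tens A M C) : rid _ (lT _ D.counit.left (f.indAux M x)) =
        tm A (rid M (lT M C.counit.left x)) (Along.one r) := by
      induction x using tens_induction with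
      | zero => simp
      | add x y hx hy => simp only [map_add, hx, hy, add_tm]
      | tm m c =>
        rw [indAux_tm, lT_tm, rid_tm, lT_tm, rid_tm, smul_tm, Along.smul_one, BimodHom.left_apply,
          BimodHom.left_apply, f.counit_map', smul_tm_right]
    induction x using tens_induction with
    | zero => simp
    | add x y hx hy => simp only [map_add, hx, hy]
    | tm m b =>
      rw [indCoact_tm, lT_op_smul D.counit.left (op b.val) (D.counit.map_op_smul' _), rid_op_smul,
        h, M.coact_counit, smul_tm_right, Along.op_smul_one]

/-- The induction functor `- ⊗_A B : M^C → M^D`. -/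
def induction (f : CoringHom C D r) : RightComod C ⥤ RightComod D where
  obj M := f.indObj M
  map {M N} g :=
    { lin := rTr (B := B) (Along r) g.lin
      comm := fun x => by
        have h (x : Tens A M C) : rT D (rTr (B := B) (Along r) g.lin) (f.indAux M x) =
            f.indAux N (rT C g.lin x) :=
          tens_ext ((rT D (rTr (B := B) (Along r) g.lin)).comp (f.indAux M))
            ((f.indAux N).comp (rT C g.lin)) (fun _ _ => rfl) x
        change rT D (rTr (B := B) (Along r) g.lin) (f.indCoact M x) =
          f.indCoact N (rTr (B := B) (Along r) g.lin x)
        induction x using tens_induction with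
        | zero => simp
        | add x y hx hy => simp only [map_add, hx, hy]
        | tm m b =>
          rw [indCoact_tm, rT_op_smul, h, g.comm]
          rfl }
  map_id M := RightComod.hom_ext _ _ fun x => rT_id x
  map_comp g g' := RightComod.hom_ext _ _ fun x => rT_comp g.lin g'.lin x

end CoringHom

namespace CoringHom

variable {A B : Type u} [Ring A] [Ring B] {C : Coring A} {D : Coring B} {r : A →+* B}

/-! The bicomodule `C ⊗_A B`. -/

theorem indCoact_smul (f : CoringHom C D r) {R : Type u} [Ring R] (N : ModComod R C) (s : R)
    (x : Tens A N (Along r)) :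
    f.indCoact N.toRightComod (s • x) = s • f.indCoact N.toRightComod x :=
  map_smul_of_tm (f.indCoact N.toRightComod).toAddMonoidHom s (fun n b => by
    change f.indCoact N.toRightComod (tm A (s • n) b) = s • f.indCoact N.toRightComod (tm A n b)
    rw [indCoact_tm, indCoact_tm, smul_comm, ← indAux_smul, N.coact_smul]) x

/-- The right coaction of `C ⊗_A B` as a bimodule homomorphism. -/
def indCoactBi (f : CoringHom C D r) :
    BimodHom A B (Tens A C (Along r)) (Tens B (Tens A C (Along r)) D) where
  __ := (f.indCoact C.regular.toRightComod).toAddMonoidHom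
  map_smul' := f.indCoact_smul C.regular
  map_op_smul' := (f.indCoact C.regular.toRightComod).map_smul

/-- `N ⊗_A B` for an `R`-`C`-bicomodule `N`. -/
def indMod (f : CoringHom C D r) {R : Type u} [Ring R] (N : ModComod R C) : ModComod R D :=
  { f.indObj N.toRightComod with
    leftModule := inferInstanceAs (Module R (Tens A N (Along r)))
    smulComm := inferInstanceAs (SMulCommClass R Bᵐᵒᵖ (Tens A N (Along r)))
    coact_smul := f.indCoact_smul N }

/-- The left coaction `Δ ⊗ B` of `C` on `C ⊗_A B`. -/
def coactCB (C : Coring A) (r : A →+* B) :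
    BimodHom A B (Tens A C (Along r)) (Tens A C (Tens A C (Along r))) where
  toFun x := assoc C C (Along r) (rT (Along r) C.comul.right x)
  map_zero' := by rw [map_zero, map_zero]
  map_add' x y := by rw [map_add, map_add]
  map_smul' a x := by rw [rT_smul C.comul.right a (C.comul.map_smul' a), assoc_smul]
  map_op_smul' b x := by
    refine Eq.trans ?_ (assoc_op_smul (M := C) (N := C) (P := Along r) b _)
    exact congrArg _ (rT_op_smul C.comul.right b x)

theorem coactCB_apply (x : Tens A C (Along r)) :
    coactCB C r x = assoc C C (Along r) (rT (Along r) C.comul.right x) := rfl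

theorem coactCB_coassoc (x : Tens A C (Along r)) :
    assoc _ _ _ (rT (Tens A C (Along r)) C.comul.right (coactCB C r x)) =
      lT C (coactCB C r).left (coactCB C r x) := by
  induction x using tens_induction with
  | zero => simp
  | add x y hx hy => simp only [map_add, hx, hy]
  | tm c b =>
    have h₁ (z : Tens A C C) : rT (Tens A C (Along r)) C.comul.right
        (assoc C C (Along r) (tm A z b)) = assoc _ _ _ (tm A (rT C C.comul.right z) b) := by
      induction z using tens_induction with
      | zero => simp
      | add x y hx hy => simp only [map_add, add_tm, hx, hy]
      | tm c c' => rfl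
    have h₂ (z : Tens A C C) : lT C (coactCB C r).left (assoc C C (Along r) (tm A z b)) =
        lT C (lTl C (insR C b)) (lT C C.comul.left z) := by
      induction z using tens_induction with
      | zero => simp
      | add x y hx hy => simp only [map_add, add_tm, hx, hy]
      | tm c c' => exact congrArg (tm A c) (assoc_tm_eq (C.comul c') b)
    have h₃ (z : Tens A (Tens A C C) C) : assoc C C (Tens A C (Along r)) (assoc _ C _ (tm A z b)) =
        lT C (lTl C (insR C b)) (assoc C C C z) := by
      rw [assoc_tm_eq, assoc_lT]
    rw [coactCB_apply, rT_tm, BimodHom.right_apply, h₁, h₂, h₃, C.coassoc]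

theorem coactCB_counit (x : Tens A C (Along r)) :
    lid (Tens A C (Along r)) (rT (Tens A C (Along r)) C.counit.right (coactCB C r x)) = x := by
  induction x using tens_induction with
  | zero => simp
  | add x y hx hy => simp only [map_add, hx, hy]
  | tm c b =>
    have h₁ (z : Tens A C C) : lid (Tens A C (Along r)) (rT (Tens A C (Along r)) C.counit.right
        (assoc C C (Along r) (tm A z b))) = tm A (lid C (rT C C.counit.right z)) b := by
      induction z using tens_induction with
      | zero => simp
      | add x y hx hy => simp only [map_add, add_tm, hx, hy]
      | tm c c' => rfl
    rw [coactCB_apply, rT_tm, BimodHom.right_apply, h₁, C.counit_left]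

theorem coactCB_comm (f : CoringHom C D r) (x : Tens A C (Along r)) :
    assoc _ _ _ (rT D (coactCB C r).right (f.indCoact C.regular.toRightComod x)) =
      lT C f.indCoactBi.left (coactCB C r x) := by
  induction x using tens_induction with
  | zero => simp
  | add x y hx hy => simp only [map_add, hx, hy]
  | tm c b =>
    let K : Tens A C C →ₗ[A] Tens B (Tens A C (Along r)) D :=
      { toFun := f.indAux C
        map_add' := map_add _
        map_smul' := f.indAux_smul C }
    let L₀ : Tens A C C →+ Tens A C (Tens A C (Along r)) :=
      (assoc C C (Along r)).toAddMonoidHom.comp (tmL (Along.one r))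
    have hL₀ (a : A) (z : Tens A C C) : L₀ (op a • z) = op (r a) • L₀ z := by
      change assoc C C (Along r) (tm A (op a • z) (Along.one r)) =
        op (r a) • assoc C C (Along r) (tm A z (Along.one r))
      rw [smul_tm, Along.smul_one, ← smul_tm_right, assoc_op_smul]
    have h₁ (z : Tens A C C) : rT D (coactCB C r).right (f.indAux C z) =
        mapAlong r L₀ f.toAddMonoidHom hL₀ f.map_smul' (rT C C.comul.right z) := by
      induction z using tens_induction with
      | zero => simp
      | add x y hx hy => simp only [map_add, hx, hy]
      | tm c c' => rfl
    have h₂ (z : Tens A (Tens A C C) C) : assoc _ _ _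
        (mapAlong r L₀ f.toAddMonoidHom hL₀ f.map_smul' z) = lT C K (assoc C C C z) :=
      tens_ext₃ ((assoc C (Tens A C (Along r)) D).toAddMonoidHom.comp
        (mapAlong r L₀ f.toAddMonoidHom hL₀ f.map_smul'))
        ((lT C K).comp (assoc C C C).toAddMonoidHom) (fun _ _ _ => rfl) z
    have h₃ (z : Tens A C C) : lT C f.indCoactBi.left
        (assoc C C (Along r) (tm A z b)) = op b.val • lT C K (lT C C.comul.left z) := by
      induction z using tens_induction with
      | zero => simp
      | add x y hx hy => simp only [map_add, add_tm, smul_add, hx, hy]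
      | tm c c' => rfl
    rw [indCoact_tm, rT_op_smul, assoc_op_smul, h₁, h₂]
    refine Eq.trans ?_ (h₃ (C.comul c)).symm
    exact congrArg (fun z => op b.val • lT C K z) (C.coassoc c)

/-- The `C`-`D`-bicomodule `C ⊗_A B`: its right coaction is the one of the induction functor and its
left coaction is `Δ ⊗ B`. -/
def tensRight (f : CoringHom C D r) : Bicomodule C D where
  __ := f.indMod C.regular
  coactL := coactCB C r
  coactL_coassoc := coactCB_coassoc
  coactL_counit := coactCB_counit
  coact_comm := f.coactCB_comm

/-! The bicomodule `B ⊗_A C`. -/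

/-- `c ↦ 1 ⊗ c`. -/
def oneTens (C : Coring A) (r : A →+* B) : C →+ Tens A (Along r) C := tmR (Along.one r)

theorem oneTens_smul (a : A) (c : C) : oneTens C r (a • c) = r a • oneTens C r c := by
  change tm A (Along.one r) (a • c) = r a • tm A (Along.one r) c
  rw [smul_tm_left, ← smul_tm, Along.smul_one']

/-- `c ⊗ c' ↦ f c ⊗ (1 ⊗ c')`. -/
def coindAux (f : CoringHom C D r) : Tens A C C →+ Tens B D (Tens A (Along r) C) :=
  mapAlong r f.toAddMonoidHom (oneTens C r) f.map_op_smul' oneTens_smul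

theorem coindAux_tm (f : CoringHom C D r) (c c' : C) : f.coindAux (tm A c c') =
    tm B (f.toAddMonoidHom c) (tm A (Along.one r) c') := rfl

theorem coindAux_smul (f : CoringHom C D r) (a : A) (x : Tens A C C) :
    f.coindAux (a • x) = r a • f.coindAux x := by
  induction x using tens_induction with
  | zero => simp
  | add x y hx hy => simp only [map_add, smul_add, hx, hy]
  | tm m c => rw [smul_tm_left, coindAux_tm, f.map_smul', coindAux_tm, smul_tm_left]

theorem coindAux_op_smul (f : CoringHom C D r) (a : Aᵐᵒᵖ) (x : Tens A C C) :
    f.coindAux (a • x) = a • f.coindAux x := by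
  induction x using tens_induction with
  | zero => simp
  | add x y hx hy => simp only [map_add, smul_add, hx, hy]
  | tm m c => rfl

/-- The left coaction `b ⊗ c ↦ ∑ b f(c₁) ⊗ (1 ⊗ c₂)` of `D` on `B ⊗_A C`. -/
def coactBC (f : CoringHom C D r) :
    BimodHom B A (Tens A (Along r) C) (Tens B D (Tens A (Along r) C)) where
  __ := lift (fun (b : Along r) c => b.val • f.coindAux (C.comul c))
    (fun b b' c => by rw [Along.val_add, add_smul])
    (fun b c c' => by rw [map_add, map_add, smul_add])
    (fun b a c => by
      rw [Along.val_op_smul', mul_smul, unop_op, ← coindAux_smul]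
      exact congrArg (fun t => b.val • f.coindAux t) (C.comul.map_smul' a c).symm)
  map_smul' s := map_smul_of_tm _ s fun b c => by
    rw [lift_tm, lift_tm, Along.val_smul', mul_smul]
  map_op_smul' s := map_op_smul_of_tm _ s fun b c => by
    rw [lift_tm, lift_tm, ← smul_comm, ← coindAux_op_smul]
    exact congrArg (fun t => b.val • f.coindAux t) (C.comul.map_op_smul' s c)

theorem coactBC_tm (f : CoringHom C D r) (b : Along r) (c : C) :
    f.coactBC (tm A b c) = b.val • f.coindAux (C.comul c) := rfl

theorem coactBC_coassoc (f : CoringHom C D r) (x : Tens A (Along r) C) :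
    assoc _ _ _ (rT (Tens A (Along r) C) D.comul.right (f.coactBC x)) =
      lT D f.coactBC.left (f.coactBC x) := by
  have hD (a : A) (x : Tens A C C) : mapAlong r f.toAddMonoidHom f.toAddMonoidHom
      f.map_op_smul' f.map_smul' (op a • x) = op (r a) • mapAlong r f.toAddMonoidHom
      f.toAddMonoidHom f.map_op_smul' f.map_smul' x := by
    induction x using tens_induction with
    | zero => simp
    | add x y hx hy => simp only [map_add, smul_add, hx, hy]
    | tm c c' => exact congrArg (tm B (f.toAddMonoidHom c)) (f.map_op_smul' a c')
  have h₁ (z : Tens A C C) : rT (Tens A (Along r) C) D.comul.right (f.coindAux z) =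
      mapAlong r (mapAlong r f.toAddMonoidHom f.toAddMonoidHom f.map_op_smul' f.map_smul')
        (oneTens C r) hD oneTens_smul (rT C C.comul.right z) :=
    tens_ext ((rT (Tens A (Along r) C) D.comul.right).comp f.coindAux)
      ((mapAlong r (mapAlong r f.toAddMonoidHom f.toAddMonoidHom f.map_op_smul' f.map_smul')
        (oneTens C r) hD oneTens_smul).comp (rT C C.comul.right))
      (fun c c' => congrArg (fun t => tm B t (tm A (Along.one r) c')) (f.comul_map' c)) z
  have h₂ (z : Tens A (Tens A C C) C) : assoc _ _ _ (mapAlong r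
      (mapAlong r f.toAddMonoidHom f.toAddMonoidHom f.map_op_smul' f.map_smul')
      (oneTens C r) hD oneTens_smul z) = mapAlong r f.toAddMonoidHom f.coindAux
        f.map_op_smul' f.coindAux_smul (assoc _ _ _ z) :=
    tens_ext₃ ((assoc D D (Tens A (Along r) C)).toAddMonoidHom.comp (mapAlong r
      (mapAlong r f.toAddMonoidHom f.toAddMonoidHom f.map_op_smul' f.map_smul')
      (oneTens C r) hD oneTens_smul)) ((mapAlong r f.toAddMonoidHom f.coindAux
        f.map_op_smul' f.coindAux_smul).comp (assoc C C C).toAddMonoidHom) (fun _ _ _ => rfl) z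
  have h₃ (z : Tens A C C) : lT D f.coactBC.left (f.coindAux z) =
      mapAlong r f.toAddMonoidHom f.coindAux f.map_op_smul' f.coindAux_smul
        (lT C C.comul.left z) := by
    refine tens_ext ((lT D f.coactBC.left).comp f.coindAux)
      ((mapAlong r f.toAddMonoidHom f.coindAux f.map_op_smul' f.coindAux_smul).comp
        (lT C C.comul.left)) (fun c c' => ?_) z
    refine congrArg (tm B (f.toAddMonoidHom c)) ((f.coactBC_tm (Along.one r) c').trans ?_)
    rw [Along.val_one, one_smul]
    rfl
  induction x using tens_induction with
  | zero => simp
  | add x y hx hy => simp only [map_add, hx, hy]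
  | tm b c =>
    rw [coactBC_tm, rT_smul D.comul.right _ (D.comul.map_smul' _), assoc_smul, lT_smul, h₁, h₂, h₃,
      C.coassoc]

theorem coactBC_counit (f : CoringHom C D r) (x : Tens A (Along r) C) :
    lid _ (rT (Tens A (Along r) C) D.counit.right (f.coactBC x)) = x := by
  have h (z : Tens A C C) : lid _ (rT (Tens A (Along r) C) D.counit.right (f.coindAux z)) =
      tm A (Along.one r) (lid C (rT C C.counit.right z)) := by
    induction z using tens_induction with
    | zero => simp
    | add x y hx hy => simp only [map_add, hx, hy, tm_add]
    | tm c c' =>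
      rw [coindAux_tm, rT_tm, lid_tm, rT_tm, lid_tm, ← smul_tm, ← Along.smul_one',
        BimodHom.right_apply, BimodHom.right_apply, f.counit_map', smul_tm_left]
  induction x using tens_induction with
  | zero => simp
  | add x y hx hy => simp only [map_add, hx, hy]
  | tm b c =>
    rw [coactBC_tm, rT_smul D.counit.right _ (D.counit.map_smul' _), lid_smul, h, C.counit_left,
      smul_tm_left, Along.val_smul_one]

theorem coind_smul (C : Coring A) (r : A →+* B) (b : B) (x : Tens A (Along r) C) :
    C.regular.tensCoact (Along r) (b • x) = b • C.regular.tensCoact (Along r) x :=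
  map_smul_of_tm (C.regular.tensCoact (Along r)).toAddMonoidHom b
    (fun y c => assoc_symm_smul b (tm A y (C.comul c))) x

/-- The right coaction `B ⊗ Δ` as a bimodule homomorphism. -/
def coindCoactBi (C : Coring A) (r : A →+* B) :
    BimodHom B A (Tens A (Along r) C) (Tens A (Tens A (Along r) C) C) where
  __ := (C.regular.tensCoact (Along r)).toAddMonoidHom
  map_smul' := coind_smul C r
  map_op_smul' := (C.regular.tensCoact (Along r)).map_smul

/-- The bimodule `B ⊗_A C` with the right coaction `B ⊗ Δ`. -/
def coindMod (C : Coring A) (r : A →+* B) : ModComod B C :=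
  { C.regular.tensObj (Along r) with
    leftModule := inferInstanceAs (Module B (Tens A (Along r) C))
    smulComm := inferInstanceAs (SMulCommClass B Aᵐᵒᵖ (Tens A (Along r) C))
    coact_smul := coind_smul C r }

theorem coactBC_comm (f : CoringHom C D r) (x : Tens A (Along r) C) :
    assoc _ _ _ (rT C f.coactBC.right (C.regular.tensCoact (Along r) x)) =
      lT D (coindCoactBi C r).left (f.coactBC x) := by
  let K : Tens A C C →+ Tens A (Tens A (Along r) C) C :=
    (assoc (Along r) C C).symm.toAddMonoidHom.comp (tmR (Along.one r))
  have hK (a : A) (z : Tens A C C) : K (a • z) = r a • K z := by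
    change (assoc (Along r) C C).symm (tm A (Along.one r) (a • z)) =
      r a • (assoc (Along r) C C).symm (tm A (Along.one r) z)
    rw [← smul_tm, ← Along.smul_one', ← smul_tm_left, assoc_symm_smul]
  have h₁ (b : Along r) (z : Tens A C C) : rT C f.coactBC.right
      ((assoc (Along r) C C).symm (tm A b z)) =
        b.val • rT C (⟨⟨f.coindAux, map_add _⟩, f.coindAux_op_smul⟩ :
          Tens A C C →ₗ[Aᵐᵒᵖ] Tens B D (Tens A (Along r) C)) (rT C C.comul.right z) := by
    induction z using tens_induction with
    | zero => simp
    | add x y hx hy => simp only [map_add, smul_add, hx, hy, tm_add]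
    | tm c c' => rfl
  have h₂ (z : Tens A (Tens A C C) C) : assoc _ _ _
      (rT C (⟨⟨f.coindAux, map_add _⟩, f.coindAux_op_smul⟩ :
          Tens A C C →ₗ[Aᵐᵒᵖ] Tens B D (Tens A (Along r) C)) z) =
      mapAlong r f.toAddMonoidHom K f.map_op_smul' hK (assoc _ _ _ z) :=
    tens_ext₃ ((assoc D (Tens A (Along r) C) C).toAddMonoidHom.comp
      (rT C (⟨⟨f.coindAux, map_add _⟩, f.coindAux_op_smul⟩ :
          Tens A C C →ₗ[Aᵐᵒᵖ] Tens B D (Tens A (Along r) C))))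
      ((mapAlong r f.toAddMonoidHom K f.map_op_smul' hK).comp (assoc C C C).toAddMonoidHom)
      (fun _ _ _ => rfl) z
  have h₃ (z : Tens A C C) : lT D (coindCoactBi C r).left (f.coindAux z) =
      mapAlong r f.toAddMonoidHom K f.map_op_smul' hK (lT C C.comul.left z) := by
    induction z using tens_induction with
    | zero => simp
    | add x y hx hy => simp only [map_add, hx, hy]
    | tm c c' => rfl
  induction x using tens_induction with
  | zero => simp
  | add x y hx hy => simp only [map_add, hx, hy]
  | tm b c =>
    refine Eq.trans (congrArg _ (h₁ b (C.comul c))) ?_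
    rw [coactBC_tm, assoc_smul, lT_smul, h₂, h₃, C.coassoc]

/-- The `D`-`C`-bicomodule `B ⊗_A C`: its right coaction is `B ⊗ Δ` and its left coaction is
`b ⊗ c ↦ ∑ b f(c₁) ⊗ (1 ⊗ c₂)`. -/
def tensLeft (f : CoringHom C D r) : Bicomodule D C where
  __ := coindMod C r
  coactL := f.coactBC
  coactL_coassoc := f.coactBC_coassoc
  coactL_counit := f.coactBC_counit
  coact_comm := f.coactBC_comm

end CoringHom

/-! ### The co-hom functor and its bicomodule structure -/

section Cohom

variable {A B : Type u} [Ring A] [Ring B] {C : Coring A} {D : Coring B}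

/-- Left multiplication by `b` as an endomorphism of the right `D`-comodule `D`. -/
def Coring.lmul (D : Coring B) (b : B) : D.regular.toRightComod ⟶ D.regular.toRightComod where
  lin := DistribSMul.toLinearMap Bᵐᵒᵖ D b
  comm d := (D.comul.map_smul' b d).symm

/-- The comodule map `D → X ⊗_B D`, `d ↦ x ⊗ d`. -/
def Coring.insHom (D : Coring B) {X : Type u} [AddCommGroup X] [Module Bᵐᵒᵖ X] (x : X) :
    D.regular.toRightComod ⟶ D.regular.tensObj X where
  lin := ins D x
  comm d := (assoc_symm_tm_eq x (D.comul d)).symm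

/-- The comultiplication as a comodule map `D → D ⊗_B D`. -/
def Coring.comulHom (D : Coring B) : D.regular.toRightComod ⟶ D.regular.tensObj D where
  lin := D.comul.right
  comm d := ((assoc D D D).symm_apply_eq.2 (D.coassoc d).symm).symm

section Adj

variable {N : ModComod A D} {h : RightComod D ⥤ ModuleCat.{u} Aᵐᵒᵖ}

/-- The unit `Y → h(Y) ⊗_A N`. -/
def unitLin (adj : h ⊣ N.tensorFunctor) (Y : RightComod D) : Y →ₗ[Bᵐᵒᵖ] Tens A (h.obj Y) N :=
  (adj.unit.app Y).lin

theorem unitLin_comm (adj : h ⊣ N.tensorFunctor) (Y : RightComod D) (y : Y) :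
    rT D (unitLin adj Y) (Y.coact y) = N.tensCoact (h.obj Y) (unitLin adj Y y) :=
  (adj.unit.app Y).comm y

theorem unitLin_naturality (adj : h ⊣ N.tensorFunctor) {Y Y' : RightComod D} (g : Y ⟶ Y') (y : Y) :
    rT N (h.map g).hom (unitLin adj Y y) = unitLin adj Y' (g.lin y) :=
  (congrArg (fun k => RightComod.Hom.lin k y) (adj.unit.naturality g)).symm

variable {Z : Type u} [AddCommGroup Z] [Module Aᵐᵒᵖ Z]

/-- The linear map `h(Y) → Z` corresponding to a comodule map `Y → Z ⊗_A N`. -/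
def desc (adj : h ⊣ N.tensorFunctor) {Y : RightComod D} (g : Y ⟶ N.tensObj Z) :
    h.obj Y →ₗ[Aᵐᵒᵖ] Z :=
  ((adj.homEquiv Y (ModuleCat.of Aᵐᵒᵖ Z)).symm g).hom

theorem rT_desc (adj : h ⊣ N.tensorFunctor) {Y : RightComod D} (g : Y ⟶ N.tensObj Z) (y : Y) :
    rT N (desc adj g) (unitLin adj Y y) = g.lin y := by
  have := (adj.homEquiv Y (ModuleCat.of Aᵐᵒᵖ Z)).apply_symm_apply g
  rw [Adjunction.homEquiv_unit] at this
  exact congrArg (fun k => RightComod.Hom.lin k y) this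

theorem adj_ext (adj : h ⊣ N.tensorFunctor) {Y : RightComod D} {f g : h.obj Y →ₗ[Aᵐᵒᵖ] Z}
    (hfg : ∀ y, rT N f (unitLin adj Y y) = rT N g (unitLin adj Y y)) : f = g := by
  have : ModuleCat.ofHom f = ModuleCat.ofHom g := by
    apply (adj.homEquiv Y (ModuleCat.of Aᵐᵒᵖ Z)).injective
    rw [Adjunction.homEquiv_unit, Adjunction.homEquiv_unit]
    exact RightComod.hom_ext _ _ hfg
  exact congrArg ModuleCat.Hom.hom this

/-- The right `A`-module `h(D)`. -/
def Cohom (_ : h ⊣ N.tensorFunctor) : Type u := h.obj D.regular.toRightComod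

instance (adj : h ⊣ N.tensorFunctor) : AddCommGroup (Cohom adj) :=
  inferInstanceAs (AddCommGroup (h.obj D.regular.toRightComod))

instance (adj : h ⊣ N.tensorFunctor) : Module Aᵐᵒᵖ (Cohom adj) :=
  inferInstanceAs (Module Aᵐᵒᵖ (h.obj D.regular.toRightComod))

/-- The unit `D → h(D) ⊗_A N`. -/
def coev (adj : h ⊣ N.tensorFunctor) : D →ₗ[Bᵐᵒᵖ] Tens A (Cohom adj) N :=
  unitLin adj D.regular.toRightComod

theorem cohom_ext {adj : h ⊣ N.tensorFunctor} {f g : Cohom adj →ₗ[Aᵐᵒᵖ] Z}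
    (hfg : ∀ d, rT N f (coev adj d) = rT N g (coev adj d)) : f = g :=
  adj_ext adj hfg

/-- `h` applied to left multiplication by `b`. -/
def cohomMul (adj : h ⊣ N.tensorFunctor) (b : B) : Cohom adj →ₗ[Aᵐᵒᵖ] Cohom adj :=
  (h.map (D.lmul b)).hom

theorem rT_cohomMul (adj : h ⊣ N.tensorFunctor) (b : B) (d : D) :
    rT N (cohomMul adj b) (coev adj d) = coev adj (b • d) :=
  unitLin_naturality adj (D.lmul b) d

/-- The left action of `B` on `h(D)`, `b z = h(d ↦ b d)(z)`. -/
instance (adj : h ⊣ N.tensorFunctor) : Module B (Cohom adj) where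
  smul b := cohomMul adj b
  one_smul := LinearMap.congr_fun (g := LinearMap.id) (cohom_ext fun d => by
    rw [rT_cohomMul, rT_id, one_smul])
  mul_smul b b' := LinearMap.congr_fun (g := (cohomMul adj b).comp (cohomMul adj b'))
    (cohom_ext fun d => by
      rw [rT_comp, rT_cohomMul, rT_cohomMul, rT_cohomMul, mul_smul])
  smul_zero b := map_zero (cohomMul adj b)
  smul_add b := map_add (cohomMul adj b)
  add_smul b b' := LinearMap.congr_fun (g := cohomMul adj b + cohomMul adj b')
    (cohom_ext fun d => by
      rw [rT_add, rT_cohomMul, rT_cohomMul, rT_cohomMul, add_smul, map_add])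
  zero_smul := LinearMap.congr_fun (f := cohomMul adj 0) (g := 0) (cohom_ext fun d => by
    have h0 : rT N (0 : Cohom adj →ₗ[Aᵐᵒᵖ] Cohom adj) (coev adj d) = 0 := by
      simpa using rT_add (N := N) (0 : Cohom adj →ₗ[Aᵐᵒᵖ] Cohom adj) 0 (coev adj d)
    rw [rT_cohomMul, h0, zero_smul, map_zero])

instance (adj : h ⊣ N.tensorFunctor) : SMulCommClass B Aᵐᵒᵖ (Cohom adj) where
  smul_comm b := (cohomMul adj b).map_smul

/-- The unit `D → h(D) ⊗_A N` as a bimodule homomorphism. -/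
def coevBi (adj : h ⊣ N.tensorFunctor) : BimodHom B B D (Tens A (Cohom adj) N) where
  __ := (coev adj).toAddMonoidHom
  map_smul' b d := (rT_cohomMul adj b d).symm
  map_op_smul' := (coev adj).map_smul

theorem coevBi_apply (adj : h ⊣ N.tensorFunctor) (d : D) : coevBi adj d = coev adj d := rfl

section Upsilon

variable (adj : h ⊣ N.tensorFunctor) (X : Type u) [AddCommGroup X] [Module Bᵐᵒᵖ X]

/-- The canonical map `X ⊗_B h(D) → h(X ⊗_B D)`, `x ⊗ z ↦ h(d ↦ x ⊗ d)(z)`. -/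
def upsilon : Tens B X (Cohom adj) →ₗ[Aᵐᵒᵖ] h.obj (D.regular.tensObj X) where
  toFun := lift (fun x (z : Cohom adj) => (h.map (D.insHom x)).hom z)
    (fun x x' z => LinearMap.congr_fun (g := (h.map (D.insHom x)).hom + (h.map (D.insHom x')).hom)
      (adj_ext adj fun d => by
        rw [rT_add, unitLin_naturality, unitLin_naturality, unitLin_naturality, ← map_add]
        exact congrArg _ (add_tm x x' d)) z)
    (fun x z z' => map_add _ _ _)
    (fun x b z => LinearMap.congr_fun (g := (h.map (D.insHom x)).hom.comp (h.map (D.lmul b)).hom)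
      (adj_ext adj fun d => by
        rw [rT_comp, unitLin_naturality, unitLin_naturality, unitLin_naturality]
        exact congrArg _ (smul_tm b x d)) z)
  map_add' := map_add _
  map_smul' a := map_op_smul_of_tm _ a fun x z => (h.map (D.insHom x)).hom.map_smul a z

theorem upsilon_tm (x : X) (z : Cohom adj) :
    upsilon adj X (tm B x z) = (h.map (D.insHom x)).hom z := rfl

/-- The map `X ⊗_B D → (X ⊗_B h(D)) ⊗_A N` induced by the unit. -/
def upsilonInvLin : Tens B X D →ₗ[Bᵐᵒᵖ] Tens A (Tens B X (Cohom adj)) N where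
  toFun x := (assoc X (Cohom adj) N).symm (lT X (coevBi adj).left x)
  map_add' x y := by rw [map_add, map_add]
  map_smul' s x := by
    rw [RingHom.id_apply, ← assoc_symm_op_smul]
    exact congrArg _ (lT_op_smul (coevBi adj).left s ((coevBi adj).map_op_smul' s) x)

variable {X}

theorem upsilonInvLin_tm (x : X) (d : D) :
    upsilonInvLin adj X (tm B x d) = rT N (ins (Cohom adj) x) (coev adj d) :=
  assoc_symm_tm_eq x (coev adj d)

theorem upsilonInvLin_comm (t : Tens B X D) :
    rT D (upsilonInvLin adj X) (D.regular.tensCoact X t) =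
      N.tensCoact (Tens B X (Cohom adj)) (upsilonInvLin adj X t) := by
  induction t using tens_induction with
  | zero => simp
  | add x y hx hy => simp only [map_add, hx, hy]
  | tm x d =>
    have h₁ : (upsilonInvLin adj X).comp (ins D x) = (rTr N (ins (Cohom adj) x)).comp (coev adj) :=
      LinearMap.ext fun d => upsilonInvLin_tm adj x d
    have h₂ : rT D (coev adj) (D.comul d) = N.tensCoact (Cohom adj) (coev adj d) :=
      unitLin_comm adj D.regular.toRightComod d
    have h₃ : D.regular.tensCoact X (tm B x d) = rT D (ins D x) (D.comul d) :=
      assoc_symm_tm_eq x (D.comul d)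
    rw [h₃, ← rT_comp, h₁, rT_comp, h₂, ModComod.rT_tensCoact, upsilonInvLin_tm]

theorem upsilon_upsilonInvLin (t : Tens B X D) :
    rT N (upsilon adj X) (upsilonInvLin adj X t) = unitLin adj (D.regular.tensObj X) t := by
  refine tens_ext ((rT N (upsilon adj X)).comp (upsilonInvLin adj X).toAddMonoidHom)
    (unitLin adj (D.regular.tensObj X)).toAddMonoidHom (fun x d => ?_) t
  have h₁ : (upsilon adj X).comp (ins (Cohom adj) x) = (h.map (D.insHom x)).hom :=
    LinearMap.ext fun z => rfl
  change rT N (upsilon adj X) (upsilonInvLin adj X (tm B x d)) = _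
  rw [upsilonInvLin_tm, ← rT_comp, h₁]
  exact unitLin_naturality adj (D.insHom x) d

variable (X)

/-- The comodule map `X ⊗_B D → (X ⊗_B h(D)) ⊗_A N` induced by the unit. -/
def upsilonInvHom : D.regular.tensObj X ⟶ N.tensObj (Tens B X (Cohom adj)) where
  lin := upsilonInvLin adj X
  comm := upsilonInvLin_comm adj

/-- The canonical map `X ⊗_B h(D) → h(X ⊗_B D)` is an isomorphism. -/
def upsilonEquiv : Tens B X (Cohom adj) ≃ₗ[Aᵐᵒᵖ] h.obj (D.regular.tensObj X) where
  __ := upsilon adj X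
  invFun := desc adj (upsilonInvHom adj X)
  left_inv t := by
    refine tens_ext ((desc adj (upsilonInvHom adj X)).toAddMonoidHom.comp
      (upsilon adj X).toAddMonoidHom) (AddMonoidHom.id _) (fun x z => ?_) t
    refine LinearMap.congr_fun (f := (desc adj (upsilonInvHom adj X)).comp
      (h.map (D.insHom x)).hom) (g := ins (B := A) (Cohom adj) x) (adj_ext adj fun d => ?_) z
    rw [rT_comp, unitLin_naturality, rT_desc]
    exact upsilonInvLin_tm adj x d
  right_inv := LinearMap.congr_fun (f := (upsilon adj X).comp (desc adj (upsilonInvHom adj X)))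
    (g := LinearMap.id) (adj_ext adj fun t => by
      rw [rT_comp, rT_desc, rT_id]
      exact upsilon_upsilonInvLin adj t)

theorem rT_upsilonEquiv_symm (t : Tens B X D) :
    rT N (upsilonEquiv adj X).symm.toLinearMap (unitLin adj (D.regular.tensObj X) t) =
      (assoc X (Cohom adj) N).symm (lT X (coevBi adj).left t) :=
  rT_desc adj (upsilonInvHom adj X) t

end Upsilon

/-- The left coaction `h(D) → h(D ⊗_B D) ≅ D ⊗_B h(D)`. -/
def cohomCoactL (adj : h ⊣ N.tensorFunctor) : Cohom adj →ₗ[Aᵐᵒᵖ] Tens B D (Cohom adj) :=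
  (upsilonEquiv adj D).symm.toLinearMap.comp (h.map D.comulHom).hom

theorem rT_cohomCoactL (adj : h ⊣ N.tensorFunctor) (d : D) :
    rT N (cohomCoactL adj) (coev adj d) =
      (assoc D (Cohom adj) N).symm (lT D (coevBi adj).left (D.comul d)) := by
  refine (rT_comp (N := N) (h.map D.comulHom).hom _ _).trans ?_
  refine (congrArg _ (unitLin_naturality adj D.comulHom d)).trans ?_
  exact rT_upsilonEquiv_symm adj D (D.comul d)

/-- The left coaction of `h(D)` as a bimodule homomorphism. -/
def cohomCoactLBi (adj : h ⊣ N.tensorFunctor) :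
    BimodHom B A (Cohom adj) (Tens B D (Cohom adj)) where
  __ := (cohomCoactL adj).toAddMonoidHom
  map_smul' b := LinearMap.congr_fun (f := (cohomCoactL adj).comp (cohomMul adj b))
    (g := (DistribSMul.toLinearMap Aᵐᵒᵖ _ b).comp (cohomCoactL adj)) (cohom_ext fun d => by
      rw [rT_comp, rT_comp, rT_cohomMul, rT_cohomCoactL, rT_cohomCoactL]
      refine Eq.trans ?_ (assoc_symm_smul (M := D) (N := Cohom adj) (P := N) b _)
      rw [← lT_smul]
      exact congrArg (fun t => (assoc D (Cohom adj) N).symm (lT D (coevBi adj).left t))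
        (D.comul.map_smul' b d))
  map_op_smul' := (cohomCoactL adj).map_smul

end Adj

section Bicomod

variable {N : Bicomodule C D} {h : RightComod D ⥤ ModuleCat.{u} Aᵐᵒᵖ}

/-- The map `X ⊗_A N → (X ⊗_A C) ⊗_A N` induced by the left coaction of `N`. -/
def Bicomodule.tensCoactL (N : Bicomodule C D) (X : Type u) [AddCommGroup X] [Module Aᵐᵒᵖ X] :
    Tens A X N →ₗ[Bᵐᵒᵖ] Tens A (Tens A X C) N where
  toFun x := (assoc X C N).symm (lT X N.coactL.left x)
  map_add' x y := by rw [map_add, map_add]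
  map_smul' s x := by
    rw [RingHom.id_apply, ← assoc_symm_op_smul]
    exact congrArg _ (lT_op_smul N.coactL.left s (N.coactL.map_op_smul' s) x)

theorem Bicomodule.tensCoactL_tm (N : Bicomodule C D) {X : Type u} [AddCommGroup X]
    [Module Aᵐᵒᵖ X] (x : X) (n : N) :
    N.tensCoactL X (tm A x n) = rT N (ins C x) (N.coactL n) :=
  assoc_symm_tm_eq x (N.coactL n)

/-- The map `X ⊗_A N → (X ⊗_A C) ⊗_A N` is a comodule map. -/
def Bicomodule.tensCoactLHom (N : Bicomodule C D) (X : Type u) [AddCommGroup X]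
    [Module Aᵐᵒᵖ X] : N.tensObj X ⟶ N.tensObj (Tens A X C) where
  lin := N.tensCoactL X
  comm t := by
    change rT D (N.tensCoactL X) (N.tensCoact X t) = N.tensCoact _ (N.tensCoactL X t)
    induction t using tens_induction with
    | zero => simp
    | add x y hx hy => simp only [map_add, hx, hy]
    | tm x n =>
      have h₁ : (N.tensCoactL X).comp (ins N x) = (rTr N (ins C x)).comp N.coactL.right :=
        LinearMap.ext fun n => N.tensCoactL_tm x n
      have h₂ : N.tensCoact C (N.coactL n) = rT D N.coactL.right (N.coact n) :=
        (assoc _ _ _).symm_apply_eq.2 (N.coact_comm n).symm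
      rw [ModComod.tensCoact_tm, assoc_symm_tm_eq, ← rT_comp, h₁, rT_comp, N.tensCoactL_tm,
        ← ModComod.rT_tensCoact, h₂]

/-- The right coaction of `C` on `h(D)`: the unique map compatible through the unit with the left
coaction of `C` on `N`. -/
def cohomCoactR (adj : h ⊣ N.tensorFunctor) : Cohom adj →ₗ[Aᵐᵒᵖ] Tens A (Cohom adj) C :=
  desc adj (adj.unit.app D.regular.toRightComod ≫ N.tensCoactLHom (Cohom adj))

theorem rT_cohomCoactR (adj : h ⊣ N.tensorFunctor) (d : D) :
    rT N (cohomCoactR adj) (coev adj d) =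
      (assoc (Cohom adj) C N).symm (lT _ N.coactL.left (coev adj d)) :=
  rT_desc adj (adj.unit.app D.regular.toRightComod ≫ N.tensCoactLHom (Cohom adj)) d

/-- The right coaction of `h(D)` as a bimodule homomorphism. -/
def cohomCoactRBi (adj : h ⊣ N.tensorFunctor) :
    BimodHom B A (Cohom adj) (Tens A (Cohom adj) C) where
  __ := (cohomCoactR adj).toAddMonoidHom
  map_smul' b := LinearMap.congr_fun (f := (cohomCoactR adj).comp (cohomMul adj b))
    (g := (DistribSMul.toLinearMap Aᵐᵒᵖ _ b).comp (cohomCoactR adj)) (cohom_ext fun d => by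
      rw [rT_comp, rT_comp, rT_cohomMul, rT_cohomCoactR, rT_cohomCoactR]
      refine Eq.trans ?_ (assoc_symm_smul (M := Cohom adj) (N := C) (P := N) b _)
      rw [← lT_smul]
      exact congrArg (fun t => (assoc (Cohom adj) C N).symm (lT _ N.coactL.left t))
        ((coevBi adj).map_smul' b d))
  map_op_smul' := (cohomCoactR adj).map_smul

theorem cohom_coact_coassoc (adj : h ⊣ N.tensorFunctor) (z : Cohom adj) :
    assoc _ _ _ (rT C (cohomCoactR adj) (cohomCoactR adj z)) =
      lT (Cohom adj) C.comul.left (cohomCoactR adj z) :=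
  LinearMap.congr_fun
    (f := (assocR _ _ _).comp ((rTr C (cohomCoactR adj)).comp (cohomCoactR adj)))
    (g := (lTr _ C.comul).comp (cohomCoactR adj)) (cohom_ext fun d => by
      have key (u : Tens A (Cohom adj) N) :
          rT N (assocR (Cohom adj) C C) ((assoc (Tens A (Cohom adj) C) C N).symm
            (lT _ N.coactL.left ((assoc (Cohom adj) C N).symm (lT _ N.coactL.left u)))) =
          rT N (lTr _ C.comul) ((assoc (Cohom adj) C N).symm (lT _ N.coactL.left u)) := by
        induction u using tens_induction with
        | zero => simp
        | add x y hx hy => simp only [map_add, hx, hy]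
        | tm x n =>
          have h₁ (w : Tens A C N) :
              rT N (assocR (Cohom adj) C C) ((assoc (Tens A (Cohom adj) C) C N).symm
                (lT _ N.coactL.left ((assoc (Cohom adj) C N).symm (tm A x w)))) =
              rT N (ins _ x) ((assoc C C N).symm (lT C N.coactL.left w)) := by
            induction w using tens_induction with
            | zero => simp
            | add x y hx hy => simp only [map_add, tm_add, hx, hy]
            | tm c n =>
              rw [assoc_symm_tm, lT_tm, lT_tm, assoc_symm_tm_eq, assoc_symm_tm_eq, ← rT_comp,
                ← rT_comp]
              rfl
          have h₂ (w : Tens A C N) : rT N (lTr _ C.comul) ((assoc (Cohom adj) C N).symm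
              (tm A x w)) = rT N (ins _ x) (rT N C.comul.right w) := by
            rw [assoc_symm_tm_eq, ← rT_comp, ← rT_comp]
            rfl
          rw [lT_tm, h₁, h₂]
          exact congrArg _ ((assoc C C N).symm_apply_eq.2 (N.coactL_coassoc n).symm)
      rw [rT_comp, rT_comp, rT_comp, rT_cohomCoactR, ← assoc_symm_rT, rT_lT, rT_cohomCoactR, key]) z

theorem cohom_coact_counit (adj : h ⊣ N.tensorFunctor) (z : Cohom adj) :
    rid (Cohom adj) (lT (Cohom adj) C.counit.left (cohomCoactR adj z)) = z :=
  LinearMap.congr_fun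
    (f := (ridR _).comp ((lTr _ C.counit).comp (cohomCoactR adj)))
    (g := LinearMap.id) (cohom_ext fun d => by
      have key (u : Tens A (Cohom adj) N) : rT N (ridR (Cohom adj)) (rT N (lTr _ C.counit)
          ((assoc (Cohom adj) C N).symm (lT _ N.coactL.left u))) = u := by
        induction u using tens_induction with
        | zero => simp
        | add x y hx hy => simp only [map_add, hx, hy]
        | tm x n =>
          have h₁ (w : Tens A C N) : rT N (ridR (Cohom adj)) (rT N (lTr _ C.counit)
              ((assoc (Cohom adj) C N).symm (tm A x w))) =
              tm A x (lid N (rT N C.counit.right w)) := by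
            induction w using tens_induction with
            | zero => simp
            | add x y hx hy => simp only [map_add, tm_add, hx, hy]
            | tm c n => exact smul_tm (C.counit c) x n
          rw [lT_tm, h₁]
          exact congrArg _ (N.coactL_counit n)
      rw [rT_comp, rT_comp, rT_cohomCoactR, key, rT_id]) z

theorem cohom_coactL_coassoc (adj : h ⊣ N.tensorFunctor) (z : Cohom adj) :
    assoc _ _ _ (rT (Cohom adj) D.comul.right (cohomCoactLBi adj z)) =
      lT D (cohomCoactLBi adj).left (cohomCoactLBi adj z) :=
  LinearMap.congr_fun
    (f := (assocR _ _ _).comp ((rTr _ D.comul.right).comp (cohomCoactL adj)))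
    (g := (lTr _ (cohomCoactLBi adj)).comp (cohomCoactL adj)) (cohom_ext fun d => by
      let G : Tens B D D →ₗ[B] Tens A (Tens B D (Cohom adj)) N :=
        { toFun := fun y => (assoc D (Cohom adj) N).symm (lT D (coevBi adj).left y)
          map_add' := fun x y => by rw [map_add, map_add]
          map_smul' := fun b x => by rw [lT_smul, assoc_symm_smul, RingHom.id_apply] }
      have key₁ (v : Tens B (Tens B D D) D) :
          rT N (assocR D D (Cohom adj)) ((assoc (Tens B D D) (Cohom adj) N).symm
            (lT _ (coevBi adj).left v)) =
          (assoc _ _ _).symm (lT D G (assoc D D D v)) := by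
        induction v using tens_induction with
        | zero => simp
        | add x y hx hy => simp only [map_add, hx, hy]
        | tm w d₃ =>
          induction w using tens_induction with
          | zero => simp
          | add x y hx hy => simp only [map_add, add_tm, hx, hy]
          | tm d₁ d₂ =>
            have hG : G (tm B d₂ d₃) = rT N (ins _ d₂) (coev adj d₃) :=
              assoc_symm_tm_eq d₂ (coev adj d₃)
            rw [assoc_tm, lT_tm, lT_tm, hG, assoc_symm_tm_eq, assoc_symm_tm_eq, ← rT_comp,
              ← rT_comp]
            rfl
      have key₂ (w : Tens B D D) : rT N (lTr _ (cohomCoactLBi adj))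
          ((assoc D (Cohom adj) N).symm (lT D (coevBi adj).left w)) =
          (assoc _ _ _).symm (lT D G (lT D D.comul.left w)) := by
        induction w using tens_induction with
        | zero => simp
        | add x y hx hy => simp only [map_add, hx, hy]
        | tm d₁ d₂ =>
          have hG : G (D.comul d₂) = rT N (cohomCoactL adj) (coev adj d₂) :=
            (rT_cohomCoactL adj d₂).symm
          rw [lT_tm, lT_tm, lT_tm, BimodHom.left_apply D.comul, hG, assoc_symm_tm_eq,
            assoc_symm_tm_eq, ← rT_comp, ← rT_comp]
          rfl
      rw [rT_comp, rT_comp, rT_comp, rT_cohomCoactL, ← assoc_symm_rT, rT_lT, key₁, key₂,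
        D.coassoc]) z

theorem cohom_coactL_counit (adj : h ⊣ N.tensorFunctor) (z : Cohom adj) :
    lid (Cohom adj) (rT (Cohom adj) D.counit.right (cohomCoactLBi adj z)) = z :=
  LinearMap.congr_fun
    (f := (lidR _).comp ((rTr _ D.counit.right).comp (cohomCoactL adj)))
    (g := LinearMap.id) (cohom_ext fun d => by
      have key (v : Tens B B D) : rT N (lidR (Cohom adj)) ((assoc B (Cohom adj) N).symm
          (lT B (coevBi adj).left v)) = coev adj (lid D v) := by
        induction v using tens_induction with
        | zero => simp
        | add x y hx hy => simp only [map_add, hx, hy]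
        | tm b d =>
          rw [lT_tm, assoc_symm_tm_eq, ← rT_comp, lid_tm, ← rT_cohomMul]
          rfl
      rw [rT_comp, rT_comp, rT_cohomCoactL, ← assoc_symm_rT, rT_lT, key, rT_id]
      exact congrArg _ (D.counit_left d)) z

theorem cohom_coact_comm (adj : h ⊣ N.tensorFunctor) (z : Cohom adj) :
    assoc _ _ _ (rT C (cohomCoactLBi adj).right (cohomCoactR adj z)) =
      lT D (cohomCoactRBi adj).left (cohomCoactLBi adj z) :=
  LinearMap.congr_fun
    (f := (assocR _ _ _).comp ((rTr C (cohomCoactL adj)).comp (cohomCoactR adj)))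
    (g := (lTr _ (cohomCoactRBi adj)).comp (cohomCoactL adj)) (cohom_ext fun d => by
      have key (w : Tens B D D) :
          rT N (assocR D (Cohom adj) C) ((assoc (Tens B D (Cohom adj)) C N).symm
            (lT _ N.coactL.left ((assoc D (Cohom adj) N).symm (lT D (coevBi adj).left w)))) =
          rT N (lTr _ (cohomCoactRBi adj)) ((assoc D (Cohom adj) N).symm
            (lT D (coevBi adj).left w)) := by
        induction w using tens_induction with
        | zero => simp
        | add x y hx hy => simp only [map_add, hx, hy]
        | tm d₁ d₂ =>
          have h₁ (u : Tens A (Cohom adj) N) :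
              rT N (assocR D (Cohom adj) C) ((assoc (Tens B D (Cohom adj)) C N).symm
                (lT _ N.coactL.left (rT N (ins _ d₁) u))) =
              rT N (ins _ d₁) ((assoc (Cohom adj) C N).symm (lT _ N.coactL.left u)) := by
            induction u using tens_induction with
            | zero => simp
            | add x y hx hy => simp only [map_add, hx, hy]
            | tm z n =>
              rw [rT_tm, lT_tm, lT_tm, assoc_symm_tm_eq, assoc_symm_tm_eq, ← rT_comp, ← rT_comp]
              rfl
          rw [lT_tm, assoc_symm_tm_eq, h₁, BimodHom.left_apply, coevBi_apply, ← rT_cohomCoactR,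
            ← rT_comp, ← rT_comp]
          rfl
      rw [rT_comp, rT_comp, rT_comp, rT_cohomCoactR, ← assoc_symm_rT, rT_lT, rT_cohomCoactL, key]) z

/-- The `D`-`C`-bicomodule `h_D(N, D)`, for a left adjoint `h` of `- ⊗_A N : M_A → M^D`. -/
def cohomBicomodule (adj : h ⊣ N.tensorFunctor) : Bicomodule D C where
  carrier := Cohom adj
  coact := cohomCoactR adj
  coact_coassoc := cohom_coact_coassoc adj
  coact_counit := cohom_coact_counit adj
  coact_smul := (cohomCoactRBi adj).map_smul'
  coactL := cohomCoactLBi adj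
  coactL_coassoc := cohom_coactL_coassoc adj
  coactL_counit := cohom_coactL_counit adj
  coact_comm := cohom_coact_comm adj

end Bicomod

end Cohom

/-! ### Quasi-finiteness, injectors, Frobenius functors -/

namespace Bicomodule

variable {A B : Type u} [Ring A] [Ring B] {C : Coring A} {D : Coring B}

/-- `N` is quasi-finite as a right `D`-comodule: `- ⊗_A N : M_A → M^D` has a left adjoint. -/
abbrev IsQuasiFinite (N : Bicomodule C D) : Prop := N.tensorFunctor.IsRightAdjoint

/-- `N` is an injector as a right `D`-comodule: `- ⊗_A N : M_A → M^D` preserves injective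
objects. -/
abbrev IsInjector (N : Bicomodule C D) : Prop := N.tensorFunctor.PreservesInjectiveObjects

/-- The `D`-`C`-bicomodule `h_D(N, D)`, where `h_D(N, -)` is the left adjoint of
`- ⊗_A N : M_A → M^D`. -/
def cohom (N : Bicomodule C D) [N.IsQuasiFinite] : Bicomodule D C :=
  cohomBicomodule (Adjunction.ofIsRightAdjoint N.tensorFunctor)

end Bicomodule

/-- A functor is Frobenius if it has a right adjoint that is also a left adjoint of it. -/
def IsFrobeniusFunctor {X Y : Type*} [Category X] [Category Y] (F : X ⥤ Y) : Prop :=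
  ∃ G : Y ⥤ X, Nonempty (F ⊣ G) ∧ Nonempty (G ⊣ F)

end

end Corings

namespace Corings

noncomputable section

/-! ### Exactness of tensor products -/

section Exact

variable {A : Type*} [Ring A] {M M' : Type*} [AddCommGroup M] [Module Aᵐᵒᵖ M]
  [AddCommGroup M'] [Module Aᵐᵒᵖ M'] {N : Type*} [AddCommGroup N] [Module A N]

/-! Write `N` for the bicomodule `C ⊗_A B` and `F` for the induction functor. Since `- ⊗_A C` is
right adjoint to the forgetful functor `M^C → M_A`, and `F` composed with it is `- ⊗_A N`
(`tensRightIso`), left adjoints of `F` and of `- ⊗_A N` are two forms of the same thing. A left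
adjoint `h` of `- ⊗_A N` takes values in `C`-comodules, because the left coaction of `N` transposes
to a right coaction on `h(Y)` (`cohomFunctor`). The lifted functor is left adjoint to `F`
(`cohomAdj`). This part is formal: `M → M ⊗_A C` is split by the counit over `A`, so tensoring it
keeps it injective.

The question is thus when the lifted `h` is also right adjoint to `F`. The expected right adjoint is
coinduction, which sends `Y` to the cotensor product of `Y` with `B ⊗_A C` over `D`, that is, to the
`t` in `Y ⊗_B (B ⊗_A C)` on which the two maps into `Y ⊗_B D ⊗_B (B ⊗_A C)` agree.

From (b) to (a): each `Y` is the equalizer of `Y ⊗_B D ⇉ Y ⊗_B D ⊗_B D`. If `h` preserves these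
equalizers (`PreservesCanonical`), the isomorphism `X ⊗_B h(D) ≅ h(X ⊗_B D)` identifies `h(Y)` with
the cotensor product of `Y` and `h(D)` (`toTensCohom`), and `h(D) ≅ B ⊗_A C` turns it into
coinduction (`inductionAdj`). The equalizers are preserved for either of two reasons: an injector
forces enough exactness on `h` (`map_exact_of_preservesInjectiveObjects`), or coseparability of `D`
splits them, so that every functor preserves them (`preservesCanonical_of_isCoseparable`).

From (a) to (b): if `G` is both left and right adjoint to `F`, then `G` followed by the forgetful
functor is left adjoint to `- ⊗_A N`. It preserves monomorphisms, as `G` is a right adjoint and `C`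
is flat, so `- ⊗_A N` preserves injectives. Uniqueness of left adjoints makes the lifted `h` a right
adjoint of `F`. Then `h(D)` and `B ⊗_A C` represent the same functor, since comodule maps `M ⊗_A B →
D` amount to `A`-linear maps `M → B`, and these to comodule maps `M → B ⊗_A C`. The isomorphism is
made explicit to see that it respects all the bicomodule structure (`cohomIso`). -/

theorem rT_sub (f f' : M →ₗ[Aᵐᵒᵖ] M') (x : Tens A M N) :
    rT N (f - f') x = rT N f x - rT N f' x :=
  tens_ext (rT N (f - f')) (rT N f - rT N f') (fun m n => by
    simpa using (tmL (B := A) n).map_sub (f m) (f' m)) x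

theorem rT_zero (x : Tens A M N) : rT N (0 : M →ₗ[Aᵐᵒᵖ] M') x = 0 :=
  tens_ext (rT N (0 : M →ₗ[Aᵐᵒᵖ] M')) 0 (fun _ n => zero_tm n) x

/-- Right exactness of `- ⊗_A N`: modulo the image of `ker p ⊗ N`, a tensor `m ⊗ n` depends only on
`p m`, so `p ⊗ N` becomes invertible on that quotient. -/
theorem rT_exact {p : M →ₗ[Aᵐᵒᵖ] M'} (hp : Function.Surjective p) {x : Tens A M N}
    (hx : rT N p x = 0) : ∃ y, rT N (LinearMap.ker p).subtype y = x := by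
  let R : AddSubgroup (Tens A M N) := (rT N (LinearMap.ker p).subtype).range
  have key {m m' : M} (h : p m = p m') (n : N) :
      (QuotientAddGroup.mk' R) (tm A m n) = QuotientAddGroup.mk' R (tm A m' n) := by
    rw [← sub_eq_zero, ← map_sub]
    refine (QuotientAddGroup.eq_zero_iff _).2 ⟨tm A ⟨m - m', ?_⟩ n, ?_⟩
    · rw [LinearMap.mem_ker, map_sub, h, sub_self]
    · exact (tmL (B := A) n).map_sub m m'
  have hs := Function.surjInv_eq hp
  -- `surjInv` is only a set-theoretic section, but by `key` the choice of preimage disappears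
  -- modulo `R`, so the formula is additive and balanced.
  let back : Tens A M' N →+ Tens A M N ⧸ R :=
    lift (fun m n => QuotientAddGroup.mk' R (tm A (Function.surjInv hp m) n))
      (fun m m' n => by
        rw [← map_add, ← add_tm]
        exact key (by rw [map_add, hs, hs, hs]) n)
      (fun m n n' => by rw [tm_add, map_add])
      (fun m a n => by
        rw [← smul_tm]
        exact key (by rw [map_smul, hs, hs]) n)
  have h := tens_ext (back.comp (rT N p)) (QuotientAddGroup.mk' R)
    (fun m n => key (by rw [hs]) n) x
  rw [AddMonoidHom.comp_apply, hx, map_zero] at h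
  exact (QuotientAddGroup.eq_zero_iff x).1 h.symm

end Exact

/-! ### Right comodules -/

namespace RightComod

variable {A : Type u} [Ring A] {C : Coring A}

/-- The forgetful functor `M^C → M_A`. -/
def forget (C : Coring A) : RightComod C ⥤ ModuleCat.{u} Aᵐᵒᵖ where
  obj M := ModuleCat.of _ M
  map f := ModuleCat.ofHom f.lin

/-- The coaction as a comodule map. -/
def coactHom (M : RightComod C) : M ⟶ C.regular.tensObj M where
  lin := M.coact
  comm m := ((assoc _ _ _).symm_apply_eq.2 (M.coact_coassoc m).symm).symm

/-- The linear map `X ⊗_A C → X` given by the counit. -/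
def tensCounit (C : Coring A) (X : Type*) [AddCommGroup X] [Module Aᵐᵒᵖ X] :
    Tens A X C →ₗ[Aᵐᵒᵖ] X :=
  (ridR X).comp (lTr X C.counit)

theorem tensCounit_coact (M : RightComod C) (m : M) : tensCounit C M (M.coact m) = m :=
  M.coact_counit m

theorem tensCounit_rT {X Y : Type*} [AddCommGroup X] [Module Aᵐᵒᵖ X] [AddCommGroup Y]
    [Module Aᵐᵒᵖ Y] (f : X →ₗ[Aᵐᵒᵖ] Y) (x : Tens A X C) :
    tensCounit C Y (rT C f x) = f (tensCounit C X x) := by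
  change rid Y (lT Y C.counit.left (rT C f x)) = _
  rw [← rT_lT, rid_rT]
  rfl

theorem rT_tensCounit {X : Type*} [AddCommGroup X] [Module Aᵐᵒᵖ X] (x : Tens A X C) :
    rT C (tensCounit C X) (C.regular.tensCoact X x) = x := by
  induction x using tens_induction with
  | zero => simp
  | add x y hx hy => simp only [map_add, hx, hy]
  | tm x c =>
    have h (u : Tens A C C) : rT C ((tensCounit C X).comp (ins C x)) u =
        tm A x (lid C (rT C C.counit.right u)) := by
      induction u using tens_induction with
      | zero => simp
      | add x y hx hy => simp only [map_add, hx, hy, tm_add]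
      | tm c c' => exact smul_tm (C.counit c) x c'
    rw [ModComod.tensCoact_tm, assoc_symm_tm_eq, ← rT_comp, h]
    exact congrArg _ (C.counit_left c)

theorem coact_injective (M : RightComod C) : Function.Injective M.coact := fun x y h => by
  rw [← tensCounit_coact M x, h, tensCounit_coact]

/-- The counit splits the coaction as a right `A`-linear map, so `ρ_M ⊗ N` stays injective for every
`N`. This spares a flatness hypothesis in the construction of the left adjoint. -/
theorem rT_tensCounit_coact (M : RightComod C) {N : Type*} [AddCommGroup N] [Module A N]
    (x : Tens A M N) : rT N (tensCounit C M) (rT N M.coact x) = x := by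
  have : (tensCounit C M).comp M.coact = LinearMap.id := LinearMap.ext M.coact_counit
  rw [← rT_comp, this, rT_id]

/-- The forgetful functor is left adjoint to `- ⊗_A C`. -/
def forgetAdj (C : Coring A) : forget C ⊣ C.regular.tensorFunctor :=
  Adjunction.mkOfUnitCounit
    { unit :=
        { app := coactHom
          naturality := fun M N f => hom_ext _ _ fun m => (f.comm m).symm }
      counit :=
        { app := fun X => ModuleCat.ofHom (tensCounit C X)
          naturality := fun X Y f => by
            ext x
            exact tensCounit_rT f.hom x }
      left_triangle := by
        ext M m
        exact M.coact_counit m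
      right_triangle := by
        ext X x
        exact rT_tensCounit x }

theorem mono_of_injective {M N : RightComod C} (f : M ⟶ N) (hf : Function.Injective f.lin) :
    Mono f where
  right_cancellation _ _ h := hom_ext _ _ fun m =>
    hf (LinearMap.congr_fun (congrArg Hom.lin h) m)

/-- The comodule structure on a submodule that is stable under the coaction. -/
def ofInjective (hC : C.IsLeftFlat) (M : RightComod C) {X : Type u} [AddCommGroup X]
    [Module Aᵐᵒᵖ X] (i : X →ₗ[Aᵐᵒᵖ] M) (hi : Function.Injective i) (c : X →ₗ[Aᵐᵒᵖ] Tens A X C)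
    (h : ∀ x, rT C i (c x) = M.coact (i x)) : RightComod C where
  carrier := X
  coact := c
  coact_coassoc x := by
    -- Flatness is used twice, once for each factor `C`. Coassociativity on `X` can then be checked
    -- inside `M`.
    have hinj : Function.Injective (rT (Tens A C C) i) := fun a b hab => by
      apply (assoc X C C).symm.injective
      refine hC _ _ (rTr C i) (hC _ _ i hi) ?_
      rw [← assoc_symm_rT, hab, assoc_symm_rT]
    have hc : (rTr C i).comp c = M.coact.comp i := LinearMap.ext h
    apply hinj
    rw [← assoc_rT_rT, ← rT_comp, hc, rT_comp, h, M.coact_coassoc, rT_lT, h]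
  coact_counit x := by
    apply hi
    rw [← rid_rT, rT_lT, h, M.coact_counit]

/-- Flatness makes the linear kernel of `f` a subcomodule. Its inclusion and the zero map have the
same composite with `f`, so they agree and the kernel vanishes. -/
theorem injective_of_mono (hC : C.IsLeftFlat) {M N : RightComod C} (f : M ⟶ N) [Mono f] :
    Function.Injective f.lin := by
  let K := LinearMap.ker f.lin
  have hi : Function.Injective (rTr (B := A) C K.subtype) :=
    hC _ _ K.subtype K.subtype_injective
  have hmem (k : K) : M.coact k ∈ LinearMap.range (rTr (B := A) C K.subtype) := by
    have h₁ : rT C f.lin (M.coact k) = 0 := by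
      rw [f.comm, LinearMap.mem_ker.1 k.2, map_zero]
    -- `rT_exact` needs a surjection, so `f` is replaced by its corestriction to the range. Flatness
    -- keeps `range ⊗ C → N ⊗ C` injective, so the vanishing persists.
    have h₂ : rT C f.lin.rangeRestrict (M.coact k) = 0 := by
      refine hC _ _ (LinearMap.range f.lin).subtype (Submodule.subtype_injective _) ?_
      rw [← rT_comp, map_zero]
      exact h₁
    obtain ⟨y, hy⟩ := rT_exact f.lin.surjective_rangeRestrict h₂
    have hk : LinearMap.ker f.lin.rangeRestrict ≤ K := by
      rw [LinearMap.ker_rangeRestrict]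
    refine ⟨rT C (Submodule.inclusion hk) y, ?_⟩
    rw [rTr_apply, ← rT_comp]
    exact hy
  let c : K →ₗ[Aᵐᵒᵖ] Tens A K C :=
    (LinearEquiv.ofInjective _ hi).symm.toLinearMap.comp
      ((M.coact.comp K.subtype).codRestrict _ hmem)
  have hc (k : K) : rT C K.subtype (c k) = M.coact k :=
    congrArg Subtype.val ((LinearEquiv.ofInjective _ hi).apply_symm_apply ⟨M.coact k, hmem k⟩)
  let P := ofInjective hC M K.subtype K.subtype_injective c hc
  let i : P ⟶ M := ⟨K.subtype, hc⟩
  let o : P ⟶ M := ⟨0, fun x => by rw [rT_zero, LinearMap.zero_apply, map_zero]⟩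
  have hio : i ≫ f = o ≫ f := hom_ext _ _ fun k => by
    change f.lin k.1 = f.lin 0
    rw [map_zero]
    exact k.2
  refine (injective_iff_map_eq_zero _).2 fun m hm => ?_
  exact LinearMap.congr_fun (congrArg Hom.lin ((cancel_mono f).1 hio)) (⟨m, hm⟩ : K)

theorem forget_preservesMonomorphisms (hC : C.IsLeftFlat) :
    (forget C).PreservesMonomorphisms where
  preserves f _ := (ModuleCat.mono_iff_injective _).2 (injective_of_mono hC f)

/-- The coaction of the cokernel of a comodule map. -/
def cokerCoact {M N : RightComod C} (f : M ⟶ N) :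
    (N ⧸ LinearMap.range f.lin) →ₗ[Aᵐᵒᵖ] Tens A (N ⧸ LinearMap.range f.lin) C :=
  (LinearMap.range f.lin).liftQ ((rTr C (LinearMap.range f.lin).mkQ).comp N.coact) (by
    intro x hx
    obtain ⟨m, rfl⟩ := LinearMap.mem_range.1 hx
    have : (LinearMap.range f.lin).mkQ.comp f.lin = 0 := LinearMap.range_mkQ_comp f.lin
    rw [LinearMap.mem_ker, LinearMap.comp_apply, ← f.comm, rTr_apply, ← rT_comp, this, rT_zero])

theorem cokerCoact_mk {M N : RightComod C} (f : M ⟶ N) (x : N) :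
    cokerCoact f ((LinearMap.range f.lin).mkQ x) =
      rT C (LinearMap.range f.lin).mkQ (N.coact x) := rfl

/-- The cokernel of a comodule map. -/
def coker {M N : RightComod C} (f : M ⟶ N) : RightComod C where
  carrier := N ⧸ LinearMap.range f.lin
  coact := cokerCoact f
  coact_coassoc x := by
    obtain ⟨x, rfl⟩ := (LinearMap.range f.lin).mkQ_surjective x
    have : (cokerCoact f).comp (LinearMap.range f.lin).mkQ =
      (rTr C (LinearMap.range f.lin).mkQ).comp N.coact := LinearMap.ext (cokerCoact_mk f)
    rw [cokerCoact_mk, ← rT_comp, this, rT_comp, assoc_rT_rT, N.coact_coassoc, rT_lT]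
  coact_counit x := by
    obtain ⟨x, rfl⟩ := (LinearMap.range f.lin).mkQ_surjective x
    rw [cokerCoact_mk, ← rT_lT, rid_rT, N.coact_counit]

/-- The linear map out of a cokernel. -/
def cokerDescLin {M N P : RightComod C} (f : M ⟶ N) (g : N ⟶ P)
    (h : ∀ m, g.lin (f.lin m) = 0) : (N ⧸ LinearMap.range f.lin) →ₗ[Aᵐᵒᵖ] P :=
  (LinearMap.range f.lin).liftQ g.lin (by
    intro x hx
    obtain ⟨m, rfl⟩ := LinearMap.mem_range.1 hx
    exact h m)

theorem cokerDescLin_mk {M N P : RightComod C} (f : M ⟶ N) (g : N ⟶ P)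
    (h : ∀ m, g.lin (f.lin m) = 0) (x : N) :
    cokerDescLin f g h ((LinearMap.range f.lin).mkQ x) = g.lin x := rfl

/-- Comodule maps out of a cokernel. -/
def cokerDesc {M N P : RightComod C} (f : M ⟶ N) (g : N ⟶ P) (h : ∀ m, g.lin (f.lin m) = 0) :
    coker f ⟶ P where
  lin := cokerDescLin f g h
  comm x := by
    obtain ⟨x, rfl⟩ := (LinearMap.range f.lin).mkQ_surjective x
    have : (cokerDescLin f g h).comp (LinearMap.range f.lin).mkQ = g.lin :=
      LinearMap.ext (cokerDescLin_mk f g h)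
    change rT C (cokerDescLin f g h) (cokerCoact f ((LinearMap.range f.lin).mkQ x)) =
      P.coact (cokerDescLin f g h ((LinearMap.range f.lin).mkQ x))
    rw [cokerDescLin_mk, ← g.comm, ← this, rT_comp, cokerCoact_mk]

/-- The difference of two comodule maps. -/
def subHom {M N : RightComod C} (f g : M ⟶ N) : M ⟶ N where
  lin := f.lin - g.lin
  comm m := by
    rw [rT_sub, f.comm, g.comm, LinearMap.sub_apply, map_sub]

end RightComod

/-! ### The co-hom functor with values in comodules -/

section CohomFunctor

variable {A B : Type u} [Ring A] [Ring B] {C : Coring A} {D : Coring B} {N : Bicomodule C D}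
  {h : RightComod D ⥤ ModuleCat.{u} Aᵐᵒᵖ} (adj : h ⊣ N.tensorFunctor)

/-- The right coaction of `C` on `h(Y)`. -/
def liftCoact (Y : RightComod D) : h.obj Y →ₗ[Aᵐᵒᵖ] Tens A (h.obj Y) C :=
  desc adj (adj.unit.app Y ≫ N.tensCoactLHom (h.obj Y))

/-- This property characterises the coaction. Linear maps out of `h(Y)` are compared through
`adj_ext`, after tensoring with `N` and composing with the unit, so the comodule axioms reduce to
those of the left coaction of `N`. -/
theorem rT_liftCoact (Y : RightComod D) (y : Y) :
    rT N (liftCoact adj Y) (unitLin adj Y y) =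
      (assoc (h.obj Y) C N).symm (lT _ N.coactL.left (unitLin adj Y y)) :=
  rT_desc adj (adj.unit.app Y ≫ N.tensCoactLHom (h.obj Y)) y

theorem tensCoactL_coassoc (X : Type u) [AddCommGroup X] [Module Aᵐᵒᵖ X] (u : Tens A X N) :
    rT N (assocR X C C) ((assoc (Tens A X C) C N).symm
      (lT _ N.coactL.left ((assoc X C N).symm (lT _ N.coactL.left u)))) =
    rT N (lTr _ C.comul) ((assoc X C N).symm (lT _ N.coactL.left u)) := by
  induction u using tens_induction with
  | zero => simp
  | add x y hx hy => simp only [map_add, hx, hy]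
  | tm x n =>
    -- The value of a coaction is not a pure tensor. It is replaced by an arbitrary `w`, for which
    -- induction on tensors applies, and the coassociativity of `N` enters only at the end. The same
    -- device recurs in most of the later computations.
    have h₁ (w : Tens A C N) :
        rT N (assocR X C C) ((assoc (Tens A X C) C N).symm
          (lT _ N.coactL.left ((assoc X C N).symm (tm A x w)))) =
        rT N (ins _ x) ((assoc C C N).symm (lT C N.coactL.left w)) := by
      induction w using tens_induction with
      | zero => simp
      | add x y hx hy => simp only [map_add, tm_add, hx, hy]
      | tm c n =>
        rw [assoc_symm_tm, lT_tm, lT_tm, assoc_symm_tm_eq, assoc_symm_tm_eq, ← rT_comp,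
          ← rT_comp]
        rfl
    have h₂ (w : Tens A C N) : rT N (lTr _ C.comul) ((assoc X C N).symm
        (tm A x w)) = rT N (ins _ x) (rT N C.comul.right w) := by
      rw [assoc_symm_tm_eq, ← rT_comp, ← rT_comp]
      rfl
    rw [lT_tm, h₁, h₂]
    exact congrArg _ ((assoc C C N).symm_apply_eq.2 (N.coactL_coassoc n).symm)

theorem tensCoactL_counit (X : Type u) [AddCommGroup X] [Module Aᵐᵒᵖ X] (u : Tens A X N) :
    rT N (RightComod.tensCounit C X) ((assoc X C N).symm (lT _ N.coactL.left u)) = u := by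
  induction u using tens_induction with
  | zero => simp
  | add x y hx hy => simp only [map_add, hx, hy]
  | tm x n =>
    have h₁ (w : Tens A C N) : rT N (RightComod.tensCounit C X) ((assoc X C N).symm (tm A x w)) =
        tm A x (lid N (rT N C.counit.right w)) := by
      induction w using tens_induction with
      | zero => simp
      | add x y hx hy => simp only [map_add, tm_add, hx, hy]
      | tm c n => exact smul_tm (C.counit c) x n
    rw [lT_tm, h₁]
    exact congrArg _ (N.coactL_counit n)

/-- The right `C`-comodule `h(Y)`. -/
def cohomObj (Y : RightComod D) : RightComod C where
  carrier := h.obj Y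
  coact := liftCoact adj Y
  coact_coassoc := LinearMap.congr_fun
    (f := (assocR _ _ _).comp ((rTr C (liftCoact adj Y)).comp (liftCoact adj Y)))
    (g := (lTr _ C.comul).comp (liftCoact adj Y)) (adj_ext adj fun y => by
      rw [rT_comp, rT_comp, rT_comp, rT_liftCoact, ← assoc_symm_rT, rT_lT, rT_liftCoact,
        tensCoactL_coassoc])
  coact_counit := LinearMap.congr_fun
    (f := (RightComod.tensCounit C _).comp (liftCoact adj Y))
    (g := LinearMap.id) (adj_ext adj fun y => by
      rw [rT_comp, rT_liftCoact, tensCoactL_counit, rT_id])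

/-- The functor `h : M^D → M_A` lifted to `M^C`. -/
def cohomFunctor : RightComod D ⥤ RightComod C where
  obj := cohomObj adj
  map {Y Y'} g :=
    { lin := (h.map g).hom
      comm := LinearMap.congr_fun (f := (rTr C (h.map g).hom).comp (liftCoact adj Y))
        (g := (liftCoact adj Y').comp (h.map g).hom) (adj_ext adj fun y => by
          rw [rT_comp, rT_comp, rT_liftCoact, unitLin_naturality, rT_liftCoact, ← assoc_symm_rT,
            rT_lT, unitLin_naturality]) }
  map_id Y := RightComod.hom_ext _ _ fun z => by
    change (h.map (𝟙 Y)).hom z = z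
    rw [h.map_id]
    rfl
  map_comp g g' := RightComod.hom_ext _ _ fun z => by
    change (h.map (g ≫ g')).hom z = (h.map g').hom ((h.map g).hom z)
    rw [h.map_comp]
    rfl

end CohomFunctor

/-! ### The induction functor -/

namespace CoringHom

variable {A B : Type u} [Ring A] [Ring B] {C : Coring A} {D : Coring B} {r : A →+* B}
  (f : CoringHom C D r)

/-- Reassociation is colinear because both coactions leave `X` alone: each sends `x ⊗ c ⊗ b` to `x ⊗
c₁ ⊗ 1 ⊗ φ(c₂) b`. -/
theorem indCoact_tensCoact (X : Type u) [AddCommGroup X] [Module Aᵐᵒᵖ X]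
    (s : Tens A (Tens A X C) (Along r)) :
    rT D (assocR (E := B) X C (Along r)) (f.indCoact (C.regular.tensObj X) s) =
      f.tensRight.tensCoact X (assoc X C (Along r) s) := by
  refine tens_ext₃ ((rT D (assocR (E := B) X C (Along r))).comp
    (f.indCoact (C.regular.tensObj X)).toAddMonoidHom)
    ((f.tensRight.tensCoact X).toAddMonoidHom.comp (assoc X C (Along r)).toAddMonoidHom)
    (fun x c b => ?_) s
  have key (u : Tens A C C) : rT D (assocR (E := B) X C (Along r))
      (op b.val • f.indAux (Tens A X C) ((assoc X C C).symm (tm A x u))) =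
      (assoc X (Tens A C (Along r)) D).symm (tm A x (op b.val • f.indAux C u)) := by
    induction u using tens_induction with
    | zero => simp
    | add x y hx hy => simp only [map_add, smul_add, tm_add, hx, hy]
    | tm c c' => rfl
  exact key (C.comul c)

/-- The isomorphism `(X ⊗_A C) ⊗_A B ≅ X ⊗_A (C ⊗_A B)` of right `D`-comodules. -/
def inductionTensHom (X : Type u) [AddCommGroup X] [Module Aᵐᵒᵖ X] :
    f.induction.obj (C.regular.tensObj X) ⟶ f.tensRight.tensObj X where
  lin := assocR (E := B) X C (Along r)
  comm := f.indCoact_tensCoact X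

/-- The inverse of `inductionTensHom`. -/
def inductionTensInv (X : Type u) [AddCommGroup X] [Module Aᵐᵒᵖ X] :
    f.tensRight.tensObj X ⟶ f.induction.obj (C.regular.tensObj X) where
  lin :=
    { toFun := (assoc X C (Along r)).symm
      map_add' := map_add _
      map_smul' := assoc_symm_op_smul }
  comm x := by
    obtain ⟨s, rfl⟩ := (assoc X C (Along r)).surjective x
    refine Eq.trans (congrArg _ (f.indCoact_tensCoact X s).symm) ?_
    refine (rT_comp _ _ _).symm.trans ?_
    refine Eq.trans ?_ (congrArg (f.indCoact (C.regular.tensObj X))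
      ((assoc X C (Along r)).symm_apply_apply s).symm)
    refine Eq.trans ?_ (rT_id _)
    congr 2
    exact LinearMap.ext fun t => (assoc X C (Along r)).symm_apply_apply t

/-- `- ⊗_A (C ⊗_A B)` is the cofree comodule functor followed by induction. -/
def tensRightIso :
    C.regular.tensorFunctor ⋙ f.induction ≅ f.tensRight.tensorFunctor :=
  NatIso.ofComponents
    (fun X =>
      { hom := f.inductionTensHom X
        inv := f.inductionTensInv X
        hom_inv_id := RightComod.hom_ext _ _ fun x => (assoc X C (Along r)).symm_apply_apply x
        inv_hom_id := RightComod.hom_ext _ _ fun x => (assoc X C (Along r)).apply_symm_apply x })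
    (fun g => RightComod.hom_ext _ _ fun x => assoc_rT_rT g.hom x)

/-- The counit `X ⊗_A (C ⊗_A B) → X ⊗_A B`. -/
def tensRightCounit (C : Coring A) (r : A →+* B) (X : Type*) [AddCommGroup X] [Module Aᵐᵒᵖ X] :
    Tens A X (Tens A C (Along r)) →ₗ[Bᵐᵒᵖ] Tens A X (Along r) where
  toFun x := rT (Along r) (RightComod.tensCounit C X) ((assoc X C (Along r)).symm x)
  map_add' x y := by rw [map_add, map_add]
  map_smul' s x := by rw [assoc_symm_op_smul, rT_op_smul, RingHom.id_apply]

theorem tensRightCounit_rT {X Y : Type*} [AddCommGroup X] [Module Aᵐᵒᵖ X] [AddCommGroup Y]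
    [Module Aᵐᵒᵖ Y] (g : X →ₗ[Aᵐᵒᵖ] Y) (x : Tens A X (Tens A C (Along r))) :
    tensRightCounit C r Y (rT _ g x) = rT (Along r) g (tensRightCounit C r X x) := by
  change rT (Along r) (RightComod.tensCounit C Y) ((assoc Y C (Along r)).symm (rT _ g x)) =
    rT (Along r) g (rT (Along r) (RightComod.tensCounit C X) ((assoc X C (Along r)).symm x))
  rw [assoc_symm_rT, ← rT_comp, ← rT_comp]
  congr 1
  exact congrArg _ (LinearMap.ext (RightComod.tensCounit_rT g))

theorem tensRightCounit_assoc {X : Type*} [AddCommGroup X] [Module Aᵐᵒᵖ X]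
    (x : Tens A (Tens A X C) (Along r)) :
    tensRightCounit C r X (assoc X C (Along r) x) = rT _ (RightComod.tensCounit C X) x := by
  change rT (Along r) (RightComod.tensCounit C X) ((assoc X C (Along r)).symm _) = _
  rw [AddEquiv.symm_apply_apply]

/-- The counit applied to the second factor `C` of `(X ⊗ C) ⊗ (C ⊗ B)` cancels `Δ ⊗ B`. -/
theorem tensRightCounit_coactL {X : Type u} [AddCommGroup X] [Module Aᵐᵒᵖ X]
    (x : Tens A X (Tens A C (Along r))) :
    tensRightCounit C r (Tens A X C)
      ((assoc X C (Tens A C (Along r))).symm (lT X (coactCB C r).left x)) =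
        (assoc X C (Along r)).symm x := by
  obtain ⟨y, rfl⟩ := (assoc X C (Along r)).surjective x
  rw [AddEquiv.symm_apply_apply]
  refine tens_ext₃ ((tensRightCounit C r (Tens A X C)).toAddMonoidHom.comp
    ((assoc X C (Tens A C (Along r))).symm.toAddMonoidHom.comp
      ((lT X (coactCB C r).left).comp (assoc X C (Along r)).toAddMonoidHom)))
    (AddMonoidHom.id _) (fun x c b => ?_) y
  have key (u : Tens A C C) : tensRightCounit C r (Tens A X C)
      ((assoc X C (Tens A C (Along r))).symm (tm A x (assoc C C (Along r) (tm A u b)))) =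
      tm A (tm A x (rid C (lT C C.counit.left u))) b := by
    induction u using tens_induction with
    | zero => simp
    | add x y hx hy => simp only [map_add, tm_add, add_tm, hx, hy]
    | tm c c' => rfl
  refine (key (C.comul c)).trans ?_
  rw [C.counit_right]
  rfl

end CoringHom

/-! ### The left adjoint of the induction functor -/

namespace CoringHom

variable {A B : Type u} [Ring A] [Ring B] {C : Coring A} {D : Coring B} {r : A →+* B}
  (f : CoringHom C D r) {h : RightComod D ⥤ ModuleCat.{u} Aᵐᵒᵖ}
  (adj : h ⊣ f.tensRight.tensorFunctor)

/-- The map `Y → h(Y) ⊗_A B` obtained from the unit. -/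
def indUnitLin (Y : RightComod D) : Y →ₗ[Bᵐᵒᵖ] Tens A (h.obj Y) (Along r) :=
  (tensRightCounit C r (h.obj Y)).comp (unitLin adj Y)

theorem rT_indUnitLin {Y : RightComod D} {Z : Type u} [AddCommGroup Z] [Module Aᵐᵒᵖ Z]
    (g : h.obj Y →ₗ[Aᵐᵒᵖ] Z) (y : Y) :
    rT (Along r) g (f.indUnitLin adj Y y) =
      tensRightCounit C r Z (rT f.tensRight g (unitLin adj Y y)) :=
  (tensRightCounit_rT g (unitLin adj Y y)).symm

/-- The coaction of `h(Y)` recovers the original unit `Y → h(Y) ⊗ C ⊗ B` from its image under the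
counit, so the two units determine each other. -/
theorem rT_liftCoact_indUnitLin (Y : RightComod D) (y : Y) :
    rT (Along r) (liftCoact adj Y) (f.indUnitLin adj Y y) =
      (assoc _ C (Along r)).symm (unitLin adj Y y) := by
  rw [rT_indUnitLin, rT_liftCoact]
  exact tensRightCounit_coactL (unitLin adj Y y)

/-- The unit `Y → h(Y) ⊗_A B` as a comodule map. -/
def indUnit (Y : RightComod D) : Y ⟶ f.induction.obj ((cohomFunctor adj).obj Y) where
  lin := f.indUnitLin adj Y
  comm y := by
    let P := (cohomFunctor adj).obj Y
    -- Colinearity is tested after the split injection `ρ ⊗ B ⊗ D`. There the map becomes the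
    -- original unit followed by reassociation, which is a comodule map.
    have hinj : Function.Injective (rT D (rTr (B := B) (Along r) P.coact)) :=
      Function.LeftInverse.injective
        (g := rT D (rTr (B := B) (Along r) (RightComod.tensCounit C P))) fun x => by
        refine (rT_comp _ _ x).symm.trans (Eq.trans ?_ (rT_id x))
        exact congrArg (fun l => rT D l x)
          (LinearMap.ext fun t => P.rT_tensCounit_coact (N := Along r) t)
    apply hinj
    have h₁ : (rTr (B := B) (Along r) P.coact).comp (f.indUnitLin adj Y) =
        (adj.unit.app Y ≫ f.inductionTensInv (h.obj Y)).lin :=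
      LinearMap.ext fun y => f.rT_liftCoact_indUnitLin adj Y y
    refine (rT_comp (N := D) (f.indUnitLin adj Y) _ (Y.coact y)).symm.trans ?_
    refine (congrArg (fun l => rT D l (Y.coact y)) h₁).trans ?_
    refine ((adj.unit.app Y ≫ f.inductionTensInv (h.obj Y)).comm y).trans ?_
    refine Eq.trans ?_ ((f.induction.map P.coactHom).comm (f.indUnitLin adj Y y)).symm
    exact congrArg (f.indCoact (C.regular.tensObj (h.obj Y))) (LinearMap.congr_fun h₁ y).symm

/-- The comodule map `Y → M ⊗_A (C ⊗_A B)` induced by `Y → M ⊗_A B`. -/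
def toTensRight {Y : RightComod D} {M : RightComod C} (g : Y ⟶ f.induction.obj M) :
    Y ⟶ f.tensRight.tensObj M :=
  g ≫ f.induction.map M.coactHom ≫ f.inductionTensHom M

theorem toTensRight_lin {Y : RightComod D} {M : RightComod C} (g : Y ⟶ f.induction.obj M) (y : Y) :
    (f.toTensRight g).lin y = assoc M C (Along r) (rT (Along r) M.coact (g.lin y)) := rfl

/-- Coassociativity of `M`, tensored with `B`. It is what makes the transpose of `toTensRight`
colinear over `C`, and not just `A`-linear. -/
theorem tensRight_coact_coassoc (M : RightComod C) (t : Tens A M (Along r)) :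
    (assoc M C (Tens A C (Along r))).symm (lT M (coactCB C r).left
      (assoc M C (Along r) (rT (Along r) M.coact t))) =
    rT (Tens A C (Along r)) M.coact (assoc M C (Along r) (rT (Along r) M.coact t)) := by
  refine tens_ext
    ((assoc M C (Tens A C (Along r))).symm.toAddMonoidHom.comp
      ((lT M (coactCB C r).left).comp ((assoc M C (Along r)).toAddMonoidHom.comp
        (rT (Along r) M.coact))))
    ((rT (Tens A C (Along r)) M.coact).comp ((assoc M C (Along r)).toAddMonoidHom.comp
        (rT (Along r) M.coact))) (fun m b => ?_) t
  have h₁ (u : Tens A M C) : (assoc M C (Tens A C (Along r))).symm (lT M (coactCB C r).left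
      (assoc M C (Along r) (tm A u b))) =
      assoc _ C (Along r) (tm A ((assoc M C C).symm (lT M C.comul.left u)) b) := by
    induction u using tens_induction with
    | zero => simp
    | add x y hx hy => simp only [map_add, add_tm, hx, hy]
    | tm m c =>
      have (w : Tens A C C) : (assoc M C (Tens A C (Along r))).symm
          (tm A m (assoc C C (Along r) (tm A w b))) =
          assoc _ C (Along r) (tm A ((assoc M C C).symm (tm A m w)) b) := by
        induction w using tens_induction with
        | zero => simp
        | add x y hx hy => simp only [map_add, add_tm, tm_add, hx, hy]
        | tm c c' => rfl
      exact this (C.comul c)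
  have h₂ (u : Tens A M C) : rT (Tens A C (Along r)) M.coact (assoc M C (Along r) (tm A u b)) =
      assoc _ C (Along r) (tm A (rT C M.coact u) b) := by
    induction u using tens_induction with
    | zero => simp
    | add x y hx hy => simp only [map_add, add_tm, hx, hy]
    | tm m c => rfl
  refine (h₁ (M.coact m)).trans (Eq.trans ?_ (h₂ (M.coact m)).symm)
  rw [← M.coact_coassoc, AddEquiv.symm_apply_apply]

/-- The comodule map `h(Y) → M` corresponding to `Y → M ⊗_A B`. -/
def indDesc {Y : RightComod D} {M : RightComod C} (g : Y ⟶ f.induction.obj M) :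
    (cohomFunctor adj).obj Y ⟶ M where
  lin := desc adj (f.toTensRight g)
  comm := LinearMap.congr_fun
    (f := (rTr C (desc adj (f.toTensRight g))).comp (liftCoact adj Y))
    (g := M.coact.comp (desc adj (f.toTensRight g))) (adj_ext adj fun y => by
      rw [rT_comp, rT_comp, rT_liftCoact, ← assoc_symm_rT, rT_lT, rT_desc]
      exact tensRight_coact_coassoc M (g.lin y))

/-- Existence half of the adjunction: the counit of `C` undoes the coaction that was inserted in
`toTensRight`. -/
theorem rT_indDesc {Y : RightComod D} {M : RightComod C} (g : Y ⟶ f.induction.obj M) (y : Y) :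
    rT (Along r) (f.indDesc adj g).lin (f.indUnitLin adj Y y) = g.lin y := by
  refine (f.rT_indUnitLin adj _ y).trans ?_
  refine (congrArg _ (rT_desc adj (f.toTensRight g) y)).trans ?_
  rw [toTensRight_lin, tensRightCounit_assoc]
  exact M.rT_tensCounit_coact (N := Along r) _

/-- Uniqueness half: for a colinear `α`, its transpose along the original unit is expressed through
its composite with the new unit `indUnitLin`. -/
theorem rT_unitLin {Y : RightComod D} {M : RightComod C} (α : h.obj Y →ₗ[Aᵐᵒᵖ] M)
    (hα : ∀ z, rT C α (liftCoact adj Y z) = M.coact (α z)) (y : Y) :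
    rT f.tensRight α (unitLin adj Y y) =
      assoc M C (Along r) (rT (Along r) M.coact (rT (Along r) α (f.indUnitLin adj Y y))) := by
  have hα : M.coact.comp α = (rTr C α).comp (liftCoact adj Y) :=
    LinearMap.ext fun z => (hα z).symm
  rw [← rT_comp, hα, rT_comp, rT_liftCoact_indUnitLin]
  refine Eq.trans ?_ (congrArg (assoc M C (Along r))
    (assoc_symm_rT (N := C) (P := Along r) α (unitLin adj Y y)))
  exact ((assoc M C (Along r)).apply_symm_apply _).symm

/-- For a left adjoint `h` of `- ⊗_A (C ⊗_A B)`, the comodule-valued functor `h` is left adjoint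
to the induction functor. -/
def cohomAdj : cohomFunctor adj ⊣ f.induction :=
  have inj {Y : RightComod D} {M : RightComod C} {α β : (cohomFunctor adj).obj Y ⟶ M}
      (hαβ : f.indUnit adj Y ≫ f.induction.map α = f.indUnit adj Y ≫ f.induction.map β) :
      α = β := by
    have key (α : (cohomFunctor adj).obj Y ⟶ M) (y : Y) :=
      f.rT_unitLin adj α.lin (fun z => α.comm z) y
    have hy (y : Y) : rT (Along r) α.lin (f.indUnitLin adj Y y) =
        rT (Along r) β.lin (f.indUnitLin adj Y y) :=
      LinearMap.congr_fun (congrArg RightComod.Hom.lin hαβ) y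
    exact RightComod.Hom.ext (adj_ext adj fun y => (key α y).trans
      ((congrArg (fun t => assoc M C (Along r) (rT (Along r) M.coact t)) (hy y)).trans
        (key β y).symm))
  have right {Y : RightComod D} {M : RightComod C} (g : Y ⟶ f.induction.obj M) :
      f.indUnit adj Y ≫ f.induction.map (f.indDesc adj g) = g :=
    RightComod.hom_ext _ _ fun y => f.rT_indDesc adj g y
  Adjunction.mkOfHomEquiv
    { homEquiv := fun Y M =>
        { toFun := fun α => f.indUnit adj Y ≫ f.induction.map α
          invFun := fun g => f.indDesc adj g
          left_inv := fun α => inj (right _)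
          right_inv := right }
      homEquiv_naturality_left_symm := fun {Y' Y M} g k => inj <| by
        refine (right _).trans ?_
        have hn : f.indUnit adj Y' ≫ f.induction.map ((cohomFunctor adj).map g) =
            g ≫ f.indUnit adj Y := RightComod.hom_ext _ _ fun y =>
          (f.rT_indUnitLin adj (h.map g).hom y).trans
            (congrArg (tensRightCounit C r (h.obj Y)) (unitLin_naturality adj g y))
        rw [Functor.map_comp, ← Category.assoc, hn, Category.assoc]
        exact congrArg (g ≫ ·) (right k).symm
      homEquiv_naturality_right := fun {Y M M'} α k => by
        change f.indUnit adj Y ≫ f.induction.map (α ≫ k) = (f.indUnit adj Y ≫ _) ≫ _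
        rw [Functor.map_comp, Category.assoc] }

end CoringHom

/-! ### Comodule maps into `X ⊗_B (B ⊗_A C)` and out of `M ⊗_A B` -/

section Coind

open CoringHom

variable {A B : Type u} [Ring A] [Ring B] (C : Coring A) (r : A →+* B)
  (X : Type u) [AddCommGroup X] [Module Bᵐᵒᵖ X]

/-- The map `X ⊗_B (B ⊗_A C) → X`, `x ⊗ (b ⊗ c) ↦ x b r(ε(c))`. -/
def coindCounit : Tens B X (Tens A (Along r) C) →+ X :=
  lift (fun x k => op (RightComod.tensCounit C (Along r) k).val • x)
    (fun x x' k => smul_add _ _ _)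
    (fun x k k' => by rw [map_add, Along.val_add, MulOpposite.op_add, add_smul])
    (fun x b k => by
      have : RightComod.tensCounit C (Along r) (b • k) =
          b • RightComod.tensCounit C (Along r) k :=
        map_smul_of_tm (RightComod.tensCounit C (Along r)).toAddMonoidHom b
          (fun b' c => (smul_comm b (op (C.counit c)) b').symm) k
      rw [this, Along.val_smul', op_mul, mul_smul])

variable {C r X}

theorem coindCounit_tm (x : X) (k : Tens A (Along r) C) :
    coindCounit C r X (tm B x k) = op (RightComod.tensCounit C (Along r) k).val • x := rfl

theorem coindCounit_tm_tm (x : X) (b : Along r) (c : C) :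
    coindCounit C r X (tm B x (tm A b c)) = op (b.val * r (C.counit c)) • x := rfl

theorem coindCounit_op_smul (a : A) (t : Tens B X (Tens A (Along r) C)) :
    coindCounit C r X (op a • t) = op (r a) • coindCounit C r X t := by
  induction t using tens_induction with
  | zero => simp
  | add x y hx hy => simp only [map_add, smul_add, hx, hy]
  | tm x k =>
    rw [smul_tm_right, coindCounit_tm, coindCounit_tm, map_smul, Along.val_op_smul', op_mul,
      mul_smul, unop_op]

theorem coindCounit_rT {Y : Type u} [AddCommGroup Y] [Module Bᵐᵒᵖ Y] (g : X →ₗ[Bᵐᵒᵖ] Y)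
    (t : Tens B X (Tens A (Along r) C)) :
    coindCounit C r Y (rT _ g t) = g (coindCounit C r X t) :=
  tens_ext ((coindCounit C r Y).comp (rT _ g)) (g.toAddMonoidHom.comp (coindCounit C r X))
    (fun x _ => (g.map_smul _ x).symm) t

section Ext

variable {M : Type u} [AddCommGroup M] [Module Aᵐᵒᵖ M] (f : M →+ X)
  (hf : ∀ (a : A) m, f (op a • m) = op (r a) • f m)

/-- The map `m ⊗ c ↦ f m ⊗ (1 ⊗ c)`. -/
def coindExt : Tens A M C →ₗ[Aᵐᵒᵖ] Tens B X (Tens A (Along r) C) where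
  __ := mapAlong r f (oneTens C r) hf oneTens_smul
  map_smul' s := map_op_smul_of_tm _ s fun _ _ => rfl

theorem coindExt_tm (m : M) (c : C) :
    coindExt f hf (tm A m c) = tm B (f m) (tm A (Along.one r) c) := rfl

/-- Since `X ⊗_B (B ⊗_A C)` is `X ⊗_A C`, it is the cofree `C`-comodule on `X` restricted to `A`,
with `coindCounit` as its counit. This and `coindExt_coindCounit` play the role of the triangle
identities. -/
theorem coindCounit_coindExt (u : Tens A M C) :
    coindCounit C r X (coindExt f hf u) = f (RightComod.tensCounit C M u) := by
  refine tens_ext ((coindCounit C r X).comp (coindExt f hf).toAddMonoidHom)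
    (f.comp (RightComod.tensCounit C M).toAddMonoidHom) (fun m c => ?_) u
  change op ((Along.one r).val * r (C.counit c)) • f m = f (op (C.counit c) • m)
  rw [Along.val_one, one_mul, hf]

theorem coindExt_comm (u : Tens A M C) :
    rT C (coindExt f hf) (C.regular.tensCoact M u) =
      (coindMod C r).tensCoact X (coindExt f hf u) := by
  refine tens_ext ((rT C (coindExt f hf)).comp (C.regular.tensCoact M).toAddMonoidHom)
    (((coindMod C r).tensCoact X).toAddMonoidHom.comp (coindExt f hf).toAddMonoidHom)
    (fun m c => ?_) u
  have key (w : Tens A C C) : rT C (coindExt f hf) ((assoc M C C).symm (tm A m w)) =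
      (assoc X (Tens A (Along r) C) C).symm
        (tm B (f m) ((assoc (Along r) C C).symm (tm A (Along.one r) w))) := by
    induction w using tens_induction with
    | zero => simp
    | add x y hx hy => simp only [map_add, tm_add, hx, hy]
    | tm c c' => rfl
  exact key (C.comul c)

end Ext

/-- The left counit law of `C`: the coaction doubles `c`, and `coindCounit` absorbs `ε(c₁)` into
`X`. -/
theorem coindExt_coindCounit (t : Tens B X (Tens A (Along r) C)) :
    coindExt (coindCounit C r X) coindCounit_op_smul ((coindMod C r).tensCoact X t) = t := by
  refine tens_ext₃' ((coindExt (coindCounit C r X) coindCounit_op_smul).toAddMonoidHom.comp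
    ((coindMod C r).tensCoact X).toAddMonoidHom) (AddMonoidHom.id _) (fun x b c => ?_) t
  have key (u : Tens A C C) : coindExt (coindCounit C r X) coindCounit_op_smul
      ((assoc X (Tens A (Along r) C) C).symm (tm B x ((assoc (Along r) C C).symm (tm A b u)))) =
      tm B x (tm A b (lid C (rT C C.counit.right u))) := by
    induction u using tens_induction with
    | zero => simp
    | add x y hx hy => simp only [map_add, tm_add, hx, hy]
    | tm c c' =>
      rw [assoc_symm_tm, assoc_symm_tm, coindExt_tm, coindCounit_tm_tm, smul_tm, smul_tm_left,
        rT_tm, lid_tm, ← smul_tm]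
      exact congrArg (fun z => tm B x (tm A z c'))
        (Along.val_smul_one r (op (C.counit c) • b))
  exact (key (C.comul c)).trans (congrArg (fun z => tm B x (tm A b z)) (C.counit_left c))

variable {M : RightComod C}

/-- A comodule map `M → X ⊗_B (B ⊗_A C)` is determined by its composite with the counit. -/
theorem coindExt_coact (β : M →ₗ[Aᵐᵒᵖ] Tens B X (Tens A (Along r) C))
    (hβ : ∀ m, rT C β (M.coact m) = (coindMod C r).tensCoact X (β m)) (f : M →+ X)
    (hf : ∀ (a : A) m, f (op a • m) = op (r a) • f m) (h : ∀ m, coindCounit C r X (β m) = f m)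
    (m : M) : β m = coindExt f hf (M.coact m) := by
  rw [← coindExt_coindCounit (β m), ← hβ]
  exact tens_ext ((coindExt (coindCounit C r X) coindCounit_op_smul).toAddMonoidHom.comp (rT C β))
    (coindExt f hf).toAddMonoidHom
    (fun m c => congrArg (fun x => tm B x (tm A (Along.one r) c)) (h m)) (M.coact m)

end Coind

/-! ### Semilinear colinear maps `M → Y`, and their description by the cotensor product of `Y` and
`B ⊗_A C` -/

namespace CoringHom

variable {A B : Type u} [Ring A] [Ring B] {C : Coring A} {D : Coring B} {r : A →+* B}

/-- Semilinear maps from a `C`-comodule to a `D`-comodule that are compatible with the coactions. -/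
structure IndHom (φ : CoringHom C D r) (M : RightComod C) (Y : RightComod D) where
  hom : M →+ Y
  map_smul : ∀ (a : A) m, hom (op a • m) = op (r a) • hom m
  comm : ∀ m, Y.coact (hom m) =
    mapAlong r hom φ.toAddMonoidHom map_smul φ.map_smul' (M.coact m)

variable {φ : CoringHom C D r} {M : RightComod C} {Y : RightComod D}

theorem rT_indAux (g : Tens A M (Along r) →ₗ[Bᵐᵒᵖ] Y) (hg) (u : Tens A M C) :
    rT D g (φ.indAux M u) = mapAlong r (g.toAddMonoidHom.comp (toTensOne M r)) φ.toAddMonoidHom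
      hg φ.map_smul' u :=
  tens_ext ((rT D g).comp (φ.indAux M)) (mapAlong r (g.toAddMonoidHom.comp (toTensOne M r))
    φ.toAddMonoidHom hg φ.map_smul') (fun _ _ => rfl) u

/-- The semilinear map `m ↦ g (m ⊗ 1)`. -/
def IndHom.ofHom (g : φ.induction.obj M ⟶ Y) : IndHom φ M Y where
  hom := g.lin.toAddMonoidHom.comp (toTensOne M r)
  map_smul a m := (congrArg g.lin (toTensOne_smul (M : Type u) a m)).trans
    (g.lin.map_smul _ (toTensOne M r m))
  comm m := by
    refine (g.comm (tm A m (Along.one r))).symm.trans ?_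
    refine (congrArg (rT D g.lin) ((φ.indCoact_tm M m (Along.one r)).trans
      (one_smul _ _))).trans ?_
    exact rT_indAux g.lin _ (M.coact m)

/-- The linear map `m ⊗ b ↦ f(m) b`. -/
def IndHom.lin (f : IndHom φ M Y) : Tens A M (Along r) →ₗ[Bᵐᵒᵖ] Y where
  toFun := lift (fun m b => op b.val • f.hom m)
    (fun m m' b => by rw [map_add, smul_add])
    (fun m b b' => by rw [Along.val_add, MulOpposite.op_add, add_smul])
    (fun m a b => by rw [f.map_smul, smul_smul, ← op_mul, Along.val_smul])
  map_add' := map_add _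
  map_smul' s := map_op_smul_of_tm _ s fun m b => by
    rw [lift_tm, lift_tm, Along.val_op_smul, op_mul, mul_smul, op_unop]

theorem IndHom.lin_tm (f : IndHom φ M Y) (m : M) (b : Along r) :
    f.lin (tm A m b) = op b.val • f.hom m := rfl

theorem IndHom.lin_tm_one (f : IndHom φ M Y) (m : M) :
    f.lin (tm A m (Along.one r)) = f.hom m := one_smul _ _

/-- The comodule map `m ⊗ b ↦ f(m) b`. -/
def IndHom.toHom (f : IndHom φ M Y) : φ.induction.obj M ⟶ Y where
  lin := f.lin
  comm x := by
    change rT D f.lin (φ.indCoact M x) = Y.coact (f.lin x)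
    induction x using tens_induction with
    | zero => simp
    | add x y hx hy => simp only [map_add, hx, hy]
    | tm m b =>
      rw [indCoact_tm, rT_op_smul, f.lin_tm, _root_.map_smul, f.comm]
      congr 1
      exact tens_ext ((rT D f.lin).comp (φ.indAux M))
        (mapAlong r f.hom φ.toAddMonoidHom f.map_smul φ.map_smul')
        (fun m c => congrArg (fun y => tm B y (φ.toAddMonoidHom c)) (f.lin_tm_one m)) (M.coact m)

/-- The elements `m ⊗ 1` generate `M ⊗_A B` as a right `B`-module. -/
theorem hom_ext_one {g g' : φ.induction.obj M ⟶ Y}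
    (h : ∀ m, g.lin (tm A m (Along.one r)) = g'.lin (tm A m (Along.one r))) : g = g' := by
  refine RightComod.hom_ext _ _ fun x => ?_
  refine tens_ext g.lin.toAddMonoidHom g'.lin.toAddMonoidHom (fun m b => ?_) x
  have hb : (tm A m b : Tens A M (Along r)) = op b.val • tm A m (Along.one r) := by
    rw [smul_tm_right, Along.op_smul_one]
  rw [hb]
  exact (g.lin.map_smul _ (tm A m (Along.one r))).trans
    ((congrArg _ (h m)).trans (g'.lin.map_smul _ (tm A m (Along.one r))).symm)

variable (φ) in
-- Links the left `D`-coaction and the right `C`-coaction of `B ⊗_A C`. At `y ⊗ b ⊗ c` both sides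
-- are `y b ⊗ φ(c)`: on the left the counit removes `c₂`, on the right it removes `c₁`.
theorem coindCounit_coactBC (Y : Type u) [AddCommGroup Y] [Module Bᵐᵒᵖ Y]
    (t : Tens B Y (Tens A (Along r) C)) :
    coindCounit C r (Tens B Y D)
      ((assoc Y D (Tens A (Along r) C)).symm (lT Y φ.coactBC.left t)) =
    mapAlong r (coindCounit C r Y) φ.toAddMonoidHom coindCounit_op_smul φ.map_smul'
      ((coindMod C r).tensCoact Y t) := by
  refine tens_ext₃' ((coindCounit C r (Tens B Y D)).comp
    ((assoc Y D (Tens A (Along r) C)).symm.toAddMonoidHom.comp (lT Y φ.coactBC.left)))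
    ((mapAlong r (coindCounit C r Y) φ.toAddMonoidHom coindCounit_op_smul φ.map_smul').comp
      ((coindMod C r).tensCoact Y).toAddMonoidHom) (fun y b c => ?_) t
  have h₁ (u : Tens A C C) : coindCounit C r (Tens B Y D)
      ((assoc Y D (Tens A (Along r) C)).symm (tm B y (b.val • φ.coindAux u))) =
      tm B (op b.val • y) (φ.toAddMonoidHom (rid C (lT C C.counit.left u))) := by
    induction u using tens_induction with
    | zero => simp
    | add x y hx hy => simp only [map_add, smul_add, tm_add, hx, hy]
    | tm c c' =>
      rw [coindAux_tm, smul_tm_left, assoc_symm_tm, coindCounit_tm_tm, Along.val_one, one_mul,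
        smul_tm_right, lT_tm, rid_tm, φ.map_op_smul', smul_tm, ← smul_comm]
      rfl
  have h₂ (u : Tens A C C) : mapAlong r (coindCounit C r Y) φ.toAddMonoidHom coindCounit_op_smul
      φ.map_smul' ((assoc Y (Tens A (Along r) C) C).symm
        (tm B y ((assoc (Along r) C C).symm (tm A b u)))) =
      tm B (op b.val • y) (φ.toAddMonoidHom (lid C (rT C C.counit.right u))) := by
    induction u using tens_induction with
    | zero => simp
    | add x y hx hy => simp only [map_add, tm_add, hx, hy]
    | tm c c' =>
      rw [assoc_symm_tm, assoc_symm_tm, rT_tm, lid_tm, φ.map_smul', ← smul_tm, smul_smul,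
        ← op_mul]
      rfl
  refine (h₁ (C.comul c)).trans (Eq.trans ?_ (h₂ (C.comul c)).symm)
  rw [C.counit_right, C.counit_left]

/-- The hypothesis `ht` places `t` in the cotensor product of `Y` and `B ⊗_A C`. Under it,
`coindCounit` becomes compatible with the coactions along `φ`. -/
theorem coact_coindCounit (t : Tens B Y (Tens A (Along r) C))
    (ht : rT _ Y.coact t = (assoc Y D (Tens A (Along r) C)).symm (lT Y φ.coactBC.left t)) :
    Y.coact (coindCounit C r Y t) =
      mapAlong r (coindCounit C r Y) φ.toAddMonoidHom coindCounit_op_smul φ.map_smul'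
        ((coindMod C r).tensCoact Y t) := by
  rw [← coindCounit_rT, ht, coindCounit_coactBC]

/-- A comodule map into `Y ⊗_B (B ⊗_A C)` whose values lie in the cotensor product gives a
semilinear map into `Y`. -/
def IndHom.ofCoind (β : M →ₗ[Aᵐᵒᵖ] Tens B Y (Tens A (Along r) C))
    (hβ : ∀ m, rT C β (M.coact m) = (coindMod C r).tensCoact Y (β m))
    (h : ∀ m, rT _ Y.coact (β m) =
      (assoc Y D (Tens A (Along r) C)).symm (lT Y φ.coactBC.left (β m))) : IndHom φ M Y where
  hom := (coindCounit C r Y).comp β.toAddMonoidHom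
  map_smul a m := (congrArg _ (β.map_smul (op a) m)).trans (coindCounit_op_smul a (β m))
  comm m := by
    refine (coact_coindCounit (β m) (h m)).trans ?_
    rw [← hβ]
    exact tens_ext ((mapAlong r (coindCounit C r Y) φ.toAddMonoidHom coindCounit_op_smul
      φ.map_smul').comp (rT C β)) (mapAlong r ((coindCounit C r Y).comp β.toAddMonoidHom)
      φ.toAddMonoidHom _ φ.map_smul') (fun _ _ => rfl) (M.coact m)

/-- Converse of `IndHom.ofCoind`. Both sides are `f(m₀) ⊗ φ(m₁) ⊗ (1 ⊗ m₂)`: one by the colinearity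
of `f`, the other by the left coaction of `B ⊗_A C`, and coassociativity of `M` matches them. -/
theorem IndHom.coindExt_mem (f : IndHom φ M Y) (m : M) :
    rT _ Y.coact (coindExt f.hom f.map_smul (M.coact m)) =
      (assoc Y D (Tens A (Along r) C)).symm
        (lT Y φ.coactBC.left (coindExt f.hom f.map_smul (M.coact m))) := by
  let g : Tens A M C →+ Tens B Y D := mapAlong r f.hom φ.toAddMonoidHom f.map_smul φ.map_smul'
  have hg (a : A) (u : Tens A M C) : g (op a • u) = op (r a) • g u := by
    induction u using tens_induction with
    | zero => simp
    | add x y hx hy => simp only [map_add, smul_add, hx, hy]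
    | tm m c => exact congrArg (tm B (f.hom m)) (φ.map_op_smul' a c)
  have h₁ (u : Tens A M C) : rT _ Y.coact (coindExt f.hom f.map_smul u) =
      mapAlong r g (oneTens C r) hg oneTens_smul (rT C M.coact u) :=
    tens_ext ((rT _ Y.coact).comp (coindExt f.hom f.map_smul).toAddMonoidHom)
      ((mapAlong r g (oneTens C r) hg oneTens_smul).comp (rT C M.coact))
      (fun m c => congrArg (fun t => tm B t (tm A (Along.one r) c)) (f.comm m)) u
  have h₂ (w : Tens A (Tens A M C) C) : assoc Y D (Tens A (Along r) C)
      (mapAlong r g (oneTens C r) hg oneTens_smul w) =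
      mapAlong r f.hom φ.coindAux f.map_smul φ.coindAux_smul (assoc M C C w) :=
    tens_ext₃ ((assoc Y D (Tens A (Along r) C)).toAddMonoidHom.comp
      (mapAlong r g (oneTens C r) hg oneTens_smul))
      ((mapAlong r f.hom φ.coindAux f.map_smul φ.coindAux_smul).comp
        (assoc M C C).toAddMonoidHom) (fun _ _ _ => rfl) w
  have h₃ (u : Tens A M C) : lT Y φ.coactBC.left (coindExt f.hom f.map_smul u) =
      mapAlong r f.hom φ.coindAux f.map_smul φ.coindAux_smul (lT M C.comul.left u) := by
    refine tens_ext ((lT Y φ.coactBC.left).comp (coindExt f.hom f.map_smul).toAddMonoidHom)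
      ((mapAlong r f.hom φ.coindAux f.map_smul φ.coindAux_smul).comp (lT M C.comul.left))
      (fun m c => ?_) u
    refine congrArg (tm B (f.hom m)) ((φ.coactBC_tm (Along.one r) c).trans ?_)
    rw [Along.val_one, one_smul]
    rfl
  rw [AddEquiv.eq_symm_apply, h₁, h₂, h₃, M.coact_coassoc]

end CoringHom

/-- The comodule map `X ⊗_A N → Y ⊗_A N` induced by a linear map. -/
def ModComod.tensMap {A B : Type u} [Ring A] [Ring B] {D : Coring B} (N : ModComod A D)
    {X Y : Type u} [AddCommGroup X] [Module Aᵐᵒᵖ X] [AddCommGroup Y] [Module Aᵐᵒᵖ Y]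
    (g : X →ₗ[Aᵐᵒᵖ] Y) : N.tensObj X ⟶ N.tensObj Y where
  lin := rTr N g
  comm := N.rT_tensCoact g

/-! ### Exactness of the co-hom functor on the canonical resolution of a comodule -/

section Exactness

variable {A B : Type u} [Ring A] [Ring B] {D : Coring B}

/-- `h` preserves the equalizer `Y → Y ⊗_B D ⇉ (Y ⊗_B D) ⊗_B D`. -/
def PreservesCanonical (h : RightComod D ⥤ ModuleCat.{u} Aᵐᵒᵖ) : Prop :=
  ∀ Y : RightComod D, Function.Injective (h.map Y.coactHom).hom ∧
    ∀ z, (h.map (D.regular.tensMap Y.coact)).hom z =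
      (h.map (D.regular.tensObj Y).coactHom).hom z → ∃ y, (h.map Y.coactHom).hom y = z

/-- The canonical fork of `Y` is an equalizer on elements, the preimage of `t` being `(Y ⊗ ε)(t)`.
-/
theorem exists_coact_eq (Y : RightComod D) (t : Tens B Y D)
    (h : rT D Y.coact t = D.regular.tensCoact Y t) : ∃ y, Y.coact y = t := by
  refine ⟨RightComod.tensCounit D Y t, ?_⟩
  rw [← RightComod.tensCounit_rT, h]
  exact (D.regular.tensObj Y).coact_counit t

/-! ### Exactness of `h` when `- ⊗_A N` preserves injectives -/

section Injector

variable {N : ModComod A D} {h : RightComod D ⥤ ModuleCat.{u} Aᵐᵒᵖ} (adj : h ⊣ N.tensorFunctor)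
  [N.tensorFunctor.PreservesInjectiveObjects]

include adj

/-- Maps from `h(Z)` to an injective module `E` are comodule maps `Z → E ⊗_A N`, and `E ⊗_A N` is
injective. One killing the image of `h(f)` therefore factors through `coker f`, extends along `a -
b`, and so kills every element equalized by `h(a)` and `h(b)`. Injectives separate points of the
quotient by that image. -/
theorem map_exact_of_preservesInjectiveObjects {Y Z W : RightComod D} (f : Y ⟶ Z) (a b : Z ⟶ W)
    (hf : ∀ y, a.lin (f.lin y) = b.lin (f.lin y))
    (hab : ∀ z, a.lin z = b.lin z → ∃ y, f.lin y = z) (z : h.obj Z)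
    (hz : (h.map a).hom z = (h.map b).hom z) : ∃ y, (h.map f).hom y = z := by
  let R := LinearMap.range (h.map f).hom
  let Q : ModuleCat.{u} Aᵐᵒᵖ := ModuleCat.of _ (h.obj Z ⧸ R)
  -- Detecting membership in the image of `h(f)` needs only one map `q` with exactly this kernel and
  -- an injective target.
  let E := Injective.under Q
  let q : h.obj Z ⟶ E := ModuleCat.ofHom R.mkQ ≫ Injective.ι Q
  let g : Z ⟶ N.tensorFunctor.obj E := adj.homEquiv Z E q
  have hg (z : Z) : rT N q.hom (unitLin adj Z z) = g.lin z := by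
    have := adj.homEquiv_unit Z E q
    exact (congrArg (fun k => RightComod.Hom.lin k z) this).symm
  have hq : (q.hom.comp (h.map f).hom) = 0 := by
    ext y
    have : R.mkQ ((h.map f).hom y) = 0 :=
      (Submodule.Quotient.mk_eq_zero R).2 (LinearMap.mem_range_self _ y)
    exact (congrArg (Injective.ι Q).hom this).trans (map_zero _)
  have hgf (y : Y) : g.lin (f.lin y) = 0 := by
    rw [← hg, ← unitLin_naturality, ← rT_comp, hq, rT_zero]
    rfl
  have hk (y : Y) : (RightComod.subHom a b).lin (f.lin y) = 0 := sub_eq_zero.2 (hf y)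
  let p : RightComod.coker f ⟶ W := RightComod.cokerDesc f (RightComod.subHom a b) hk
  let e : RightComod.coker f ⟶ N.tensorFunctor.obj E := RightComod.cokerDesc f g hgf
  -- Injectivity of `a - b` on `coker f` is precisely the equalizer property `hab`.
  have : Mono p := RightComod.mono_of_injective p <| (injective_iff_map_eq_zero _).2 fun x hx => by
    obtain ⟨x, rfl⟩ := (LinearMap.range f.lin).mkQ_surjective x
    obtain ⟨y, rfl⟩ := hab x (sub_eq_zero.1 hx)
    exact (Submodule.Quotient.mk_eq_zero _).2 (LinearMap.mem_range_self _ y)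
  have : Injective (N.tensObj E) := N.tensorFunctor.injective_obj E
  let s : W ⟶ N.tensObj E := Injective.factorThru e p
  have hs (z : Z) : s.lin (a.lin z) - s.lin (b.lin z) = g.lin z :=
    (s.lin.map_sub _ _).symm.trans (LinearMap.congr_fun (congrArg RightComod.Hom.lin
      (Injective.comp_factorThru e p)) ((LinearMap.range f.lin).mkQ z))
  -- Transposing `s ∘ (a - b) = g` back along the adjunction shows that `q` factors through `h(a) -
  -- h(b)`.
  have key : (desc adj s).comp (h.map a).hom - (desc adj s).comp (h.map b).hom = q.hom :=
    adj_ext adj fun z => by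
      rw [rT_sub, rT_comp, rT_comp, unitLin_naturality, unitLin_naturality, rT_desc, rT_desc]
      exact (hs z).trans (hg z).symm
  have hqz : q.hom z = 0 := by
    rw [← key, LinearMap.sub_apply, LinearMap.comp_apply, LinearMap.comp_apply, hz, sub_self]
  have hz' : R.mkQ z = 0 := (ModuleCat.mono_iff_injective (Injective.ι Q)).1 inferInstance
    (hqz.trans (map_zero _).symm)
  exact (Submodule.Quotient.mk_eq_zero R).1 hz'

theorem preservesCanonical_of_preservesInjectiveObjects : PreservesCanonical h := fun Y => by
  refine ⟨?_, fun z hz => map_exact_of_preservesInjectiveObjects adj _ _ _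
    (fun y => ?_) (fun t ht => exists_coact_eq Y t ht) z hz⟩
  · have := Functor.preservesMonomorphisms_of_adjunction_of_preservesInjectiveObjects adj
    have : Mono Y.coactHom := RightComod.mono_of_injective _ Y.coact_injective
    exact (ModuleCat.mono_iff_injective _).1 inferInstance
  · exact Y.coactHom.comm y

end Injector

/-! ### Splitting of the canonical fork when `D` is coseparable -/

section Coseparable

variable (p : BimodHom B B (Tens B D D) D)

/-- The map `y ⊗ d ↦ ∑ y₀ ε(p(y₁ ⊗ d))`. -/
def coactRetraction (Y : RightComod D) : Tens B Y D →ₗ[Bᵐᵒᵖ] Y :=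
  (RightComod.tensCounit D Y).comp ((lTr Y p).comp ((assocR Y D D).comp (rTr D Y.coact)))

theorem coactRetraction_coact (hp : ∀ d, p (D.comul d) = d) (Y : RightComod D) (y : Y) :
    coactRetraction p Y (Y.coact y) = y := by
  change RightComod.tensCounit D Y (lT Y p.left (assoc Y D D (rT D Y.coact (Y.coact y)))) = y
  have : p.left.comp D.comul.left = LinearMap.id := LinearMap.ext hp
  rw [Y.coact_coassoc, ← lT_comp, this, lT_id, RightComod.tensCounit_coact]

theorem coactRetraction_naturality {Y Z : RightComod D} (f : Y ⟶ Z) (t : Tens B Y D) :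
    coactRetraction p Z (rT D f.lin t) = f.lin (coactRetraction p Y t) := by
  change RightComod.tensCounit D Z (lT Z p.left (assoc Z D D (rT D Z.coact (rT D f.lin t)))) =
    f.lin (RightComod.tensCounit D Y (lT Y p.left (assoc Y D D (rT D Y.coact t))))
  have : Z.coact.comp f.lin = (rTr D f.lin).comp Y.coact :=
    LinearMap.ext fun y => (f.comm y).symm
  rw [← rT_comp, this, rT_comp, assoc_rT_rT, ← rT_lT, RightComod.tensCounit_rT]

variable (hl : ∀ x, lT D p.left (assoc D D D (rT D D.comul.right x)) = D.comul (p x))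
  (hr : ∀ x, rT D p.right ((assoc D D D).symm (lT D D.comul.left x)) = D.comul (p x))

include hl in
-- Left colinearity of `p` removes the counit: `y₀ ⊗ y₁ ε(p(y₂ ⊗ d))` collapses to `y₀ ⊗ p(y₁ ⊗ d)`.
-- Naturality along `Y → Y ⊗ D` brings the left side to this form.
theorem coact_coactRetraction (Y : RightComod D) (t : Tens B Y D) :
    Y.coact (coactRetraction p Y t) = lT Y p.left (assoc Y D D (rT D Y.coact t)) := by
  refine (coactRetraction_naturality p Y.coactHom t).symm.trans ?_
  change RightComod.tensCounit D _ (lT _ p.left (assoc _ D D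
    (rT D (D.regular.tensCoact Y) (rT D Y.coact t)))) = _
  generalize rT D Y.coact t = s
  refine tens_ext₃ ((RightComod.tensCounit D (Tens B Y D)).toAddMonoidHom.comp
    ((lT _ p.left).comp ((assoc _ D D).toAddMonoidHom.comp (rT D (D.regular.tensCoact Y)))))
    ((lT Y p.left).comp (assoc Y D D).toAddMonoidHom) (fun y x d => ?_) s
  have h₁ (u : Tens B D D) : RightComod.tensCounit D (Tens B Y D) (lT _ p.left (assoc _ D D
      (tm B ((assoc Y D D).symm (tm B y u)) d))) =
      tm B y (rid D (lT D D.counit.left (lT D p.left (assoc D D D (tm B u d))))) := by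
    induction u using tens_induction with
    | zero => simp
    | add x y hx hy => simp only [map_add, add_tm, tm_add, hx, hy]
    | tm c c' => rfl
  refine (h₁ (D.comul x)).trans (congrArg (tm B y) ?_)
  refine (congrArg (fun w => rid D (lT D D.counit.left w)) (hl (tm B x d))).trans ?_
  exact D.counit_right _

include hl hr in
/-- The retraction as a comodule map. -/
theorem coactRetraction_comm (Y : RightComod D) (t : Tens B Y D) :
    rT D (coactRetraction p Y) (D.regular.tensCoact Y t) = Y.coact (coactRetraction p Y t) := by
  rw [coact_coactRetraction p hl]
  have h₁ (t : Tens B Y D) : rT D (coactRetraction p Y) (D.regular.tensCoact Y t) =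
      rT D ((RightComod.tensCounit D Y).comp ((lTr Y p).comp (assocR Y D D)))
        (D.regular.tensCoact (Tens B Y D) (rT D Y.coact t)) := by
    rw [← ModComod.rT_tensCoact, ← rT_comp]
    rfl
  rw [h₁]
  generalize rT D Y.coact t = s
  refine tens_ext₃ ((rT D ((RightComod.tensCounit D Y).comp
    ((lTr Y p).comp (assocR Y D D)))).comp (D.regular.tensCoact (Tens B Y D)).toAddMonoidHom)
    ((lT Y p.left).comp (assoc Y D D).toAddMonoidHom) (fun y x d => ?_) s
  have h₂ (u : Tens B D D) : rT D ((RightComod.tensCounit D Y).comp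
      ((lTr Y p).comp (assocR Y D D))) ((assoc _ D D).symm (tm B (tm B y x) u)) =
      tm B y (lid D (rT D D.counit.right (rT D p.right ((assoc D D D).symm (tm B x u))))) := by
    induction u using tens_induction with
    | zero => simp
    | add x y hx hy => simp only [map_add, tm_add, hx, hy]
    | tm c c' => exact smul_tm (D.counit (p (tm B x c))) y c'
  -- Here right colinearity of `p` is used, with the left counit law; the other side was computed
  -- from left colinearity.
  refine (h₂ (D.comul d)).trans (congrArg (tm B y) ?_)
  refine (congrArg (fun w => lid D (rT D D.counit.right w)) (hr (tm B x d))).trans ?_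
  exact D.counit_left _

/-- The retraction of `Y → Y ⊗ D` is colinear and natural in `Y`, so the canonical fork is split.
Split equalizers are preserved by every functor. -/
theorem preservesCanonical_of_isCoseparable (hD : D.IsCoseparable)
    (h : RightComod D ⥤ ModuleCat.{u} Aᵐᵒᵖ) : PreservesCanonical h := fun Y => by
  obtain ⟨p, hl, hr, hp⟩ := hD
  let s (Y : RightComod D) : D.regular.tensObj Y ⟶ Y :=
    ⟨coactRetraction p Y, coactRetraction_comm p hl hr Y⟩
  have hs (Y : RightComod D) : Y.coactHom ≫ s Y = 𝟙 Y :=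
    RightComod.hom_ext _ _ (coactRetraction_coact p hp Y)
  -- This is the second splitting identity of the fork: the retraction at `Y ⊗ D` turns the arrow `ρ
  -- ⊗ D` into the idempotent `ρ ∘ s`, while it turns the other arrow into the identity.
  have hn : D.regular.tensMap Y.coact ≫ s (D.regular.tensObj Y) =
      s Y ≫ Y.coactHom :=
    RightComod.hom_ext _ _ (coactRetraction_naturality p Y.coactHom)
  have hm {Y Z W : RightComod D} (f : Y ⟶ Z) (g : Z ⟶ W) (y : h.obj Y) :
      (h.map g).hom ((h.map f).hom y) = (h.map (f ≫ g)).hom y := by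
    rw [h.map_comp]
    rfl
  have hi (Y : RightComod D) (y : h.obj Y) : (h.map (s Y)).hom ((h.map Y.coactHom).hom y) = y := by
    rw [hm, hs, h.map_id]
    rfl
  refine ⟨Function.LeftInverse.injective (hi Y), fun z hz => ⟨(h.map (s Y)).hom z, ?_⟩⟩
  rw [hm, ← hn]
  exact (hm _ _ z).symm.trans ((congrArg _ hz).trans (hi _ z))

end Coseparable

end Exactness

/-! ### The canonical map from `h(Y)` to the cotensor product of `Y` and `h(D)` -/

section Cotensor

variable {A B : Type u} [Ring A] [Ring B] {C : Coring A} {D : Coring B}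

section

variable {N : ModComod A D} {h : RightComod D ⥤ ModuleCat.{u} Aᵐᵒᵖ} (adj : h ⊣ N.tensorFunctor)

theorem map_comp_hom_apply {Y Z W : RightComod D} (f : Y ⟶ Z) (g : Z ⟶ W) (y : h.obj Y) :
    (h.map (f ≫ g)).hom y = (h.map g).hom ((h.map f).hom y) := by
  rw [h.map_comp]
  rfl

theorem upsilon_naturality {X X' : Type u} [AddCommGroup X] [Module Bᵐᵒᵖ X] [AddCommGroup X']
    [Module Bᵐᵒᵖ X'] (g : X →ₗ[Bᵐᵒᵖ] X') (t : Tens B X (Cohom adj)) :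
    (h.map (D.regular.tensMap g)).hom (upsilon adj X t) = upsilon adj X' (rT _ g t) := by
  refine tens_ext ((h.map (D.regular.tensMap g)).hom.toAddMonoidHom.comp
    (upsilon adj X).toAddMonoidHom) ((upsilon adj X').toAddMonoidHom.comp (rT _ g))
    (fun x z => ?_) t
  exact (map_comp_hom_apply (D.insHom x) (D.regular.tensMap g) z).symm

theorem upsilon_cohomCoactL (z : Cohom adj) :
    upsilon adj D (cohomCoactL adj z) = (h.map D.comulHom).hom z :=
  (upsilonEquiv adj D).apply_symm_apply _

/-- Through `X ⊗ h(D) ≅ h(X ⊗ D)`, the map `h(X ⊗ Δ)` becomes `X` tensored with the left coaction of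
`h(D)`. With `upsilon_naturality`, this carries `h` of the canonical pair to the pair that defines
the cotensor product. -/
theorem map_coactHom_upsilon {X : Type u} [AddCommGroup X] [Module Bᵐᵒᵖ X]
    (t : Tens B X (Cohom adj)) :
    (h.map (D.regular.tensObj X).coactHom).hom (upsilon adj X t) =
      upsilon adj (Tens B X D)
        ((assoc X D (Cohom adj)).symm (lT X (cohomCoactLBi adj).left t)) := by
  refine tens_ext ((h.map (D.regular.tensObj X).coactHom).hom.toAddMonoidHom.comp
    (upsilon adj X).toAddMonoidHom) ((upsilon adj (Tens B X D)).toAddMonoidHom.comp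
      ((assoc X D (Cohom adj)).symm.toAddMonoidHom.comp (lT X (cohomCoactLBi adj).left)))
    (fun x z => ?_) t
  have h₁ : D.insHom x ≫ (D.regular.tensObj X).coactHom =
      D.comulHom ≫ D.regular.tensMap (ins D x) :=
    RightComod.hom_ext _ _ fun d => assoc_symm_tm_eq x (D.comul d)
  have h₂ : (assoc X D (Cohom adj)).symm (tm B x (cohomCoactL adj z)) =
      rT (Cohom adj) (ins D x) (cohomCoactL adj z) := assoc_symm_tm_eq x (cohomCoactL adj z)
  refine (map_comp_hom_apply (D.insHom x) (D.regular.tensObj X).coactHom z).symm.trans ?_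
  refine Eq.trans ?_ (congrArg (upsilon adj (Tens B X D)) h₂.symm)
  refine (congrArg (fun k => (h.map k).hom z) h₁).trans ?_
  refine (map_comp_hom_apply D.comulHom (D.regular.tensMap (ins D x)) z).trans ?_
  rw [← upsilon_cohomCoactL, upsilon_naturality]

/-- The canonical map `h(Y) → Y ⊗_B h(D)`. -/
def toTensCohom (Y : RightComod D) : h.obj Y →ₗ[Aᵐᵒᵖ] Tens B Y (Cohom adj) :=
  (upsilonEquiv adj Y).symm.toLinearMap.comp (h.map Y.coactHom).hom

theorem upsilon_toTensCohom (Y : RightComod D) (z : h.obj Y) :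
    upsilon adj Y (toTensCohom adj Y z) = (h.map Y.coactHom).hom z :=
  (upsilonEquiv adj Y).apply_symm_apply _

theorem upsilon_injective (X : Type u) [AddCommGroup X] [Module Bᵐᵒᵖ X] :
    Function.Injective (upsilon adj X) := (upsilonEquiv adj X).injective

theorem toTensCohom_naturality {Y Y' : RightComod D} (g : Y ⟶ Y') (z : h.obj Y) :
    toTensCohom adj Y' ((h.map g).hom z) = rT (Cohom adj) g.lin (toTensCohom adj Y z) := by
  apply upsilon_injective
  have : g ≫ Y'.coactHom = Y.coactHom ≫ D.regular.tensMap g.lin :=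
    RightComod.hom_ext _ _ fun y => (g.comm y).symm
  rw [upsilon_toTensCohom, ← map_comp_hom_apply, this, map_comp_hom_apply, ← upsilon_naturality,
    ← upsilon_toTensCohom]

/-- `h` applied to the coassociativity of `Y`: the canonical map takes values in the cotensor
product of `Y` and `h(D)`. -/
theorem toTensCohom_mem (Y : RightComod D) (z : h.obj Y) :
    rT (Cohom adj) Y.coact (toTensCohom adj Y z) = (assoc Y D (Cohom adj)).symm
      (lT Y (cohomCoactLBi adj).left (toTensCohom adj Y z)) := by
  apply upsilon_injective
  have : Y.coactHom ≫ D.regular.tensMap Y.coact =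
      Y.coactHom ≫ (D.regular.tensObj Y).coactHom :=
    RightComod.hom_ext _ _ fun y => Y.coactHom.comm y
  rw [← upsilon_naturality, ← map_coactHom_upsilon, upsilon_toTensCohom, ← map_comp_hom_apply,
    this]
  exact map_comp_hom_apply Y.coactHom (D.regular.tensObj Y).coactHom z

theorem toTensCohom_injective (hc : PreservesCanonical h) (Y : RightComod D) :
    Function.Injective (toTensCohom adj Y) :=
  (upsilonEquiv adj Y).symm.injective.comp (hc Y).1

/-- With `toTensCohom_injective`, this identifies `h(Y)` with the cotensor product of `Y` and
`h(D)`. -/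
theorem exists_toTensCohom_eq (hc : PreservesCanonical h) (Y : RightComod D)
    (t : Tens B Y (Cohom adj))
    (ht : rT (Cohom adj) Y.coact t = (assoc Y D (Cohom adj)).symm
      (lT Y (cohomCoactLBi adj).left t)) : ∃ z, toTensCohom adj Y z = t := by
  obtain ⟨z, hz⟩ := (hc Y).2 (upsilon adj Y t) (by
    rw [upsilon_naturality, map_coactHom_upsilon, ht])
  refine ⟨z, upsilon_injective adj Y ?_⟩
  rw [upsilon_toTensCohom, hz]

end

/-! ### Compatibility of these maps with the right `C`-coactions -/

variable {N : Bicomodule C D} {h : RightComod D ⥤ ModuleCat.{u} Aᵐᵒᵖ} (adj : h ⊣ N.tensorFunctor)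

/-- On `x ⊗ z` the map is `h(d ↦ x ⊗ d)`, and the lifted functor makes every `h(g)` colinear. -/
theorem upsilon_comm {X : Type u} [AddCommGroup X] [Module Bᵐᵒᵖ X] (t : Tens B X (Cohom adj)) :
    rT C (upsilon adj X) ((cohomBicomodule adj).tensCoact X t) =
      liftCoact adj (D.regular.tensObj X) (upsilon adj X t) := by
  refine tens_ext ((rT C (upsilon adj X)).comp
    ((cohomBicomodule adj).tensCoact X).toAddMonoidHom)
    ((liftCoact adj (D.regular.tensObj X)).toAddMonoidHom.comp (upsilon adj X).toAddMonoidHom)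
    (fun x z => ?_) t
  have h₁ : (assoc X (Cohom adj) C).symm (tm B x (cohomCoactR adj z)) =
      rT C (ins (Cohom adj) x) (cohomCoactR adj z) := assoc_symm_tm_eq x (cohomCoactR adj z)
  refine (congrArg (rT C (upsilon adj X)) h₁).trans ?_
  refine (rT_comp (ins (Cohom adj) x) (upsilon adj X) (cohomCoactR adj z)).symm.trans ?_
  exact ((cohomFunctor adj).map (D.insHom x)).comm z

theorem toTensCohom_comm (Y : RightComod D) (z : h.obj Y) :
    rT C (toTensCohom adj Y) (liftCoact adj Y z) =
      (cohomBicomodule adj).tensCoact Y (toTensCohom adj Y z) := by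
  have h₁ : rT C (h.map Y.coactHom).hom (liftCoact adj Y z) =
      rT C (upsilon adj Y) ((cohomBicomodule adj).tensCoact Y (toTensCohom adj Y z)) := by
    refine (((cohomFunctor adj).map Y.coactHom).comm z).trans ?_
    rw [upsilon_comm, upsilon_toTensCohom]
    rfl
  refine (rT_comp (N := C) (h.map Y.coactHom).hom (upsilonEquiv adj Y).symm.toLinearMap _).trans ?_
  rw [h₁]
  refine (rT_comp (N := C) (upsilon adj Y) (upsilonEquiv adj Y).symm.toLinearMap _).symm.trans ?_
  refine Eq.trans ?_ (rT_id _)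
  exact congrArg (fun l => rT C l ((cohomBicomodule adj).tensCoact Y (toTensCohom adj Y z)))
    (LinearMap.ext (upsilonEquiv adj Y).symm_apply_apply)

/-- Functoriality of the cotensor product in its second argument, stated on elements; only the left
colinearity of `τ` enters. -/
theorem Bicomodule.Hom.lT_mem {P Q : Bicomodule D C} (τ : P ⟶ Q) {Y : RightComod D}
    {t : Tens B Y P}
    (ht : rT P Y.coact t = (assoc Y D P).symm (lT Y P.coactL.left t)) :
    rT Q Y.coact (lT Y τ.hom.left t) =
      (assoc Y D Q).symm (lT Y Q.coactL.left (lT Y τ.hom.left t)) := by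
  have : Q.coactL.left.comp τ.hom.left = (lTl D τ.hom.left).comp P.coactL.left :=
    LinearMap.ext fun x => (τ.commL x).symm
  rw [rT_lT, ht, ← lT_comp, this, lT_comp, assoc_symm_lT_lT]

theorem ModComod.lT_comm {P Q : ModComod B C} (τ : BimodHom B A P Q)
    (hτ : ∀ x, rT C τ.right (P.coact x) = Q.coact (τ x)) {X : Type u} [AddCommGroup X]
    [Module Bᵐᵒᵖ X] (t : Tens B X P) :
    rT C (lTr X τ) (P.tensCoact X t) = Q.tensCoact X (lT X τ.left t) := by
  have : Q.coactBi.left.comp τ.left = (rTl C τ).comp P.coactBi.left :=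
    LinearMap.ext fun x => (hτ x).symm
  change rT C (lTr X τ) ((assoc X P C).symm (lT X P.coactBi.left t)) =
    (assoc X Q C).symm (lT X Q.coactBi.left (lT X τ.left t))
  rw [← lT_comp, this, lT_comp, assoc_symm_lT_rT]

theorem Bicomodule.iso_hom_inv_apply {P Q : Bicomodule D C} (e : P ≅ Q) (x : P) :
    e.inv.hom (e.hom.hom x) = x :=
  congrArg (fun k : P ⟶ P => k.hom x) e.hom_inv_id

theorem Bicomodule.iso_inv_hom_apply {P Q : Bicomodule D C} (e : P ≅ Q) (x : Q) :
    e.hom.hom (e.inv.hom x) = x :=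
  congrArg (fun k : Q ⟶ Q => k.hom x) e.inv_hom_id

end Cotensor

/-! ### The right adjoint of the induction functor -/

namespace CoringHom

variable {A B : Type u} [Ring A] [Ring B] {C : Coring A} {D : Coring B} {r : A →+* B}
  {φ : CoringHom C D r} {N : Bicomodule C D} {h : RightComod D ⥤ ModuleCat.{u} Aᵐᵒᵖ}
  {adj : h ⊣ N.tensorFunctor} (e : cohomBicomodule adj ≅ φ.tensLeft)

/-- The map `h(Y) → Y ⊗_B (B ⊗_A C)`. -/
def toCoind (Y : RightComod D) : h.obj Y →ₗ[Aᵐᵒᵖ] Tens B Y (Tens A (Along r) C) :=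
  (lTr Y e.hom.hom).comp (toTensCohom adj Y)

theorem toCoind_comm (Y : RightComod D) (z : h.obj Y) :
    rT C (toCoind e Y) (liftCoact adj Y z) = (coindMod C r).tensCoact Y (toCoind e Y z) := by
  refine (rT_comp (N := C) (toTensCohom adj Y) (lTr Y e.hom.hom) (liftCoact adj Y z)).trans ?_
  rw [toTensCohom_comm]
  exact ModComod.lT_comm e.hom.hom e.hom.commR (toTensCohom adj Y z)

theorem toCoind_mem (Y : RightComod D) (z : h.obj Y) :
    rT _ Y.coact (toCoind e Y z) =
      (assoc Y D (Tens A (Along r) C)).symm (lT Y φ.coactBC.left (toCoind e Y z)) :=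
  Bicomodule.Hom.lT_mem e.hom (toTensCohom_mem adj Y z)

theorem lT_iso_injective (Y : Type u) [AddCommGroup Y] [Module Bᵐᵒᵖ Y] :
    Function.Injective (lT Y e.hom.hom.left) :=
  Function.LeftInverse.injective (g := lT Y e.inv.hom.left) fun t => by
    have : e.inv.hom.left.comp e.hom.hom.left = LinearMap.id :=
      LinearMap.ext (Bicomodule.iso_hom_inv_apply e)
    rw [← lT_comp, this, lT_id]

theorem toCoind_injective (hc : PreservesCanonical h) (Y : RightComod D) :
    Function.Injective (toCoind e Y) :=
  (lT_iso_injective e Y).comp (toTensCohom_injective adj hc Y)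

theorem exists_toCoind_eq (hc : PreservesCanonical h) (Y : RightComod D)
    (t : Tens B Y (Tens A (Along r) C))
    (ht : rT _ Y.coact t = (assoc Y D (Tens A (Along r) C)).symm (lT Y φ.coactBC.left t)) :
    ∃ z, toCoind e Y z = t := by
  obtain ⟨z, hz⟩ := exists_toTensCohom_eq adj hc Y (lT Y e.inv.hom.left t)
    (Bicomodule.Hom.lT_mem e.inv (t := t) ht)
  refine ⟨z, (congrArg (lT Y e.hom.hom.left) hz).trans ?_⟩
  have : e.hom.hom.left.comp e.inv.hom.left = LinearMap.id :=
    LinearMap.ext (Bicomodule.iso_inv_hom_apply e)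
  refine (lT_comp e.inv.hom.left e.hom.hom.left t).symm.trans ?_
  rw [this]
  exact lT_id t

/-- The counit of the adjunction as a semilinear map `h(Y) → Y`. -/
def indCounit (Y : RightComod D) : IndHom φ ((cohomFunctor adj).obj Y) Y :=
  IndHom.ofCoind (M := (cohomFunctor adj).obj Y) (toCoind e Y) (toCoind_comm e Y) (toCoind_mem e Y)

theorem indCounit_hom (Y : RightComod D) (z : h.obj Y) :
    (indCounit e Y).hom z = coindCounit C r Y (toCoind e Y z) := rfl

theorem indCounit_naturality {Y Y' : RightComod D} (g : Y ⟶ Y') (z : h.obj Y) :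
    (indCounit e Y').hom ((h.map g).hom z) = g.lin ((indCounit e Y).hom z) := by
  rw [indCounit_hom, indCounit_hom, ← coindCounit_rT]
  change coindCounit C r Y' (lT Y' e.hom.hom.left (toTensCohom adj Y' _)) =
    coindCounit C r Y' (rT _ g.lin (lT Y e.hom.hom.left (toTensCohom adj Y z)))
  rw [toTensCohom_naturality]
  exact congrArg (coindCounit C r Y') (rT_lT g.lin e.hom.hom.left (toTensCohom adj Y z)).symm

/-- Composing with the counit determines `α` after the map `toCoind`, by the cofreeness of its
target. Where `toCoind` is injective, `α` itself is determined. -/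
theorem toCoind_hom {M : RightComod C} {Y : RightComod D}
    (α : M ⟶ (cohomFunctor adj).obj Y) (f : IndHom φ M Y)
    (hf : ∀ m, (indCounit e Y).hom (α.lin m) = f.hom m) (m : M) :
    toCoind e Y (α.lin m) = coindExt f.hom f.map_smul (M.coact m) :=
  coindExt_coact (M := M) ((toCoind e Y).comp α.lin) (fun m => by
    refine (rT_comp (N := C) α.lin (toCoind e Y) (M.coact m)).trans ?_
    rw [α.comm]
    exact toCoind_comm e Y (α.lin m)) f.hom f.map_smul hf m

/-- The colinear extension of `f` lands in the cotensor product, which is the image of the injection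
`toCoind`, and so it lifts to `h(Y)`. -/
theorem exists_hom (hC : C.IsLeftFlat) (hc : PreservesCanonical h) {M : RightComod C}
    {Y : RightComod D} (f : IndHom φ M Y) : ∃ α : M ⟶ (cohomFunctor adj).obj Y,
      ∀ m, (indCounit e Y).hom (α.lin m) = f.hom m := by
  have hi := toCoind_injective e hc Y
  let β : M →ₗ[Aᵐᵒᵖ] Tens B Y (Tens A (Along r) C) := (coindExt f.hom f.map_smul).comp M.coact
  have hβ (m : M) : β m ∈ LinearMap.range (toCoind e Y) :=
    exists_toCoind_eq e hc Y (β m) (f.coindExt_mem m)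
  let α : M →ₗ[Aᵐᵒᵖ] h.obj Y :=
    (LinearEquiv.ofInjective _ hi).symm.toLinearMap.comp (β.codRestrict _ hβ)
  have hα (m : M) : toCoind e Y (α m) = β m :=
    congrArg Subtype.val ((LinearEquiv.ofInjective _ hi).apply_symm_apply ⟨β m, hβ m⟩)
  have hα' : (toCoind e Y).comp α = β := LinearMap.ext hα
  -- Flatness of `C` keeps `toCoind ⊗ C` injective, so colinearity of the lift can be checked in `Y
  -- ⊗_B (B ⊗_A C)`.
  refine ⟨⟨α, fun m => hC _ _ (toCoind e Y) hi ?_⟩, fun m => ?_⟩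
  · refine (rT_comp (N := C) α (toCoind e Y) (M.coact m)).symm.trans ?_
    rw [hα']
    refine Eq.trans ?_ (toCoind_comm e Y (α m)).symm
    rw [hα, rT_comp]
    refine (congrArg _ (M.coactHom.comm m)).trans ?_
    exact coindExt_comm f.hom f.map_smul (M.coact m)
  · refine (congrArg (coindCounit C r Y) (hα m)).trans ?_
    refine (coindCounit_coindExt f.hom f.map_smul (M.coact m)).trans ?_
    rw [RightComod.tensCounit_coact]

/-- The functor `h` is right adjoint to induction as soon as `h(D) ≅ B ⊗_A C` and `h` preserves
the canonical resolutions of comodules. -/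
def inductionAdj (hC : C.IsLeftFlat) (hc : PreservesCanonical h) :
    φ.induction ⊣ cohomFunctor adj :=
  have one {M : RightComod C} {Y : RightComod D} (α : M ⟶ (cohomFunctor adj).obj Y) (m : M) :
      (φ.induction.map α ≫ (indCounit e Y).toHom).lin (tm A m (Along.one r)) =
        (indCounit e Y).hom (α.lin m) := (indCounit e Y).lin_tm_one (α.lin m)
  -- Injectivity comes from `toCoind_hom`, both maps having the same extension of `f` as image;
  -- surjectivity comes from `exists_hom`.
  have bij (M : RightComod C) (Y : RightComod D) : Function.Bijective
      fun α : M ⟶ (cohomFunctor adj).obj Y => φ.induction.map α ≫ (indCounit e Y).toHom := by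
    refine ⟨fun α β h => ?_, fun g => ?_⟩
    · have hm (m : M) : (indCounit e Y).hom (β.lin m) = (indCounit e Y).hom (α.lin m) := by
        rw [← one, ← one]
        exact (LinearMap.congr_fun (congrArg RightComod.Hom.lin h) (tm A m (Along.one r))).symm
      let f := IndHom.ofHom (φ.induction.map α ≫ (indCounit e Y).toHom)
      refine RightComod.hom_ext _ _ fun m => toCoind_injective e hc Y ?_
      rw [toCoind_hom e α f (fun m => (one α m).symm),
        toCoind_hom e β f (fun m => (hm m).trans (one α m).symm)]
    · obtain ⟨α, hα⟩ := exists_hom e hC hc (IndHom.ofHom g)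
      exact ⟨α, hom_ext_one fun m => (one α m).trans (hα m)⟩
  Adjunction.mkOfHomEquiv
    { homEquiv := fun M Y => (Equiv.ofBijective _ (bij M Y)).symm
      homEquiv_naturality_left_symm := fun {M M' Y} g α => by
        change φ.induction.map (g ≫ α) ≫ _ = _ ≫ _ ≫ _
        rw [Functor.map_comp, Category.assoc]
      homEquiv_naturality_right := fun {M Y Y'} k g => by
        rw [Equiv.symm_apply_eq]
        change _ = φ.induction.map (_ ≫ _) ≫ (indCounit e Y').toHom
        have hn : φ.induction.map ((cohomFunctor adj).map g) ≫ (indCounit e Y').toHom =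
            (indCounit e Y).toHom ≫ g := hom_ext_one fun z =>
          (one _ z).trans ((indCounit_naturality e g z).trans
            (congrArg g.lin ((indCounit e Y).lin_tm_one z).symm))
        rw [Functor.map_comp, Category.assoc, hn, ← Category.assoc]
        congr 1
        exact ((Equiv.ofBijective _ (bij M Y)).apply_symm_apply k).symm }

end CoringHom

/-! ### The bicomodule `h(D)` when `h` is right adjoint to induction -/

/-- A bijective morphism of bicomodules is an isomorphism. -/
def Bicomodule.isoOfBijective {A B : Type u} [Ring A] [Ring B] {C : Coring A} {D : Coring B}
    {P Q : Bicomodule C D} (τ : P ⟶ Q) (σ : Q → P) (h₁ : ∀ p, σ (τ.hom p) = p)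
    (h₂ : ∀ q, τ.hom (σ q) = q) : P ≅ Q :=
  have inj : Function.Injective τ.hom := Function.LeftInverse.injective h₁
  -- `σ` is a bare function; its additivity and linearity are pulled back along the injective `τ`.
  let i : BimodHom A B Q P :=
    { toFun := σ
      map_zero' := inj (by rw [h₂, map_zero])
      map_add' := fun x y => inj (by rw [h₂, map_add, h₂, h₂])
      map_smul' := fun a x => inj ((h₂ _).trans
        ((congrArg (a • ·) (h₂ x)).symm.trans (τ.hom.map_smul' a (σ x)).symm))
      map_op_smul' := fun b x => inj ((h₂ _).trans
        ((congrArg (b • ·) (h₂ x)).symm.trans (τ.hom.map_op_smul' b (σ x)).symm)) }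
  have hl : i.left.comp τ.hom.left = LinearMap.id := LinearMap.ext h₁
  have hr : i.right.comp τ.hom.right = LinearMap.id := LinearMap.ext h₁
  { hom := τ
    inv :=
      { hom := i
        commL := fun q => by
          rw [← h₂ q, ← τ.commL, ← lT_comp, hl, lT_id]
          exact congrArg P.coactL (h₁ (σ q)).symm
        commR := fun q => by
          rw [← h₂ q, ← τ.commR, ← rT_comp, hr, rT_id]
          exact congrArg P.coact (h₁ (σ q)).symm }
    hom_inv_id := Bicomodule.Hom.ext (DFunLike.ext _ _ h₁)
    inv_hom_id := Bicomodule.Hom.ext (DFunLike.ext _ _ h₂) }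

namespace CoringHom

variable {A B : Type u} [Ring A] [Ring B] {C : Coring A} {D : Coring B} {r : A →+* B}
  (φ : CoringHom C D r)

theorem coindCounit_smul_coindAux (b : B) (u : Tens A C C) :
    coindCounit C r D (b • φ.coindAux u) =
      b • φ.toAddMonoidHom (rid C (lT C C.counit.left u)) := by
  induction u using tens_induction with
  | zero => simp
  | add x y hx hy => simp only [map_add, smul_add, hx, hy]
  | tm c c' =>
    rw [coindAux_tm, smul_tm_left, coindCounit_tm_tm, Along.val_one, one_mul, lT_tm, rid_tm,
      φ.map_op_smul', ← smul_comm]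
    rfl

theorem coindCounit_coactBC_tm (b : Along r) (c : C) :
    coindCounit C r D (φ.coactBC (tm A b c)) = b.val • φ.toAddMonoidHom c := by
  rw [coactBC_tm, coindCounit_smul_coindAux]
  exact congrArg (fun c => b.val • φ.toAddMonoidHom c) (C.counit_right c)

theorem rT_coactBC (k : Tens A (Along r) C) :
    rT C φ.coactBC.right (C.regular.tensCoact (Along r) k) =
      (coindMod C r).tensCoact D (φ.coactBC k) :=
  (AddEquiv.eq_symm_apply _).2 (φ.coactBC_comm k)

/-- The semilinear map `B ⊗_A C → D`, `b ⊗ c ↦ b φ(c)`. -/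
def coindIndHom : IndHom φ (coindMod C r).toRightComod D.regular.toRightComod :=
  IndHom.ofCoind (M := (coindMod C r).toRightComod) (Y := D.regular.toRightComod)
    -- For `Y = D`, the left coaction of `B ⊗_A C` is itself the map into `D ⊗_B (B ⊗_A C)`, and the
    -- cotensor condition is its coassociativity.
    φ.coactBC.right φ.rT_coactBC fun k => (AddEquiv.eq_symm_apply _).2 (φ.coactBC_coassoc k)

theorem coindIndHom_tm (b : Along r) (c : C) :
    φ.coindIndHom.hom (tm A b c) = b.val • φ.toAddMonoidHom c := φ.coindCounit_coactBC_tm b c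

/-- A semilinear colinear map into `D` is seen through its composite with the counit of `D`. For
`coindIndHom` that composite is the cofree counit `B ⊗_A C → B`, which is why it is the universal
such map. -/
theorem counit_coindIndHom (k : Tens A (Along r) C) :
    D.counit (φ.coindIndHom.hom k) = (RightComod.tensCounit C (Along r) k).val := by
  refine tens_ext (D.counit.toAddMonoidHom.comp φ.coindIndHom.hom)
    (show _ →+ B from (RightComod.tensCounit C (Along r)).toAddMonoidHom) (fun b c => ?_) k
  refine (congrArg D.counit (φ.coindIndHom_tm b c)).trans ?_
  refine (D.counit.map_smul' b.val _).trans ?_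
  exact congrArg (b.val • ·) (φ.counit_map' c)

/-! ### The comparison `h(D) → B ⊗_A C` given by the counit of the adjunction -/

variable {φ} {N : Bicomodule C D} {h : RightComod D ⥤ ModuleCat.{u} Aᵐᵒᵖ}
  {adj : h ⊣ N.tensorFunctor} (adjR : φ.induction ⊣ cohomFunctor adj)

/-- The counit of the adjunction, as a semilinear map. -/
def counitHom (Y : RightComod D) : IndHom φ ((cohomFunctor adj).obj Y) Y :=
  IndHom.ofHom (adjR.counit.app Y)

theorem counitHom_naturality {Y Y' : RightComod D} (g : Y ⟶ Y') (z : h.obj Y) :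
    (counitHom adjR Y').hom ((h.map g).hom z) = g.lin ((counitHom adjR Y).hom z) :=
  LinearMap.congr_fun (congrArg RightComod.Hom.lin (adjR.counit.naturality g))
    (tm A (M := (cohomFunctor adj).obj Y) z (Along.one r))

/-- The counit at `D`, as a semilinear map on the bicomodule `h(D)`. -/
def cohomEval : Cohom adj →+ D := (counitHom adjR D.regular.toRightComod).hom

theorem cohomEval_op_smul (a : A) (z : Cohom adj) :
    cohomEval adjR (op a • z) = op (r a) • cohomEval adjR z :=
  (counitHom adjR D.regular.toRightComod).map_smul a z

theorem cohomEval_smul (b : B) (z : Cohom adj) : cohomEval adjR (b • z) = b • cohomEval adjR z :=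
  counitHom_naturality adjR (D.lmul b) z

theorem comul_cohomEval (z : Cohom adj) : D.comul (cohomEval adjR z) =
    mapAlong r (cohomEval adjR) φ.toAddMonoidHom (cohomEval_op_smul adjR) φ.map_smul'
      (cohomCoactR adj z) :=
  (counitHom adjR D.regular.toRightComod).comm z

/-- The map `h(D) → B` given by the counits of the adjunction and of `D`. -/
def cohomCounit : Cohom adj →ₗ[Aᵐᵒᵖ] Along r where
  toFun z := D.counit (cohomEval adjR z)
  map_add' x y := by rw [map_add, map_add]; rfl
  map_smul' a z := (congrArg D.counit (cohomEval_op_smul adjR (unop a) z)).trans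
    (D.counit.map_op_smul' (op (r (unop a))) (cohomEval adjR z))

theorem cohomCounit_smul (b : B) (z : Cohom adj) :
    cohomCounit adjR (b • z) = b • cohomCounit adjR z :=
  (congrArg D.counit (cohomEval_smul adjR b z)).trans (D.counit.map_smul' b (cohomEval adjR z))

/-- The bimodule map `h(D) → B ⊗_A C`. -/
def cohomToTensLeft : BimodHom B A (Cohom adj) (Tens A (Along r) C) where
  __ := (rT C (cohomCounit adjR)).comp (cohomCoactR adj).toAddMonoidHom
  map_smul' b z := (congrArg (rT C (cohomCounit adjR)) ((cohomCoactRBi adj).map_smul' b z)).trans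
    (rT_smul _ b (cohomCounit_smul adjR b) _)
  map_op_smul' a z := (congrArg (rT C (cohomCounit adjR)) ((cohomCoactR adj).map_smul a z)).trans
    (rT_op_smul _ a _)

theorem cohomToTensLeft_apply (z : Cohom adj) :
    cohomToTensLeft adjR z = rT C (cohomCounit adjR) (cohomCoactR adj z) := rfl

theorem tensCounit_cohomToTensLeft (z : Cohom adj) :
    RightComod.tensCounit C (Along r) (cohomToTensLeft adjR z) = cohomCounit adjR z := by
  rw [cohomToTensLeft_apply, RightComod.tensCounit_rT]
  exact congrArg _ (cohom_coact_counit adj z)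

/-- Coassociativity of `h(D)`: the comparison is the cofree extension of `cohomCounit`. -/
theorem cohomToTensLeft_comm (z : Cohom adj) :
    rT C (cohomToTensLeft adjR).right (cohomCoactR adj z) =
      C.regular.tensCoact (Along r) (cohomToTensLeft adjR z) := by
  have h₁ : C.regular.tensCoact (Cohom adj) (cohomCoactR adj z) =
      rT C (cohomCoactR adj) (cohomCoactR adj z) :=
    (AddEquiv.symm_apply_eq _).2 (cohom_coact_coassoc adj z).symm
  rw [cohomToTensLeft_apply, ← ModComod.rT_tensCoact, h₁, ← rT_comp]
  rfl

/-- Naturality of the adjunction counit along `d ↦ x ⊗ d`. It allows the left coaction of `h(D)`,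
known only through `upsilon`, to be evaluated. -/
theorem coindCounit_lT_cohomToTensLeft {X : Type u} [AddCommGroup X] [Module Bᵐᵒᵖ X]
    (t : Tens B X (Cohom adj)) : coindCounit C r X (lT X (cohomToTensLeft adjR).left t) =
      RightComod.tensCounit D X ((counitHom adjR (D.regular.tensObj X)).hom (upsilon adj X t)) := by
  refine tens_ext ((coindCounit C r X).comp (lT X (cohomToTensLeft adjR).left))
    ((RightComod.tensCounit D X).toAddMonoidHom.comp
      ((counitHom adjR (D.regular.tensObj X)).hom.comp (upsilon adj X).toAddMonoidHom))
    (fun x z => ?_) t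
  refine (congrArg (fun k : Along r => op k.val • x) (tensCounit_cohomToTensLeft adjR z)).trans ?_
  exact (congrArg (RightComod.tensCounit D X) (counitHom_naturality adjR (D.insHom x) z)).symm

theorem coindCounit_cohomCoactL (z : Cohom adj) :
    coindCounit C r D (lT D (cohomToTensLeft adjR).left (cohomCoactL adj z)) =
      cohomEval adjR z := by
  rw [coindCounit_lT_cohomToTensLeft, upsilon_cohomCoactL]
  refine (congrArg (RightComod.tensCounit D D) (counitHom_naturality adjR D.comulHom z)).trans ?_
  exact D.counit_right (cohomEval adjR z)

/-- Colinearity of the adjunction counit expresses `Δ(cohomEval z)` through the right coaction of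
`z`; the left counit law of `D` then recovers `cohomEval z`. -/
theorem coindIndHom_cohomToTensLeft (z : Cohom adj) :
    φ.coindIndHom.hom (cohomToTensLeft adjR z) = cohomEval adjR z := by
  have h₁ (u : Tens A (Cohom adj) C) : φ.coindIndHom.hom (rT C (cohomCounit adjR) u) =
      lid D (rT D D.counit.right (mapAlong r (cohomEval adjR) φ.toAddMonoidHom
        (cohomEval_op_smul adjR) φ.map_smul' u)) :=
    tens_ext (φ.coindIndHom.hom.comp (rT C (cohomCounit adjR)))
      ((lid D).comp ((rT D D.counit.right).comp (mapAlong r (cohomEval adjR) φ.toAddMonoidHom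
        (cohomEval_op_smul adjR) φ.map_smul'))) (fun z c => φ.coindIndHom_tm _ c) u
  rw [cohomToTensLeft_apply, h₁, ← comul_cohomEval]
  exact D.counit_left _

/-- Both sides are `C`-comodule maps from `h(D)` to the cofree comodule `D ⊗_B (B ⊗_A C)`, and their
composites with its counit are both `cohomEval`. Hence they coincide. -/
theorem cohomToTensLeft_commL (z : Cohom adj) :
    lT D (cohomToTensLeft adjR).left (cohomCoactL adj z) = φ.coactBC (cohomToTensLeft adjR z) := by
  have h₁ := coindExt_coact (M := (cohomFunctor adj).obj D.regular.toRightComod)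
    ((lTr D (cohomToTensLeft adjR)).comp (cohomCoactL adj)) (fun z => by
      refine (rT_comp (N := C) (cohomCoactL adj) (lTr D (cohomToTensLeft adjR)) _).trans ?_
      refine (congrArg _ (toTensCohom_comm adj D.regular.toRightComod z)).trans ?_
      exact ModComod.lT_comm (P := (cohomBicomodule adj).toModComod) (Q := coindMod C r)
        (cohomToTensLeft adjR) (cohomToTensLeft_comm adjR) (cohomCoactL adj z))
    (cohomEval adjR) (cohomEval_op_smul adjR) (coindCounit_cohomCoactL adjR) z
  have h₂ := coindExt_coact (M := (cohomFunctor adj).obj D.regular.toRightComod)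
    (φ.coactBC.right.comp (cohomToTensLeft adjR).right) (fun z => by
      refine (rT_comp (N := C) (cohomToTensLeft adjR).right φ.coactBC.right _).trans ?_
      refine (congrArg _ (cohomToTensLeft_comm adjR z)).trans ?_
      exact φ.rT_coactBC (cohomToTensLeft adjR z))
    (cohomEval adjR) (cohomEval_op_smul adjR) (coindIndHom_cohomToTensLeft adjR) z
  exact h₁.trans h₂.symm

/-- The comodule map `B ⊗_A C → h(D)`. -/
def tensLeftToCohom :
    (coindMod C r).toRightComod ⟶ (cohomFunctor adj).obj D.regular.toRightComod :=
  adjR.homEquiv _ _ φ.coindIndHom.toHom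

theorem cohomEval_tensLeftToCohom (k : Tens A (Along r) C) :
    cohomEval adjR ((tensLeftToCohom adjR).lin k) = φ.coindIndHom.hom k := by
  have h₁ : φ.induction.map (tensLeftToCohom adjR) ≫ adjR.counit.app D.regular.toRightComod =
      φ.coindIndHom.toHom :=
    (adjR.homEquiv_counit ..).symm.trans ((adjR.homEquiv _ _).symm_apply_apply _)
  exact (LinearMap.congr_fun (congrArg RightComod.Hom.lin h₁) (tm A k (Along.one r))).trans
    (φ.coindIndHom.lin_tm_one k)

/-- A comodule endomorphism of the cofree `B ⊗_A C` is the identity once it fixes the counit, which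
holds by `counit_coindIndHom`. -/
theorem cohomToTensLeft_tensLeftToCohom (k : Tens A (Along r) C) :
    cohomToTensLeft adjR ((tensLeftToCohom adjR).lin k) = k := by
  have h₁ : (cohomCounit adjR).comp (tensLeftToCohom adjR).lin =
      RightComod.tensCounit C (Along r) := LinearMap.ext fun k =>
    (congrArg D.counit (cohomEval_tensLeftToCohom adjR k)).trans (φ.counit_coindIndHom k)
  have h₂ := (tensLeftToCohom adjR).comm k
  refine (congrArg (rT C (cohomCounit adjR)) h₂.symm).trans ?_
  refine (rT_comp (N := C) (tensLeftToCohom adjR).lin (cohomCounit adjR) _).symm.trans ?_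
  refine (congrArg (fun l => rT C l (C.regular.tensCoact (Along r) k)) h₁).trans ?_
  exact RightComod.rT_tensCounit k

/-- Uniqueness in the adjunction: the composite and the identity of `h(D)` have the same transpose,
the counit at `D`. -/
theorem tensLeftToCohom_cohomToTensLeft (z : Cohom adj) :
    (tensLeftToCohom adjR).lin (cohomToTensLeft adjR z) = z := by
  let τ : (cohomFunctor adj).obj D.regular.toRightComod ⟶ (coindMod C r).toRightComod :=
    ⟨(cohomToTensLeft adjR).right, cohomToTensLeft_comm adjR⟩
  have h₁ : τ ≫ tensLeftToCohom adjR = 𝟙 _ := by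
    apply (adjR.homEquiv _ _).symm.injective
    rw [adjR.homEquiv_counit, adjR.homEquiv_counit]
    exact hom_ext_one fun z => (cohomEval_tensLeftToCohom adjR _).trans
      (coindIndHom_cohomToTensLeft adjR z)
  exact LinearMap.congr_fun (congrArg RightComod.Hom.lin h₁) z

/-- If `h` is right adjoint to induction, then `h(D) ≅ B ⊗_A C` as bicomodules. -/
def cohomIso : cohomBicomodule adj ≅ φ.tensLeft :=
  Bicomodule.isoOfBijective
    (⟨cohomToTensLeft adjR, cohomToTensLeft_commL adjR, cohomToTensLeft_comm adjR⟩ :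
      cohomBicomodule adj ⟶ φ.tensLeft)
    (tensLeftToCohom adjR).lin (tensLeftToCohom_cohomToTensLeft adjR)
    (cohomToTensLeft_tensLeftToCohom adjR)

end CoringHom

end

/-! ### The two implications -/

namespace CoringHom

variable {A B : Type u} [Ring A] [Ring B] {C : Coring A} {D : Coring B} {r : A →+* B}
  {φ : CoringHom C D r}

/-- The two-sided adjoint is the lifted co-hom functor. Only the preservation of canonical
equalizers is asked here, so that the injector and the coseparable cases share the argument. -/
theorem isFrobeniusFunctor_induction (hC : C.IsLeftFlat) [φ.tensRight.IsQuasiFinite]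
    (hc : PreservesCanonical φ.tensRight.tensorFunctor.leftAdjoint)
    (e : φ.tensRight.cohom ≅ φ.tensLeft) : IsFrobeniusFunctor φ.induction :=
  ⟨_, ⟨inductionAdj e hC hc⟩,
    ⟨φ.cohomAdj (Adjunction.ofIsRightAdjoint φ.tensRight.tensorFunctor)⟩⟩

theorem exists_of_isFrobeniusFunctor (hC : C.IsLeftFlat) (h : IsFrobeniusFunctor φ.induction) :
    ∃ _ : φ.tensRight.IsQuasiFinite, φ.tensRight.IsInjector ∧
      Nonempty (φ.tensRight.cohom ≅ φ.tensLeft) := by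
  obtain ⟨G, ⟨adj₁⟩, ⟨adj₂⟩⟩ := h
  have adjN : G ⋙ RightComod.forget C ⊣ φ.tensRight.tensorFunctor :=
    (adj₂.comp (RightComod.forgetAdj C)).ofNatIsoRight φ.tensRightIso
  -- As a right adjoint `G` preserves monomorphisms, and by flatness of `C` the forgetful functor
  -- does too. So the left adjoint of `- ⊗_A N` does, which gives the injector property.
  have := Functor.preservesMonomorphisms_of_adjunction adj₁
  have := RightComod.forget_preservesMonomorphisms hC
  have : φ.tensRight.IsQuasiFinite := adjN.isRightAdjoint
  let adj := Adjunction.ofIsRightAdjoint φ.tensRight.tensorFunctor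
  exact ⟨this, Functor.preservesInjectiveObjects_of_adjunction_of_preservesMonomorphisms adjN,
    -- `G` and the lifted `h` are both left adjoint to induction, hence isomorphic; this transports
    -- the adjunction `F ⊣ G` to the chosen `h`.
    ⟨cohomIso (adj := adj) (adj₁.ofNatIsoRight (adj₂.leftAdjointUniq (φ.cohomAdj adj)))⟩⟩

end CoringHom

end Corings

open Corings in
theorem theorem23 {k : Type*} [CommRing k] {A B : Type u} [Ring A] [Ring B] [Algebra k A]
    [Algebra k B] (C : Coring A) (D : Coring B) (hCk : C.IsCentralOver k)
    (hDk : D.IsCentralOver k) (ρ : A →ₐ[k] B) (φ : CoringHom C D (ρ : A →+* B))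
    (hC : C.IsLeftFlat) (hD : D.IsLeftFlat) :
    (IsFrobeniusFunctor φ.induction ↔
      ∃ _ : φ.tensRight.IsQuasiFinite, φ.tensRight.IsInjector ∧
        Nonempty (φ.tensRight.cohom ≅ φ.tensLeft)) ∧
    (C.IsCoseparable → D.IsCoseparable →
      (IsFrobeniusFunctor φ.induction ↔
        ∃ _ : φ.tensRight.IsQuasiFinite, Nonempty (φ.tensRight.cohom ≅ φ.tensLeft))) := by
  refine ⟨⟨CoringHom.exists_of_isFrobeniusFunctor hC, fun ⟨_, _, ⟨e⟩⟩ => ?_⟩,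
    fun _ hDc => ⟨fun h => ?_, fun ⟨_, ⟨e⟩⟩ => ?_⟩⟩
  · exact CoringHom.isFrobeniusFunctor_induction hC
      (preservesCanonical_of_preservesInjectiveObjects (Adjunction.ofIsRightAdjoint _)) e
  · obtain ⟨hq, _, e⟩ := CoringHom.exists_of_isFrobeniusFunctor hC h
    exact ⟨hq, e⟩
  · exact CoringHom.isFrobeniusFunctor_induction hC
      (preservesCanonical_of_isCoseparable hDc _) e
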